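/- **Setting.** Let $d\in\{2,3\}$, $\Omega=[0,\ell]^d$ with $\ell>0$, $T>0$, and let $L_1>0$, $L_2+L_3\ge 0$ (with $L_2+L_3=0$ if $d=3$), $a\in\mathbb R$, $b\ge 0$, $c>0$. Put $L=L_1+\frac{L_2+L_3}{2}$. Let $\mathcal S^{(d)}$ be the space of symmetric traceless real $d\times d$ matrices, $|\cdot|_F$ the Frobenius norm, and for $Q\in\mathcal S^{(d)}$ $$F(Q)=\tfrac a2\operatorname{tr}(Q^2)-\tfrac b3\operatorname{tr}(Q^3)+\tfrac c4\operatorname{tr}^2(Q^2),\qquad f(Q)=-aQ+b\big(Q^2-\tfrac1d\operatorname{tr}(Q^2)I\big)-c\operatorname{tr}(Q^2)Q .$$ Let $C_*>0$ be a constant with $\ell^dF(A)\ge -C_*$ for all $A\in\mathcal S^{(d)}$. Let $Q_e:[0,T]\times\Omega\to\mathcal S^{(d)}$ be of class $C^4$ up to the boundary, $Q_e=0$ on $[0,T]\times\partial\Omega$, and, for $t\in(0,T)$, $x$ in the interior of $\Omega$ and $1\le i,j\le d$, $$\partial_tQ^{ij}=L_1\Delta Q^{ij}+\frac{L_2+L_3}{2}\Big(\sum_k(\partial_j\partial_kQ^{ik}+\partial_i\partial_kQ^{jk})-\frac2d\sum_{k,l}\partial_l\partial_kQ^{lk}\delta^{ij}\Big)+f(Q)^{ij}.$$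 Put $Q^0=Q_e(0)$ and $s_e(t)=\int_\Omega F(Q_e(t,x))\,dx$. **Stabilization.** With $\|Q^0\|_\infty=\sup_{x\in\Omega}|Q^0(x)|_F$ let $\eta=\max\{\|Q^0\|_\infty,\sqrt{\max(0,-a)/c}\}$ if $d=2$; if $d=3$ let $\eta=\max\{\|Q^0\|_\infty,\frac{|b|+\sqrt{b^2-24ac}}{2\sqrt6\,c}\}$ when $a\le\frac{b^2}{24c}$ and $\eta=\|Q^0\|_\infty$ otherwise. Let $\bar f(\xi)=-a\xi+\frac{b}{\sqrt6}\xi^2-c\xi^3$, the $b$-term being omitted if $d=2$. The parameter $\kappa$ satisfies $\kappa\ge\max\{a+c\eta^2,\ \max_{\xi\in[0,\eta]}|\bar f'(\xi)|\}$. **Grid.** For an integer $M\ge1$ let $h=\ell/M$, with nodes $ph$, $p\in\{0,\dots,M\}^d$. Grid functions $U$ with values in $\mathcal S^{(d)}$ vanish at boundary nodes (and ghost nodes); $\langle U,V\rangle_h=h^d\sum_{p}U_p:V_p$ over the interior nodes, $\|U\|_h^2=\langle U,U\rangle_h$, $\Delta_h$ is the standard $(2d+1)$-point Laplacian, and $\|\nabla_hU\|_h^2=h^d\sum_{k}\sum_{p}\big|\frac{U_{p+e_k}-U_p}{h}\big|_F^2$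 over $p\in\{0,\dots,M-1\}^d$, so that $\langle\Delta_hU,U\rangle_h=-\|\nabla_hU\|_h^2$. Put $\mathcal E_{1h}[U]=h^d\sum_{p\text{ interior}}F(U_p)$, $E_{el}[U]=\frac L2\|\nabla_hU\|_h^2$ and $g(U,s)=\exp(s)/\exp(\mathcal E_{1h}[U])$. **Schemes.** Let $\tau>0$. Initial values: $Q_h^0$ is the restriction of $Q^0$ to the nodes and $s^0=\mathcal E_{1h}[Q_h^0]$. Equations for grid functions hold at the interior nodes. *MBP-sESAV1*, $[Q^{n+1}_h,s^{n+1}]=\mathrm{MBP\text{-}sESAV1}(Q_h^n,s^n,\tau)$: with $g^n=g(Q_h^n,s^n)$, $$\tfrac{Q_h^{n+1}-Q_h^n}{\tau}=L\Delta_hQ_h^{n+1}+g^n\big(f(Q_h^n)-\kappa(Q_h^{n+1}-Q_h^n)\big),$$ $$\tilde s^{n+1}=s^n-g^n\langle f(Q_h^n),Q_h^{n+1}-Q_h^n\rangle_h,\qquad s^{n+1}=\max\{\tilde s^{n+1},-C_*-E_{el}[Q_h^{n+1}]\}.$$ *MBP-sESAV2*: let $[Q_*,s_*]=\mathrm{MBP\text{-}sESAV1}(Q_h^n,s^n,\tau/2)$,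 $g_*=g(Q_*,s_*)$, $Q_h^{n+1/2}=\frac12(Q_h^{n+1}+Q_h^n)$ and $$\tfrac{Q_h^{n+1}-Q_h^n}{\tau}=L\Delta_hQ_h^{n+1/2}+g_*\big(f(Q_*)-\kappa(Q_h^{n+1/2}-Q_*)\big),$$ $$\tilde s^{n+1}=s^n-g_*\langle f(Q_*),Q_h^{n+1}-Q_h^n\rangle_h+\kappa g_*\langle Q_h^{n+1/2}-Q_*,Q_h^{n+1}-Q_h^n\rangle_h,$$ $$s^{n+1}=\max\{\tilde s^{n+1},-C_*-E_{el}[Q_h^{n+1}]\}.$$ **Theorem.** There is a constant $C>0$, depending on $Q_e,T,\ell,d,L_1,L_2,L_3,a,b,c,\kappa,C_*$ but not on $M$, $\tau$ or $n$, such that the following holds. Let $M\ge1$ and $\tau>0$ satisfy $$\tau\le\Big(\frac{\kappa G^*}{2}+\frac{2^{d-1}L}{h^2}\Big)^{-1},\qquad G^*=\exp\{E_{el}[Q_h^0]+\mathcal E_{1h}[Q_h^0]+C_*\},$$ and let $(Q_h^n,s^n)_{n\ge0}$ be the solution of MBP-sESAV$p$, $p\in\{1,2\}$. Then the errors $e_Q^n=Q_h^n-Q_e(n\tau)$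 (at the nodes) and $e_s^n=s^n-s_e(n\tau)$ satisfy $$\|e_Q^n\|_h+\|\nabla_he_Q^n\|_h+|e_s^n|\le C(\tau^p+h^2),\qquad 0\le n\le\lfloor T/\tau\rfloor .$$ -/

import Mathlib

noncomputable section

namespace QTensorFlow

/-- The numerical data: elastic constants `L₁, L₂, L₃`, bulk constants `a, b, c`, side length `ℓ` of
the domain `[0, ℓ]^d`, stabilizing parameter `κ`, and the constant `Cstar` used in the cut-off of the
auxiliary variable. -/
structure Params where
  L₁ : ℝ
  L₂ : ℝ
  L₃ : ℝ
  a : ℝ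
  b : ℝ
  c : ℝ
  ℓ : ℝ
  κ : ℝ
  Cstar : ℝ

/-- The effective elastic constant `L = L₁ + (L₂ + L₃) / 2`. -/
def Params.L (P : Params) : ℝ := P.L₁ + (P.L₂ + P.L₃) / 2

/-! ### Tensors and the bulk energy -/

/-- Symmetric traceless `d × d` matrices. -/
def IsQTensor {d : ℕ} (A : Matrix (Fin d) (Fin d) ℝ) : Prop := A.trace = 0 ∧ A.IsSymm

/-- The Frobenius norm. -/
def frobNorm {d : ℕ} (A : Matrix (Fin d) (Fin d) ℝ) : ℝ := √(∑ i, ∑ j, A i j ^ 2)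

/-- The bulk free energy density. -/
def bulkDensity {d : ℕ} (P : Params) (A : Matrix (Fin d) (Fin d) ℝ) : ℝ :=
  P.a / 2 * (A ^ 2).trace - P.b / 3 * (A ^ 3).trace + P.c / 4 * (A ^ 2).trace ^ 2

/-- The bulk force `f(A) = -a A + b (A² - tr(A²) I / d) - c tr(A²) A`. -/
def bulkForce {d : ℕ} (P : Params) (A : Matrix (Fin d) (Fin d) ℝ) : Matrix (Fin d) (Fin d) ℝ :=
  -(P.a • A) + P.b • (A ^ 2 - ((A ^ 2).trace / (d : ℝ)) • (1 : Matrix (Fin d) (Fin d) ℝ))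
    - (P.c * (A ^ 2).trace) • A

/-! ### The continuous problem -/

/-- The closed cube `[0, ℓ]^d`. -/
def cube (d : ℕ) (ℓ : ℝ) : Set (Fin d → ℝ) := Set.Icc 0 (fun _ => ℓ)

/-- The bulk energy of a tensor field on the cube. -/
def bulkEnergy {d : ℕ} (P : Params) (Q : (Fin d → ℝ) → Matrix (Fin d) (Fin d) ℝ) : ℝ :=
  ∫ x in cube d P.ℓ, bulkDensity P (Q x)

/-- The partial derivative in the `k`-th coordinate direction. -/
def partialDeriv {d : ℕ} (k : Fin d) (u : (Fin d → ℝ) → ℝ) (x : Fin d → ℝ) : ℝ :=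
  fderiv ℝ u x (Pi.single k 1)

/-- A solution of the `Q`-tensor flow on `[0, T] × [0, ℓ]^d` with homogeneous Dirichlet boundary
condition, which is of class `C⁴` up to the boundary of the space-time cylinder. -/
structure IsExactSolution {d : ℕ} (P : Params) (T : ℝ)
    (Q : ℝ → (Fin d → ℝ) → Matrix (Fin d) (Fin d) ℝ) : Prop where
  smooth : ∀ i j, ContDiffOn ℝ 4 (fun z : ℝ × (Fin d → ℝ) => Q z.1 z.2 i j)
    (Set.Icc 0 T ×ˢ cube d P.ℓ)
  isQTensor : ∀ t ∈ Set.Icc 0 T, ∀ x ∈ cube d P.ℓ, IsQTensor (Q t x)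
  dirichlet : ∀ t ∈ Set.Icc 0 T, ∀ x ∈ cube d P.ℓ, (∃ k, x k = 0 ∨ x k = P.ℓ) → Q t x = 0
  evolution : ∀ t ∈ Set.Ioo 0 T, ∀ x : Fin d → ℝ, (∀ k, x k ∈ Set.Ioo 0 P.ℓ) → ∀ i j,
    deriv (fun r => Q r x i j) t =
      P.L₁ * (∑ k, partialDeriv k (partialDeriv k (fun y => Q t y i j)) x)
      + (P.L₂ + P.L₃) / 2 *
        ((∑ k, (partialDeriv j (partialDeriv k (fun y => Q t y i k)) x
            + partialDeriv i (partialDeriv k (fun y => Q t y j k)) x))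
          - 2 / (d : ℝ) * (∑ k, ∑ l, partialDeriv l (partialDeriv k (fun y => Q t y l k)) x)
            * (if i = j then 1 else 0))
      + bulkForce P (Q t x) i j

/-! ### The maximum bound and the condition on the stabilizing parameter -/

/-- The `L^∞` norm over the cube, `sup_x |Q(x)|_F`. -/
def supNorm {d : ℕ} (ℓ : ℝ) (Q : (Fin d → ℝ) → Matrix (Fin d) (Fin d) ℝ) : ℝ :=
  ⨆ x : cube d ℓ, frobNorm (Q x)

/-- The maximum bound `η^(d)` attached to the initial field `Q₀`, for `d = 2` and `d = 3`. -/
def maxBound {d : ℕ} (P : Params) (Q₀ : (Fin d → ℝ) → Matrix (Fin d) (Fin d) ℝ) : ℝ :=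
  if d = 2 then max (supNorm P.ℓ Q₀) (√(max 0 (-P.a) / P.c))
  else if P.a ≤ P.b ^ 2 / (24 * P.c) then
    max (supNorm P.ℓ Q₀) ((|P.b| + √(P.b ^ 2 - 24 * P.a * P.c)) / (2 * √6 * P.c))
  else supNorm P.ℓ Q₀

/-- The scalar function `-a ξ + (b / √6) ξ² - c ξ³`; for `d = 2`, where the cubic bulk term vanishes
identically on symmetric traceless matrices, the `b`-term is absent. -/
def scalarForce (d : ℕ) (P : Params) (ξ : ℝ) : ℝ :=
  -P.a * ξ + (if d = 2 then 0 else P.b) / √6 * ξ ^ 2 - P.c * ξ ^ 3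

/-- The condition on the stabilizing parameter:
`κ ≥ max {a + c η², max_{ξ ∈ [0, η]} |f̄'(ξ)|}`. -/
def StabilizationCondition {d : ℕ} (P : Params)
    (Q₀ : (Fin d → ℝ) → Matrix (Fin d) (Fin d) ℝ) : Prop :=
  P.a + P.c * maxBound P Q₀ ^ 2 ≤ P.κ ∧
    ∀ ξ ∈ Set.Icc 0 (maxBound P Q₀), |deriv (scalarForce d P) ξ| ≤ P.κ

/-! ### Grid functions -/

/-- Tensor-valued grid functions. The integer vector `p` stands for the node `p h`; grid functions are
indexed by all of `ℤ^d` so that ghost nodes are available. -/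
abbrev GridTensor (d : ℕ) := (Fin d → ℤ) → Matrix (Fin d) (Fin d) ℝ

/-- The interior nodes `1 ≤ p_k ≤ M - 1`. -/
def interiorNodes (d M : ℕ) : Finset (Fin d → ℤ) :=
  Fintype.piFinset fun _ => Finset.Ioo 0 (M : ℤ)

/-- The nodes `0 ≤ p_k ≤ M - 1`. -/
def cellNodes (d M : ℕ) : Finset (Fin d → ℤ) :=
  Fintype.piFinset fun _ => Finset.Ico 0 (M : ℤ)

/-- Symmetric traceless grid functions vanishing at the boundary nodes and at the ghost nodes. -/
def IsGridQTensor {d : ℕ} (M : ℕ) (Φ : GridTensor d) : Prop :=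
  (∀ p, IsQTensor (Φ p)) ∧ ∀ p, p ∉ interiorNodes d M → Φ p = 0

/-- The forward difference `(Φ(p + e_k) - Φ(p)) / h`, located at `p + e_k / 2`. -/
def forwardDiff {d : ℕ} (h : ℝ) (k : Fin d) (Φ : GridTensor d) : GridTensor d :=
  fun p => h⁻¹ • (Φ (p + Pi.single k 1) - Φ p)

/-- The discrete Laplacian: the backward difference of the forward difference, summed over the
coordinate directions. -/
def discLaplacian {d : ℕ} (h : ℝ) (Φ : GridTensor d) : GridTensor d :=
  fun p => ∑ k, h⁻¹ • (forwardDiff h k Φ p - forwardDiff h k Φ (p - Pi.single k 1))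

/-- The discrete `L²` inner product `h^d ∑_p Φ(p) : Ψ(p)` over the interior nodes. -/
def gridInner {d : ℕ} (h : ℝ) (M : ℕ) (Φ Ψ : GridTensor d) : ℝ :=
  h ^ d * ∑ p ∈ interiorNodes d M, ∑ i, ∑ j, Φ p i j * Ψ p i j

/-- The discrete `L²` norm. -/
def gridNorm {d : ℕ} (h : ℝ) (M : ℕ) (Φ : GridTensor d) : ℝ := √(gridInner h M Φ Φ)

/-- The discrete `H¹` seminorm `‖∇_h Φ‖_h`. Every edge of the grid that leaves an interior node, in
particular one that ends at the boundary, has weight one, so that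
`⟨Δ_h U, V⟩_h = -[∇_h U, ∇_h V]_h` for grid functions vanishing at the boundary. -/
def gradNorm {d : ℕ} (h : ℝ) (M : ℕ) (Φ : GridTensor d) : ℝ :=
  √(h ^ d * ∑ k, ∑ p ∈ cellNodes d M, ∑ i, ∑ j, forwardDiff h k Φ p i j ^ 2)

/-- The discrete bulk energy. -/
def discBulkEnergy {d : ℕ} (P : Params) (M : ℕ) (Φ : GridTensor d) : ℝ :=
  (P.ℓ / M) ^ d * ∑ p ∈ interiorNodes d M, bulkDensity P (Φ p)

/-- The discrete elastic energy `(L / 2) ‖∇_h Φ‖_h²`. -/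
def discElasticEnergy {d : ℕ} (P : Params) (M : ℕ) (Φ : GridTensor d) : ℝ :=
  P.L / 2 * gradNorm (P.ℓ / M) M Φ ^ 2

/-- The factor `g(Φ, s) = exp(s) / exp(E_{1h}[Φ])`. -/
def expRatio {d : ℕ} (P : Params) (M : ℕ) (Φ : GridTensor d) (s : ℝ) : ℝ :=
  Real.exp s / Real.exp (discBulkEnergy P M Φ)

/-- The bulk force applied at every node. -/
def gridForce {d : ℕ} (P : Params) (Φ : GridTensor d) : GridTensor d := fun p => bulkForce P (Φ p)

/-! ### The schemes (mesh size `h = ℓ / M`) -/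

/-- `(Q', s')` is obtained from `(Q, s)` by one step of the first-order scheme MBP-sESAV1 with step
size `τ`. -/
def FirstOrderStep {d : ℕ} (P : Params) (M : ℕ) (τ : ℝ)
    (Q : GridTensor d) (s : ℝ) (Q' : GridTensor d) (s' : ℝ) : Prop :=
  IsGridQTensor M Q' ∧
  (∀ p ∈ interiorNodes d M,
    τ⁻¹ • (Q' p - Q p) = P.L • discLaplacian (P.ℓ / M) Q' p
      + expRatio P M Q s • (bulkForce P (Q p) - P.κ • (Q' p - Q p))) ∧
  s' = max (s - expRatio P M Q s * gridInner (P.ℓ / M) M (gridForce P Q) (Q' - Q))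
    (-P.Cstar - discElasticEnergy P M Q')

/-- `(Q', s')` is obtained from `(Q, s)` by one step of the second-order scheme MBP-sESAV2 with step
size `τ`; the predictor `(Qs, ss)` at the half step is one step of the first-order scheme with step
size `τ / 2`. -/
def SecondOrderStep {d : ℕ} (P : Params) (M : ℕ) (τ : ℝ)
    (Q : GridTensor d) (s : ℝ) (Q' : GridTensor d) (s' : ℝ) : Prop :=
  ∃ (Qs : GridTensor d) (ss : ℝ), FirstOrderStep P M (τ / 2) Q s Qs ss ∧
  IsGridQTensor M Q' ∧
  (∀ p ∈ interiorNodes d M,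
    τ⁻¹ • (Q' p - Q p) = P.L • discLaplacian (P.ℓ / M) ((1 / 2 : ℝ) • (Q' + Q)) p
      + expRatio P M Qs ss •
        (bulkForce P (Qs p) - P.κ • ((1 / 2 : ℝ) • (Q' p + Q p) - Qs p))) ∧
  s' = max
    (s - expRatio P M Qs ss * gridInner (P.ℓ / M) M (gridForce P Qs) (Q' - Q)
      + P.κ * expRatio P M Qs ss
        * gridInner (P.ℓ / M) M ((1 / 2 : ℝ) • (Q' + Q) - Qs) (Q' - Q))
    (-P.Cstar - discElasticEnergy P M Q')

/-- The initial values: the nodal values of `Q₀`, and the discrete bulk energy. -/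
def IsInitialValue {d : ℕ} (P : Params) (M : ℕ)
    (Q₀ : (Fin d → ℝ) → Matrix (Fin d) (Fin d) ℝ) (Φ : GridTensor d) (s : ℝ) : Prop :=
  IsGridQTensor M Φ ∧
  (∀ p ∈ interiorNodes d M, Φ p = Q₀ (fun k => (p k : ℝ) * (P.ℓ / M))) ∧
  s = discBulkEnergy P M Φ

/-- The bound `G^* = exp(E_h[Φ, E_{1h}[Φ]] + C_*)` of the factor `g`, where `Φ` is the initial grid
function and `E_h[Φ, s] = (L / 2) ‖∇_h Φ‖_h² + s`. -/
def ratioBound {d : ℕ} (P : Params) (M : ℕ) (Φ : GridTensor d) : ℝ :=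
  Real.exp (discElasticEnergy P M Φ + discBulkEnergy P M Φ + P.Cstar)

/-- The error `Φ - Q` at the grid nodes, for a tensor field `Q` on the cube. -/
def gridError {d : ℕ} (P : Params) (M : ℕ) (Φ : GridTensor d)
    (Q : (Fin d → ℝ) → Matrix (Fin d) (Fin d) ℝ) : GridTensor d :=
  fun p => Φ p - Q (fun k => (p k : ℝ) * (P.ℓ / M))

/-- The total error `‖e_Q‖_h + ‖∇_h e_Q‖_h + |e_s|` of `(Φ, s)` with respect to `Q` and
`E₁[Q]`. -/
def totalError {d : ℕ} (P : Params) (M : ℕ) (Φ : GridTensor d) (s : ℝ)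
    (Q : (Fin d → ℝ) → Matrix (Fin d) (Fin d) ℝ) : ℝ :=
  gridNorm (P.ℓ / M) M (gridError P M Φ Q) + gradNorm (P.ℓ / M) M (gridError P M Φ Q)
    + |s - bulkEnergy P Q|

end QTensorFlow

end

noncomputable section

namespace QTensorFlow

open scoped Matrix.Norms.Frobenius

/-! ### Tensor algebra -/

/-! The elastic terms collapse to `P.L` times the Laplacian: for d = 2 because the field is
symmetric and traceless (`elastic_two`), for d = 3 because L₂ + L₃ = 0. The flow becomes ∂ₜQ = LΔQ +
f(Q), where f is minus the gradient of F in the space of Q-tensors, and the schemes discretize this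
equation with f multiplied by a factor g that should be 1.

Stability comes first. The condition on κ makes A ↦ f(A) + κA map the ball of radius η into the ball
of radius κη (`norm_bulkForce_add_smul_le`), and the discrete Laplacian points inwards at a maximum
of the norm; hence every iterate stays in the ball of radius η. The explicit half of the
Crank-Nicolson step needs the step size condition here and nowhere else. Pairing a scheme with its
increment shows that the modified energy E_el + s does not grow. Together these invariants
(`IsAdmissible`) bound g uniformly and confine all tensors to a fixed ball, on which f is bounded
and Lipschitz.

The auxiliary variable is compared with E₁ₕ[Qⁿ] rather than with the exact energy. Its defect σ = |s
− E₁ₕ[Qⁿ]| controls |g − 1|, because g = exp(s − E₁ₕ[Qⁿ]). The update of s is a discrete chain rule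
for E₁ₕ, so one step changes the defect only by a Taylor remainder, quadratic in the increment for
the first scheme and cubic for the second (`bulkDensity_sub_midpoint`), and by terms containing g −
1 or the distance of the predictor from the midpoint. The cut-off is harmless, since its threshold
lies below E₁ₕ.

Let x and w be the discrete L² and H¹ errors and δ the norm of the difference quotient of the error.
Pairing the error equation with the increment of the error (`energy_estimate`) controls w and gives
τδ² on the good side. This absorbs the δ that appears in the bounds for x and σ, and a weighted
Gronwall argument (`ErrorStep`, `exists_gronwall_const`) closes. The right-hand side contains only
old values, so no smallness of τ is needed. For the second scheme, one Euler step gains a power of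
τ, so the predictor is accurate to second order whenever the data are.

The consistency errors are Taylor remainders on the closed space-time cylinder, with the equation
used only at midpoint times. Finally E₁ₕ of the exact solution differs from E₁ by O(h²): this is the
midpoint rule on dual cells, while in the boundary layer F(Q) is itself O(h²) because Q vanishes on
the boundary. -/

/-- The Frobenius inner product `A : B`. -/
def frobInner {d : ℕ} (A B : Matrix (Fin d) (Fin d) ℝ) : ℝ := ∑ i, ∑ j, A i j * B i j

section Tensor

variable {d : ℕ} {A B : Matrix (Fin d) (Fin d) ℝ}

lemma frobNorm_eq_norm (A : Matrix (Fin d) (Fin d) ℝ) : frobNorm A = ‖A‖ := by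
  rw [frobNorm, Matrix.frobenius_norm_def, Real.sqrt_eq_rpow]
  simp

lemma norm_sq_eq_sum (A : Matrix (Fin d) (Fin d) ℝ) : ‖A‖ ^ 2 = ∑ i, ∑ j, A i j ^ 2 := by
  rw [← frobNorm_eq_norm, frobNorm, Real.sq_sqrt (by positivity)]

lemma frobInner_self (A : Matrix (Fin d) (Fin d) ℝ) : frobInner A A = ‖A‖ ^ 2 := by
  rw [norm_sq_eq_sum]; simp only [frobInner, sq]

lemma frobInner_eq_sum_prod (A B : Matrix (Fin d) (Fin d) ℝ) :
    frobInner A B = ∑ q : Fin d × Fin d, A q.1 q.2 * B q.1 q.2 := by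
  rw [frobInner, Fintype.sum_prod_type]

lemma abs_frobInner_le (A B : Matrix (Fin d) (Fin d) ℝ) : |frobInner A B| ≤ ‖A‖ * ‖B‖ := by
  apply abs_le_of_sq_le_sq _ (by positivity)
  have := Finset.sum_mul_sq_le_sq_mul_sq Finset.univ
    (fun q : Fin d × Fin d => A q.1 q.2) (fun q => B q.1 q.2)
  rw [mul_pow, ← frobInner_self A, ← frobInner_self B]
  simp only [frobInner_eq_sum_prod, ← sq]
  exact this

lemma frobInner_add_left (A B C : Matrix (Fin d) (Fin d) ℝ) :
    frobInner (A + B) C = frobInner A C + frobInner B C := by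
  simp [frobInner, add_mul, Finset.sum_add_distrib]

lemma frobInner_sub_left (A B C : Matrix (Fin d) (Fin d) ℝ) :
    frobInner (A - B) C = frobInner A C - frobInner B C := by
  simp [frobInner, sub_mul, Finset.sum_sub_distrib]

lemma frobInner_smul_left (r : ℝ) (A C : Matrix (Fin d) (Fin d) ℝ) :
    frobInner (r • A) C = r * frobInner A C := by
  simp [frobInner, Finset.mul_sum, mul_assoc]

lemma frobInner_eq_trace (hB : B.IsSymm) : frobInner A B = (A * B).trace := by
  simp only [frobInner, Matrix.trace, Matrix.diag, Matrix.mul_apply]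
  refine Finset.sum_congr rfl fun i _ => Finset.sum_congr rfl fun j _ => ?_
  rw [hB.apply j i]

lemma trace_sq_eq_norm_sq (hA : A.IsSymm) : (A ^ 2).trace = ‖A‖ ^ 2 := by
  rw [← frobInner_self, frobInner_eq_trace hA, sq]

lemma IsQTensor.sub (hA : IsQTensor A) (hB : IsQTensor B) : IsQTensor (A - B) :=
  ⟨by rw [Matrix.trace_sub, hA.1, hB.1, sub_zero], hA.2.sub hB.2⟩

lemma IsQTensor.smul (r : ℝ) (hA : IsQTensor A) : IsQTensor (r • A) :=
  ⟨by rw [Matrix.trace_smul, hA.1, smul_zero], hA.2.smul r⟩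

lemma isQTensor_zero : IsQTensor (0 : Matrix (Fin d) (Fin d) ℝ) :=
  ⟨Matrix.trace_zero _ _, Matrix.isSymm_zero⟩

lemma contDiff_trace {n : WithTop ℕ∞} :
    ContDiff ℝ n (fun A : Matrix (Fin d) (Fin d) ℝ => A.trace) :=
  (Matrix.traceLinearMap (Fin d) ℝ ℝ).toContinuousLinearMap.contDiff

lemma contDiff_bulkForce (P : Params) {n : WithTop ℕ∞} :
    ContDiff ℝ n (bulkForce P : Matrix (Fin d) (Fin d) ℝ → _) := by
  have h : ContDiff ℝ n (fun A : Matrix (Fin d) (Fin d) ℝ => (A ^ 2).trace) :=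
    contDiff_trace.comp (contDiff_id.pow 2)
  unfold bulkForce
  have h2 : ContDiff ℝ n (fun A : Matrix (Fin d) (Fin d) ℝ => A ^ 2) := contDiff_id.pow 2
  have h3 : ContDiff ℝ n (fun A : Matrix (Fin d) (Fin d) ℝ => A) := contDiff_id
  exact ((h3.const_smul P.a).neg.add ((h2.sub ((h.div_const _).smul contDiff_const)).const_smul
    P.b)).sub ((contDiff_const.mul h).smul h3)

lemma contDiff_bulkDensity (P : Params) {n : WithTop ℕ∞} :
    ContDiff ℝ n (bulkDensity P : Matrix (Fin d) (Fin d) ℝ → ℝ) := by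
  have h : ∀ k : ℕ, ContDiff ℝ n (fun A : Matrix (Fin d) (Fin d) ℝ => (A ^ k).trace) :=
    fun k => contDiff_trace.comp (contDiff_id.pow k)
  unfold bulkDensity
  exact ((contDiff_const.mul (h 2)).sub (contDiff_const.mul (h 3))).add
    (contDiff_const.mul ((h 2).pow 2))

/-- A C¹ map is locally Lipschitz, and closed balls are compact in finite dimension. A ball suffices
because the schemes obey a maximum bound. -/
lemma exists_lipschitz_on_ball {E : Type*} [NormedAddCommGroup E] [NormedSpace ℝ E]
    {f : Matrix (Fin d) (Fin d) ℝ → E} (hf : ContDiff ℝ 1 f) (R : ℝ) :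
    ∃ K : ℝ, 0 ≤ K ∧ ∀ A B, ‖A‖ ≤ R → ‖B‖ ≤ R → ‖f A - f B‖ ≤ K * ‖A - B‖ := by
  have : ProperSpace (Matrix (Fin d) (Fin d) ℝ) := FiniteDimensional.proper ℝ _
  obtain ⟨K, hK⟩ := (hf.locallyLipschitz.locallyLipschitzOn
    (s := Metric.closedBall 0 R)).exists_lipschitzOnWith_of_compact (isCompact_closedBall _ _)
  refine ⟨K, K.2, fun A B hA hB => ?_⟩
  have := hK.dist_le_mul A (by simpa using hA) B (by simpa using hB)
  simpa [dist_eq_norm] using this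

@[simp] lemma bulkForce_zero (P : Params) :
    bulkForce P (0 : Matrix (Fin d) (Fin d) ℝ) = 0 := by
  simp [bulkForce]

@[simp] lemma bulkDensity_zero (P : Params) :
    bulkDensity P (0 : Matrix (Fin d) (Fin d) ℝ) = 0 := by
  simp [bulkDensity]

lemma frobInner_bulkForce (P : Params) (hB : IsQTensor B) :
    frobInner (bulkForce P A) B =
      -P.a * (A * B).trace + P.b * (A ^ 2 * B).trace - P.c * (A ^ 2).trace * (A * B).trace := by
  rw [frobInner_eq_trace hB.2, bulkForce]
  simp [add_mul, sub_mul, hB.1, Matrix.trace_sub, Matrix.trace_add]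

/-- The defect of the midpoint rule for the bulk energy. -/
lemma bulkDensity_sub_midpoint (P : Params) (m E : Matrix (Fin d) (Fin d) ℝ) (hE : IsQTensor E) :
    bulkDensity P (m + E) - bulkDensity P (m - E) + frobInner (bulkForce P m) ((2 : ℝ) • E)
      = -(2 * P.b / 3) * (E ^ 3).trace + 2 * P.c * (E ^ 2).trace * (m * E).trace := by
  have hc : (E * m).trace = (m * E).trace := Matrix.trace_mul_comm _ _
  -- Cyclicity of the trace leaves two mixed words of degree three, tr(mmE) and tr(mEE). The latter
  -- is even in E and cancels in the difference.
  have c1 : (m * (E * m)).trace = (m * (m * E)).trace := by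
    rw [← mul_assoc, Matrix.trace_mul_comm]
  have c2 : (E * (m * m)).trace = (m * (m * E)).trace := by
    rw [Matrix.trace_mul_comm, mul_assoc]
  have c3 : (E * (m * E)).trace = (m * (E * E)).trace := by
    rw [Matrix.trace_mul_comm, mul_assoc]
  have c4 : (E * (E * m)).trace = (m * (E * E)).trace := by
    rw [← mul_assoc, Matrix.trace_mul_comm]
  have p2 : ((m + E) ^ 2).trace = (m ^ 2).trace + 2 * (m * E).trace + (E ^ 2).trace := by
    simp only [sq, add_mul, mul_add, Matrix.trace_add, hc]; ring
  have q2 : ((m - E) ^ 2).trace = (m ^ 2).trace - 2 * (m * E).trace + (E ^ 2).trace := by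
    simp only [sq, sub_mul, mul_sub, Matrix.trace_sub, hc]; ring
  have p3 : ((m + E) ^ 3).trace = (m ^ 3).trace + 3 * (m ^ 2 * E).trace
      + 3 * (m * (E * E)).trace + (E ^ 3).trace := by
    simp only [pow_succ, pow_zero, one_mul, add_mul, mul_add, Matrix.trace_add, mul_assoc,
      c1, c2, c3, c4]; ring
  have q3 : ((m - E) ^ 3).trace = (m ^ 3).trace - 3 * (m ^ 2 * E).trace
      + 3 * (m * (E * E)).trace - (E ^ 3).trace := by
    simp only [pow_succ, pow_zero, one_mul, sub_mul, mul_sub, Matrix.trace_sub, mul_assoc,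
      c1, c2, c3, c4]; ring
  rw [frobInner_bulkForce P (hE.smul 2)]
  simp only [bulkDensity, p2, q2, p3, q3, Matrix.mul_smul, Matrix.trace_smul, smul_eq_mul]
  ring

lemma abs_trace_mul_le (hB : B.IsSymm) : |(A * B).trace| ≤ ‖A‖ * ‖B‖ := by
  rw [← frobInner_eq_trace hB]; exact abs_frobInner_le _ _

/-- The midpoint rule for the bulk energy is of third order. -/
lemma abs_bulkDensity_sub_midpoint_le (P : Params) (R : ℝ) (hA : IsQTensor A) (hB : IsQTensor B)
    (hAR : ‖A‖ ≤ R) (hBR : ‖B‖ ≤ R) :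
    |bulkDensity P B - bulkDensity P A + frobInner (bulkForce P ((1 / 2 : ℝ) • (B + A))) (B - A)|
      ≤ (|P.b| + |P.c| * R) * ‖B - A‖ ^ 3 := by
  set D := B - A with hD
  have hDQ : IsQTensor ((1 / 2 : ℝ) • D) := (hB.sub hA).smul _
  have h := bulkDensity_sub_midpoint P ((1 / 2 : ℝ) • (B + A)) ((1 / 2 : ℝ) • D) hDQ
  have e1 : (1 / 2 : ℝ) • (B + A) + (1 / 2 : ℝ) • D = B := by rw [hD]; module
  have e2 : (1 / 2 : ℝ) • (B + A) - (1 / 2 : ℝ) • D = A := by rw [hD]; module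
  have e3 : (2 : ℝ) • (1 / 2 : ℝ) • D = D := by module
  rw [e1, e2, e3] at h
  rw [h]
  set E := (1 / 2 : ℝ) • D with hE
  have hEn : ‖E‖ = ‖D‖ / 2 := by rw [hE, norm_smul]; norm_num; ring
  have hm : ‖(1 / 2 : ℝ) • (B + A)‖ ≤ R := by
    rw [norm_smul]; norm_num; linarith [norm_add_le B A]
  have hR : 0 ≤ R := (norm_nonneg _).trans hm
  have t2 : |(E ^ 2).trace| ≤ ‖E‖ ^ 2 := by rw [sq, sq]; exact abs_trace_mul_le hDQ.2
  have t3 : |(E ^ 3).trace| ≤ ‖E‖ ^ 3 := by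
    rw [pow_succ]
    refine (abs_trace_mul_le hDQ.2).trans ?_
    rw [pow_succ ‖E‖]
    gcongr
    rw [sq, sq]; exact norm_mul_le _ _
  have t4 : |(((1 / 2 : ℝ) • (B + A)) * E).trace| ≤ R * ‖E‖ :=
    (abs_trace_mul_le hDQ.2).trans (by gcongr)
  calc |-(2 * P.b / 3) * (E ^ 3).trace
        + 2 * P.c * (E ^ 2).trace * (((1 / 2 : ℝ) • (B + A)) * E).trace|
      ≤ (2 * |P.b| / 3) * |(E ^ 3).trace|
        + 2 * |P.c| * |(E ^ 2).trace| * |(((1 / 2 : ℝ) • (B + A)) * E).trace| := by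
        refine (abs_add_le _ _).trans (le_of_eq ?_)
        simp [abs_mul, abs_div]
    _ ≤ (2 * |P.b| / 3) * ‖E‖ ^ 3 + 2 * |P.c| * ‖E‖ ^ 2 * (R * ‖E‖) := by gcongr
    _ = (|P.b| / 12 + |P.c| * R / 4) * ‖D‖ ^ 3 := by rw [hEn]; ring
    _ ≤ _ := by
        gcongr
        · linarith [abs_nonneg P.b]
        · have := mul_nonneg (abs_nonneg P.c) hR; linarith

/-- The first-order expansion of the bulk energy. -/
lemma exists_abs_bulkDensity_sub_le (d : ℕ) (P : Params) (R : ℝ) : ∃ K : ℝ, 0 ≤ K ∧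
    ∀ A B : Matrix (Fin d) (Fin d) ℝ, IsQTensor A → IsQTensor B → ‖A‖ ≤ R → ‖B‖ ≤ R →
      |bulkDensity P B - bulkDensity P A + frobInner (bulkForce P A) (B - A)|
        ≤ K * ‖B - A‖ ^ 2 := by
  obtain ⟨K, hK0, hK⟩ := exists_lipschitz_on_ball (contDiff_bulkForce (d := d) P) R
  rcases lt_or_ge R 0 with hR | hR
  · exact ⟨0, le_rfl, fun A B _ _ hA _ => absurd hA (not_le.2 (hR.trans_le (norm_nonneg _)))⟩
  -- The first summand is the cubic midpoint defect, lowered to a quadratic one by |B − A| ≤ 2R. K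
  -- pays for moving the force from the midpoint to A.
  refine ⟨(|P.b| + |P.c| * R) * (2 * R) + K, by positivity, fun A B hA hB hAR hBR => ?_⟩
  have h1 := abs_bulkDensity_sub_midpoint_le P R hA hB hAR hBR
  set m := (1 / 2 : ℝ) • (B + A) with hm
  have hmR : ‖m‖ ≤ R := by
    rw [hm, norm_smul]; norm_num; linarith [norm_add_le B A]
  have h2 : |frobInner (bulkForce P A - bulkForce P m) (B - A)| ≤ K * ‖B - A‖ * ‖B - A‖ := by
    refine (abs_frobInner_le _ _).trans ?_
    gcongr
    refine (hK A m hAR hmR).trans ?_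
    gcongr
    rw [show A - m = (-(1 / 2 : ℝ)) • (B - A) by rw [hm]; module, norm_smul]
    norm_num
    linarith [norm_nonneg (B - A)]
  have h3 : ‖B - A‖ ≤ 2 * R := by linarith [norm_sub_le B A]
  have h4 : bulkDensity P B - bulkDensity P A + frobInner (bulkForce P A) (B - A)
      = (bulkDensity P B - bulkDensity P A + frobInner (bulkForce P m) (B - A))
        + frobInner (bulkForce P A - bulkForce P m) (B - A) := by
    rw [frobInner_sub_left]; ring
  rw [h4]
  refine (abs_add_le _ _).trans ?_
  calc _ ≤ (|P.b| + |P.c| * R) * ‖B - A‖ ^ 3 + K * ‖B - A‖ * ‖B - A‖ := add_le_add h1 h2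
    _ = (|P.b| + |P.c| * R) * ‖B - A‖ * ‖B - A‖ ^ 2 + K * ‖B - A‖ ^ 2 := by ring
    _ ≤ (|P.b| + |P.c| * R) * (2 * R) * ‖B - A‖ ^ 2 + K * ‖B - A‖ ^ 2 := by gcongr
    _ = _ := by ring

/-! ### The stabilized force -/

/-- By Cayley-Hamilton a traceless 2 × 2 matrix satisfies A² = −det(A) I, so the cubic bulk term
exerts no force when d = 2. -/
lemma traceless_sq_two {A : Matrix (Fin 2) (Fin 2) ℝ} (hA : IsQTensor A) :
    A ^ 2 - ((A ^ 2).trace / (2 : ℝ)) • (1 : Matrix (Fin 2) (Fin 2) ℝ) = 0 := by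
  have h1 : A 1 1 = -A 0 0 := by
    have := hA.1
    simp only [Matrix.trace, Matrix.diag, Fin.sum_univ_two] at this
    linarith
  have h2 : A 1 0 = A 0 1 := hA.2.apply 0 1
  ext i j
  fin_cases i <;> fin_cases j <;>
    simp [sq, Matrix.mul_apply, Matrix.trace, Fin.sum_univ_two, h1, h2] <;> ring

/-- For a traceless symmetric 3 × 3 matrix tr(A⁴) = tr(A²)²/2, so the squared norm is (1/2 −
1/3)|A|⁴. This is the source of the √6 in the scalar force. -/
lemma norm_traceless_three {A : Matrix (Fin 3) (Fin 3) ℝ} (hA : IsQTensor A) :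
    ‖A ^ 2 - ((A ^ 2).trace / (3 : ℝ)) • (1 : Matrix (Fin 3) (Fin 3) ℝ)‖ = ‖A‖ ^ 2 / √6 := by
  have h1 : A 2 2 = -A 0 0 - A 1 1 := by
    have := hA.1
    simp only [Matrix.trace, Matrix.diag, Fin.sum_univ_three] at this
    linarith
  have h2 : A 1 0 = A 0 1 := hA.2.apply 0 1
  have h3 : A 2 0 = A 0 2 := hA.2.apply 0 2
  have h4 : A 2 1 = A 1 2 := hA.2.apply 1 2
  rw [← sq_eq_sq₀ (norm_nonneg _) (by positivity), div_pow, Real.sq_sqrt (by norm_num),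
    norm_sq_eq_sum, norm_sq_eq_sum]
  simp [sq, Matrix.mul_apply, Matrix.trace, Fin.sum_univ_three, h1, h2, h3, h4]
  ring

lemma maxBound_nonneg (P : Params) (Q₀ : (Fin d → ℝ) → Matrix (Fin d) (Fin d) ℝ) :
    0 ≤ maxBound P Q₀ := by
  have h : 0 ≤ supNorm P.ℓ Q₀ := Real.iSup_nonneg fun _ => Real.sqrt_nonneg _
  unfold maxBound
  split_ifs <;> first | exact h | exact h.trans (le_max_left _ _)

lemma supNorm_le_maxBound (P : Params) (Q₀ : (Fin d → ℝ) → Matrix (Fin d) (Fin d) ℝ) :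
    supNorm P.ℓ Q₀ ≤ maxBound P Q₀ := by
  unfold maxBound
  split_ifs <;> simp

lemma hasDerivAt_scalarForce (d : ℕ) (P : Params) (ξ : ℝ) :
    HasDerivAt (scalarForce d P)
      (-P.a + (if d = 2 then 0 else P.b) / √6 * (2 * ξ) - P.c * (3 * ξ ^ 2)) ξ := by
  have h := (((hasDerivAt_id ξ).const_mul (-P.a)).add (((hasDerivAt_pow 2 ξ)).const_mul
    ((if d = 2 then 0 else P.b) / √6))).sub ((hasDerivAt_pow 3 ξ).const_mul P.c)
  exact h.congr_deriv (by norm_num)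

lemma kappa_nonneg {P : Params} {Q₀ : (Fin d → ℝ) → Matrix (Fin d) (Fin d) ℝ}
    (hκ : StabilizationCondition P Q₀) : 0 ≤ P.κ :=
  (abs_nonneg _).trans (hκ.2 0 ⟨le_rfl, maxBound_nonneg P Q₀⟩)

/-- The scalar force is −ξ times a quadratic polynomial with leading coefficient c > 0. By its
definition the maximum bound lies at or beyond the larger root, if real roots exist. -/
lemma scalarForce_maxBound_nonpos (hd : d = 2 ∨ d = 3) {P : Params} (hb : 0 ≤ P.b) (hc : 0 < P.c)
    (Q₀ : (Fin d → ℝ) → Matrix (Fin d) (Fin d) ℝ) :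
    scalarForce d P (maxBound P Q₀) ≤ 0 := by
  have h0 := maxBound_nonneg P Q₀
  set η := maxBound P Q₀ with hη
  suffices h : 0 ≤ P.a - (if d = 2 then 0 else P.b) / √6 * η + P.c * η ^ 2 by
    have : scalarForce d P η
      = -(η * (P.a - (if d = 2 then 0 else P.b) / √6 * η + P.c * η ^ 2)) := by
      unfold scalarForce; ring
    rw [this]
    exact neg_nonpos.2 (mul_nonneg h0 h)
  rcases hd with rfl | rfl
  · have h1 : √(max 0 (-P.a) / P.c) ≤ η := by simp [hη, maxBound]
    have h2 : max 0 (-P.a) / P.c ≤ η ^ 2 := by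
      rw [← Real.sq_sqrt (show 0 ≤ max 0 (-P.a) / P.c by positivity)]
      gcongr
    rw [div_le_iff₀ hc] at h2
    have := le_max_right 0 (-P.a)
    simp
    nlinarith
  · have h6 : 0 < √(6 : ℝ) := by positivity
    have h66 : √(6 : ℝ) ^ 2 = 6 := Real.sq_sqrt (by norm_num)
    simp only [show ¬ (3 = 2) by norm_num, if_false]
    set r := √(6 : ℝ)
    have key : 0 ≤ 6 * P.a - P.b * r * η + 6 * P.c * η ^ 2 → 0 ≤ P.a - P.b / r * η + P.c * η ^ 2 := by
      intro h
      have : P.b / r = P.b * r / 6 := by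
        rw [div_eq_div_iff h6.ne' (by norm_num), mul_assoc, ← sq, h66]
      rw [this]; linarith
    apply key
    by_cases hab : P.a ≤ P.b ^ 2 / (24 * P.c)
    · rw [le_div_iff₀ (by positivity)] at hab
      have hD : 0 ≤ P.b ^ 2 - 24 * P.a * P.c := by linarith
      have h1 : (|P.b| + √(P.b ^ 2 - 24 * P.a * P.c)) / (2 * r * P.c) ≤ η := by
        have hab' : P.a ≤ P.b ^ 2 / (24 * P.c) := by rwa [le_div_iff₀ (by positivity)]
        simp [hη, maxBound, hab', r]
      rw [div_le_iff₀ (by positivity), abs_of_nonneg hb] at h1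
      have hs := Real.sq_sqrt hD
      have hs0 := Real.sqrt_nonneg (P.b ^ 2 - 24 * P.a * P.c)
      set S := √(P.b ^ 2 - 24 * P.a * P.c)
      have h2 : S ^ 2 ≤ (2 * r * P.c * η - P.b) ^ 2 := by
        apply pow_le_pow_left₀ hs0; linarith
      have h3 : (2 * r * P.c * η - P.b) ^ 2
          = 4 * P.c * (6 * P.c * η ^ 2 - P.b * r * η) + P.b ^ 2 := by
        linear_combination (4 * P.c ^ 2 * η ^ 2) * h66
      have h4 : 0 ≤ (4 * P.c) * (6 * P.a - P.b * r * η + 6 * P.c * η ^ 2) := by nlinarith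
      exact nonneg_of_mul_nonneg_right h4 (by positivity)
    -- Negative discriminant: the completed square is positive whatever η is.
    · rw [not_le, div_lt_iff₀ (by positivity)] at hab
      have h3 : (2 * r * P.c * η - P.b) ^ 2
          = 4 * P.c * (6 * P.c * η ^ 2 - P.b * r * η) + P.b ^ 2 := by
        linear_combination (4 * P.c ^ 2 * η ^ 2) * h66
      have h4 : 0 ≤ (4 * P.c) * (6 * P.a - P.b * r * η + 6 * P.c * η ^ 2) := by
        nlinarith [sq_nonneg (2 * r * P.c * η - P.b)]
      exact nonneg_of_mul_nonneg_right h4 (by positivity)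

/-- Since |f̄′| ≤ κ on [0, η], the function κξ + f̄(ξ) is nondecreasing there, and its value at η is
at most κη by `scalarForce_maxBound_nonpos`. -/
lemma stabilized_scalarForce_le (hd : d = 2 ∨ d = 3) {P : Params} (hb : 0 ≤ P.b) (hc : 0 < P.c)
    {Q₀ : (Fin d → ℝ) → Matrix (Fin d) (Fin d) ℝ} (hκ : StabilizationCondition P Q₀)
    {r : ℝ} (hr : 0 ≤ r) (hrη : r ≤ maxBound P Q₀) :
    P.κ * r + scalarForce d P r ≤ P.κ * maxBound P Q₀ := by
  have hm : MonotoneOn (fun ξ => P.κ * ξ + scalarForce d P ξ) (Set.Icc 0 (maxBound P Q₀)) := by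
    have hder : ∀ ξ, HasDerivAt (fun ξ => P.κ * ξ + scalarForce d P ξ)
        (P.κ + deriv (scalarForce d P) ξ) ξ := fun ξ => by
      rw [(hasDerivAt_scalarForce d P ξ).deriv]
      exact (((hasDerivAt_id ξ).const_mul P.κ).add (hasDerivAt_scalarForce d P ξ)).congr_deriv
        (by rw [mul_one])
    refine monotoneOn_of_deriv_nonneg (convex_Icc _ _)
      (fun ξ _ => (hder ξ).continuousAt.continuousWithinAt)
      (fun ξ _ => (hder ξ).differentiableAt.differentiableWithinAt) fun ξ hξ => ?_
    rw [(hder ξ).deriv]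
    linarith [neg_le_of_abs_le (hκ.2 ξ (interior_subset hξ))]
  have := hm ⟨hr, hrη⟩ ⟨hr.trans hrη, le_rfl⟩ hrη
  have h2 := scalarForce_maxBound_nonpos hd hb hc Q₀
  simp only at this
  linarith

/-- The stabilized force maps the ball of radius `η` into the ball of radius `κ η`. -/
lemma norm_bulkForce_add_smul_le (hd : d = 2 ∨ d = 3) {P : Params} (hb : 0 ≤ P.b) (hc : 0 < P.c)
    {Q₀ : (Fin d → ℝ) → Matrix (Fin d) (Fin d) ℝ} (hκ : StabilizationCondition P Q₀)
    (hA : IsQTensor A) (hAη : ‖A‖ ≤ maxBound P Q₀) :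
    ‖bulkForce P A + P.κ • A‖ ≤ P.κ * maxBound P Q₀ := by
  refine le_trans ?_ (stabilized_scalarForce_le hd hb hc hκ (norm_nonneg A) hAη)
  have htr := trace_sq_eq_norm_sq hA.2
  -- The condition κ ≥ a + cη² is used here: with a nonnegative coefficient the triangle inequality
  -- produces exactly κ|A| + f̄(|A|).
  have hα : 0 ≤ P.κ - P.a - P.c * ‖A‖ ^ 2 := by
    have : P.c * ‖A‖ ^ 2 ≤ P.c * maxBound P Q₀ ^ 2 := by gcongr
    linarith [hκ.1]
  have hsplit : bulkForce P A + P.κ • A = (P.κ - P.a - P.c * ‖A‖ ^ 2) • A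
      + P.b • (A ^ 2 - ((A ^ 2).trace / (d : ℝ)) • (1 : Matrix (Fin d) (Fin d) ℝ)) := by
    rw [bulkForce, htr]; module
  rw [hsplit]
  rcases hd with rfl | rfl
  · rw [Nat.cast_ofNat, traceless_sq_two hA, smul_zero, add_zero, norm_smul,
      Real.norm_of_nonneg hα, scalarForce]
    simp only [if_true]
    apply le_of_eq; ring
  · refine (norm_add_le _ _).trans ?_
    rw [Nat.cast_ofNat, norm_smul, norm_smul, Real.norm_of_nonneg hα, Real.norm_of_nonneg hb,
      norm_traceless_three hA, scalarForce]
    simp only [show ¬ (3 = 2) by norm_num, if_false]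
    apply le_of_eq; ring

end Tensor

/-! ### Grid functions as Euclidean vectors -/

section Grid

variable {d M : ℕ} {h : ℝ}

lemma frobInner_sum_left {ι : Type*} (s : Finset ι) (A : ι → Matrix (Fin d) (Fin d) ℝ)
    (B : Matrix (Fin d) (Fin d) ℝ) :
    frobInner (∑ k ∈ s, A k) B = ∑ k ∈ s, frobInner (A k) B := by
  classical
  induction s using Finset.induction_on with
  | empty => simp [frobInner]
  | insert a s ha ih => rw [Finset.sum_insert ha, Finset.sum_insert ha, frobInner_add_left, ih]

/-- The nodal values at the interior nodes, scaled so that the Euclidean norm is `gridNorm`. -/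
def gridVec (h : ℝ) (M : ℕ) :
    GridTensor d →ₗ[ℝ] EuclideanSpace ℝ (interiorNodes d M × (Fin d × Fin d)) where
  toFun Φ := WithLp.toLp 2 fun q => √(h ^ d) * Φ q.1 q.2.1 q.2.2
  map_add' Φ Ψ := by ext q; simp [mul_add]
  map_smul' r Φ := by ext q; simp; ring

/-- The forward differences, scaled so that the Euclidean norm is `gradNorm`. -/
def gradVec (h : ℝ) (M : ℕ) :
    GridTensor d →ₗ[ℝ] EuclideanSpace ℝ (Fin d × cellNodes d M × (Fin d × Fin d)) where
  toFun Φ := WithLp.toLp 2 fun q => √(h ^ d) * forwardDiff h q.1 Φ q.2.1 q.2.2.1 q.2.2.2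
  map_add' Φ Ψ := by ext q; simp [forwardDiff]; ring
  map_smul' r Φ := by ext q; simp [forwardDiff]; ring

lemma gridInner_eq_sum (h : ℝ) (M : ℕ) (Φ Ψ : GridTensor d) :
    gridInner h M Φ Ψ = h ^ d * ∑ p ∈ interiorNodes d M, frobInner (Φ p) (Ψ p) := rfl

lemma inner_gridVec (hh : 0 ≤ h) (Φ Ψ : GridTensor d) :
    inner ℝ (gridVec h M Φ) (gridVec h M Ψ) = gridInner h M Φ Ψ := by
  have hs : √(h ^ d) * √(h ^ d) = h ^ d := Real.mul_self_sqrt (by positivity)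
  rw [gridInner, ← Finset.sum_coe_sort, PiLp.inner_apply, Fintype.sum_prod_type, Finset.mul_sum]
  refine Finset.sum_congr rfl fun p _ => ?_
  rw [Fintype.sum_prod_type, Finset.mul_sum]
  refine Finset.sum_congr rfl fun i _ => ?_
  rw [Finset.mul_sum]
  refine Finset.sum_congr rfl fun j _ => ?_
  simp only [gridVec, LinearMap.coe_mk, AddHom.coe_mk, RCLike.inner_apply, conj_trivial]
  linear_combination (Φ p i j * Ψ p i j) * hs

lemma inner_gradVec (hh : 0 ≤ h) (Φ Ψ : GridTensor d) :
    inner ℝ (gradVec h M Φ) (gradVec h M Ψ) = h ^ d * ∑ k, ∑ p ∈ cellNodes d M, ∑ i, ∑ j,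
      forwardDiff h k Φ p i j * forwardDiff h k Ψ p i j := by
  have hs : √(h ^ d) * √(h ^ d) = h ^ d := Real.mul_self_sqrt (by positivity)
  rw [PiLp.inner_apply, Fintype.sum_prod_type, Finset.mul_sum]
  refine Finset.sum_congr rfl fun k _ => ?_
  rw [Fintype.sum_prod_type, ← Finset.sum_coe_sort (cellNodes d M), Finset.mul_sum]
  refine Finset.sum_congr rfl fun p _ => ?_
  rw [Fintype.sum_prod_type, Finset.mul_sum]
  refine Finset.sum_congr rfl fun i _ => ?_
  rw [Finset.mul_sum]
  refine Finset.sum_congr rfl fun j _ => ?_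
  simp only [gradVec, LinearMap.coe_mk, AddHom.coe_mk, RCLike.inner_apply, conj_trivial]
  linear_combination (forwardDiff h k Φ p i j * forwardDiff h k Ψ p i j) * hs

lemma norm_gridVec (hh : 0 ≤ h) (Φ : GridTensor d) : ‖gridVec h M Φ‖ = gridNorm h M Φ := by
  rw [gridNorm, ← inner_gridVec hh, real_inner_self_eq_norm_sq, Real.sqrt_sq (norm_nonneg _)]

lemma norm_gradVec (hh : 0 ≤ h) (Φ : GridTensor d) : ‖gradVec h M Φ‖ = gradNorm h M Φ := by
  rw [gradNorm, ← Real.sqrt_sq (norm_nonneg (gradVec h M Φ)), ← real_inner_self_eq_norm_sq,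
    inner_gradVec hh]
  simp only [sq]

lemma norm_gridVec_sq (hh : 0 ≤ h) (Φ : GridTensor d) :
    ‖gridVec h M Φ‖ ^ 2 = h ^ d * ∑ p ∈ interiorNodes d M, ‖Φ p‖ ^ 2 := by
  rw [← real_inner_self_eq_norm_sq, inner_gridVec hh, gridInner_eq_sum]
  simp only [frobInner_self]

lemma mem_interiorNodes {p : Fin d → ℤ} :
    p ∈ interiorNodes d M ↔ ∀ k, 0 < p k ∧ p k < M := by
  simp [interiorNodes, Fintype.mem_piFinset]

lemma mem_cellNodes {p : Fin d → ℤ} : p ∈ cellNodes d M ↔ ∀ k, 0 ≤ p k ∧ p k < M := by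
  simp [cellNodes, Fintype.mem_piFinset]

/-- An edge based outside `cellNodes` has no interior end point, so sums over cells extend to all of
ℤ^d for functions supported on the interior nodes. -/
lemma notMem_interiorNodes_of_notMem_cellNodes {p : Fin d → ℤ} (k : Fin d)
    (hp : p ∉ cellNodes d M) :
    p ∉ interiorNodes d M ∧ p + Pi.single k 1 ∉ interiorNodes d M := by
  simp only [mem_cellNodes, mem_interiorNodes, not_forall] at hp ⊢
  obtain ⟨j, hj⟩ := hp
  refine ⟨⟨j, by omega⟩, j, ?_⟩
  by_cases hjk : j = k
  · subst hjk; simp; omega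
  · simp [Pi.single_eq_of_ne hjk]; omega

/-- Both sums extend to all of ℤ^d, where the identity is translation invariance. Only v has to
vanish off the interior nodes; w is arbitrary. -/
lemma sum_by_parts (k : Fin d) (w v : (Fin d → ℤ) → ℝ)
    (hv : ∀ p, p ∉ interiorNodes d M → v p = 0) :
    ∑ p ∈ interiorNodes d M, (w p - w (p - Pi.single k 1)) * v p
      = -∑ p ∈ cellNodes d M, w p * (v (p + Pi.single k 1) - v p) := by
  set e : Fin d → ℤ := Pi.single k 1
  have hfin : ∀ a : (Fin d → ℤ) → ℝ, Summable fun p => a p * v p := fun a =>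
    summable_of_ne_finset_zero (s := interiorNodes d M) fun p hp => by rw [hv p hp, mul_zero]
  have hshift : ∀ a : (Fin d → ℤ) → ℝ, Summable (fun p => a p * v (p + e)) ∧
      ∑' p, a p * v (p + e) = ∑' p, a (p - e) * v p := fun a => by
    have h1 := hfin fun p => a (p - e)
    constructor
    · simpa [Function.comp_def] using (Equiv.addRight e).summable_iff.2 h1
    · rw [← (Equiv.addRight e).tsum_eq fun p => a (p - e) * v p]
      simp
  have hl : ∑ p ∈ interiorNodes d M, (w p - w (p - e)) * v p
      = ∑' p, w p * v p - ∑' p, w (p - e) * v p := by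
    rw [← (hfin w).tsum_sub (hfin fun p => w (p - e)), tsum_eq_sum (s := interiorNodes d M)]
    · simp only [sub_mul]
    · intro p hp; simp [hv p hp]
  have hr : ∑ p ∈ cellNodes d M, w p * (v (p + e) - v p)
      = ∑' p, w p * v (p + e) - ∑' p, w p * v p := by
    rw [← (hshift w).1.tsum_sub (hfin w), tsum_eq_sum (s := cellNodes d M)]
    · simp only [mul_sub]
    · intro p hp
      have := notMem_interiorNodes_of_notMem_cellNodes k hp
      rw [hv _ this.1, hv _ this.2, sub_self]
  rw [hl, hr, (hshift w).2]; ring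

/-- Summation by parts. -/
lemma gridInner_discLaplacian (hh : 0 ≤ h) (Φ Ψ : GridTensor d)
    (hΨ : ∀ p, p ∉ interiorNodes d M → Ψ p = 0) :
    gridInner h M (discLaplacian h Φ) Ψ = -inner ℝ (gradVec h M Φ) (gradVec h M Ψ) := by
  have key : ∀ k i j, ∑ p ∈ interiorNodes d M,
      (h⁻¹ • (forwardDiff h k Φ p - forwardDiff h k Φ (p - Pi.single k 1))) i j * Ψ p i j
      = -∑ p ∈ cellNodes d M, forwardDiff h k Φ p i j * forwardDiff h k Ψ p i j := fun k i j => by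
    have := sum_by_parts (M := M) k (fun p => forwardDiff h k Φ p i j) (fun p => Ψ p i j)
      fun p hp => by simp [hΨ p hp]
    calc _ = h⁻¹ * ∑ p ∈ interiorNodes d M, (forwardDiff h k Φ p i j
          - forwardDiff h k Φ (p - Pi.single k 1) i j) * Ψ p i j := by
          rw [Finset.mul_sum]
          refine Finset.sum_congr rfl fun p _ => ?_
          simp; ring
      _ = _ := by
          rw [this, mul_neg, Finset.mul_sum]
          congr 1
          refine Finset.sum_congr rfl fun p _ => ?_
          have : forwardDiff h k Ψ p i j = h⁻¹ * (Ψ (p + Pi.single k 1) i j - Ψ p i j) := by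
            simp [forwardDiff]
          rw [this]; ring
  rw [inner_gradVec hh, gridInner_eq_sum, ← mul_neg]
  congr 1
  simp only [discLaplacian, frobInner_sum_left]
  rw [Finset.sum_comm, ← Finset.sum_neg_distrib]
  refine Finset.sum_congr rfl fun k _ => ?_
  simp only [frobInner]
  rw [Finset.sum_comm, Finset.sum_comm (s := cellNodes d M), ← Finset.sum_neg_distrib]
  refine Finset.sum_congr rfl fun i _ => ?_
  rw [Finset.sum_comm, Finset.sum_comm (s := cellNodes d M), ← Finset.sum_neg_distrib]
  exact Finset.sum_congr rfl fun j _ => key k i j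

lemma card_interiorNodes_le (d M : ℕ) : ((interiorNodes d M).card : ℝ) ≤ (M : ℝ) ^ d := by
  have : (interiorNodes d M).card ≤ M ^ d := by
    simp only [interiorNodes, Fintype.card_piFinset, Int.card_Ioo, Finset.prod_const,
      Finset.card_univ, Fintype.card_fin]
    exact Nat.pow_le_pow_left (by omega) d
  exact_mod_cast this

lemma card_cellNodes (d M : ℕ) : ((cellNodes d M).card : ℝ) = (M : ℝ) ^ d := by
  simp [cellNodes, Fintype.card_piFinset]

/-- The weighted sum over the interior nodes of a function bounded by `c` is at most `c ℓ^d`. -/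
lemma weighted_sum_le {ℓ c : ℝ} (hℓ : 0 < ℓ) (hM : 0 < M) (hc : 0 ≤ c) {u : (Fin d → ℤ) → ℝ}
    (hu : ∀ p ∈ interiorNodes d M, u p ≤ c) :
    (ℓ / M) ^ d * ∑ p ∈ interiorNodes d M, u p ≤ c * ℓ ^ d := by
  have hM' : (0 : ℝ) < M := by exact_mod_cast hM
  have h1 : ∑ p ∈ interiorNodes d M, u p ≤ (M : ℝ) ^ d * c := by
    refine (Finset.sum_le_card_nsmul _ _ _ hu).trans ?_
    rw [nsmul_eq_mul]
    exact mul_le_mul_of_nonneg_right (card_interiorNodes_le d M) hc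
  calc _ ≤ (ℓ / M) ^ d * ((M : ℝ) ^ d * c) := by gcongr
    _ = c * ℓ ^ d := by rw [← mul_assoc, ← mul_pow, div_mul_cancel₀ _ hM'.ne']; ring

lemma norm_gridVec_le {ℓ c : ℝ} (hℓ : 0 < ℓ) (hM : 0 < M) (hc : 0 ≤ c) {Φ : GridTensor d}
    (hΦ : ∀ p ∈ interiorNodes d M, ‖Φ p‖ ≤ c) :
    ‖gridVec (ℓ / M) M Φ‖ ≤ c * √(ℓ ^ d) := by
  apply le_of_sq_le_sq _ (by positivity)
  rw [norm_gridVec_sq (by positivity), mul_pow, Real.sq_sqrt (by positivity)]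
  exact weighted_sum_le hℓ hM (by positivity) fun p hp =>
    pow_le_pow_left₀ (norm_nonneg _) (hΦ p hp) 2

lemma norm_gridVec_le_mul (hh : 0 ≤ h) {c : ℝ} (hc : 0 ≤ c) {Φ Ψ : GridTensor d}
    (hΦ : ∀ p ∈ interiorNodes d M, ‖Φ p‖ ≤ c * ‖Ψ p‖) :
    ‖gridVec h M Φ‖ ≤ c * ‖gridVec h M Ψ‖ := by
  apply le_of_sq_le_sq _ (by positivity)
  rw [norm_gridVec_sq hh, mul_pow, norm_gridVec_sq hh, mul_left_comm]
  refine mul_le_mul_of_nonneg_left ?_ (pow_nonneg hh d)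
  rw [Finset.mul_sum]
  refine Finset.sum_le_sum fun p hp => ?_
  rw [← mul_pow]
  exact pow_le_pow_left₀ (norm_nonneg _) (hΦ p hp) 2

/-! ### The discrete maximum principle -/

lemma discLaplacian_apply (h : ℝ) (Φ : GridTensor d) (p : Fin d → ℤ) :
    discLaplacian h Φ p
      = ∑ k, (h⁻¹ ^ 2) • (Φ (p + Pi.single k 1) + Φ (p - Pi.single k 1) - (2 : ℝ) • Φ p) := by
  refine Finset.sum_congr rfl fun k _ => ?_
  simp only [forwardDiff, sub_add_cancel]
  module

lemma discLaplacian_add (h : ℝ) (Φ Ψ : GridTensor d) :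
    discLaplacian h (Φ + Ψ) = discLaplacian h Φ + discLaplacian h Ψ := by
  ext1 p
  simp only [discLaplacian_apply, Pi.add_apply, ← Finset.sum_add_distrib]
  exact Finset.sum_congr rfl fun k _ => by module

lemma discLaplacian_smul (h r : ℝ) (Φ : GridTensor d) :
    discLaplacian h (r • Φ) = r • discLaplacian h Φ := by
  ext1 p
  simp only [discLaplacian_apply, Pi.smul_apply, Finset.smul_sum]
  exact Finset.sum_congr rfl fun k _ => by module

lemma discLaplacian_sub (h : ℝ) (Φ Ψ : GridTensor d) :
    discLaplacian h (Φ - Ψ) = discLaplacian h Φ - discLaplacian h Ψ := by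
  have := discLaplacian_add h Φ ((-1 : ℝ) • Ψ)
  rw [discLaplacian_smul] at this
  simpa [sub_eq_add_neg] using this

/-- At a maximum of the norm, the discrete Laplacian points inwards. -/
lemma frobInner_discLaplacian_nonpos (h : ℝ) {Φ : GridTensor d} {p : Fin d → ℤ}
    (hp : ∀ q, ‖Φ q‖ ≤ ‖Φ p‖) : frobInner (discLaplacian h Φ p) (Φ p) ≤ 0 := by
  rw [discLaplacian_apply, frobInner_sum_left]
  refine Finset.sum_nonpos fun k _ => ?_
  rw [frobInner_smul_left, frobInner_sub_left, frobInner_add_left, frobInner_smul_left,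
    frobInner_self]
  have h1 : ∀ q, frobInner (Φ q) (Φ p) ≤ ‖Φ p‖ ^ 2 := fun q => by
    rw [sq]
    exact ((le_abs_self _).trans (abs_frobInner_le _ _)).trans (by gcongr; exact hp q)
  exact mul_nonpos_of_nonneg_of_nonpos (by positivity)
    (by linarith [h1 (p + Pi.single k 1), h1 (p - Pi.single k 1)])

/-- The maximum principle for the implicit part of the schemes. -/
lemma norm_le_of_resolvent_eq {U W : GridTensor d} (hU : ∀ p, p ∉ interiorNodes d M → U p = 0)
    {α μ η : ℝ} (hα : 0 < α) (hμ : 0 ≤ μ) (hη : 0 ≤ η)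
    (heq : ∀ p ∈ interiorNodes d M, α • U p = μ • discLaplacian h U p + W p)
    (hW : ∀ p ∈ interiorNodes d M, ‖W p‖ ≤ α * η) (q : Fin d → ℤ) : ‖U q‖ ≤ η := by
  by_cases hq : q ∈ interiorNodes d M
  swap
  · rw [hU q hq, norm_zero]; exact hη
  -- The equation is tested with U at a node where |U| is largest. This interior maximum is global
  -- because U vanishes elsewhere.
  obtain ⟨p, hp, hmax⟩ := Finset.exists_max_image (interiorNodes d M) (fun p => ‖U p‖) ⟨q, hq⟩
  refine (hmax q hq).trans ?_
  have hmax' : ∀ q, ‖U q‖ ≤ ‖U p‖ := fun q => by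
    by_cases hq : q ∈ interiorNodes d M
    · exact hmax q hq
    · rw [hU q hq, norm_zero]; exact norm_nonneg _
  by_contra! hlt
  have h0 : 0 < ‖U p‖ := hη.trans_lt hlt
  have h1 : α * ‖U p‖ ^ 2
      = μ * frobInner (discLaplacian h U p) (U p) + frobInner (W p) (U p) := by
    rw [← frobInner_self, ← frobInner_smul_left, heq p hp, frobInner_add_left,
      frobInner_smul_left]
  have h2 := mul_nonpos_of_nonneg_of_nonpos hμ (frobInner_discLaplacian_nonpos h hmax')
  have h3 : frobInner (W p) (U p) ≤ α * η * ‖U p‖ :=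
    ((le_abs_self _).trans (abs_frobInner_le _ _)).trans (by gcongr; exact hW p hp)
  have h4 : α * ‖U p‖ * ‖U p‖ ≤ α * η * ‖U p‖ := by nlinarith
  have h5 := le_of_mul_le_mul_right h4 h0
  exact absurd (le_of_mul_le_mul_left h5 hα) (not_le.2 hlt)

/-- The explicit part of the Crank-Nicolson step is a contraction under the step size condition. -/
lemma norm_smul_add_discLaplacian_le {U : GridTensor d} {α μ η : ℝ} (hμ : 0 ≤ μ)
    (hα : 2 * d * μ * h⁻¹ ^ 2 ≤ α) (hU : ∀ q, ‖U q‖ ≤ η) (p : Fin d → ℤ) :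
    ‖α • U p + μ • discLaplacian h U p‖ ≤ α * η := by
  -- A combination of U at p and its 2d neighbours with total weight α. The hypothesis on α makes
  -- the central weight nonnegative.
  have h1 : α • U p + μ • discLaplacian h U p = (α - 2 * d * μ * h⁻¹ ^ 2) • U p
      + ∑ k : Fin d, (μ * h⁻¹ ^ 2) • (U (p + Pi.single k 1) + U (p - Pi.single k 1)) := by
    simp only [discLaplacian_apply, smul_sub, Finset.sum_sub_distrib, Finset.sum_const,
      Finset.card_univ, Fintype.card_fin, Finset.smul_sum]
    simp only [smul_smul, ← Nat.cast_smul_eq_nsmul ℝ, sub_smul]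
    simp only [mul_smul]
    module
  rw [h1]
  have h2 : ∀ k : Fin d, ‖(μ * h⁻¹ ^ 2) • (U (p + Pi.single k 1) + U (p - Pi.single k 1))‖
      ≤ μ * h⁻¹ ^ 2 * (2 * η) := fun k => by
    rw [norm_smul, Real.norm_of_nonneg (by positivity)]
    gcongr
    linarith [norm_add_le (U (p + Pi.single k 1)) (U (p - Pi.single k 1)),
      hU (p + Pi.single k 1), hU (p - Pi.single k 1)]
  have h3 := norm_sum_le_of_le Finset.univ fun k _ => h2 k
  have h4 : ‖(α - 2 * d * μ * h⁻¹ ^ 2) • U p‖ ≤ (α - 2 * d * μ * h⁻¹ ^ 2) * η := by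
    rw [norm_smul, Real.norm_of_nonneg (by linarith)]
    exact mul_le_mul_of_nonneg_left (hU p) (by linarith)
  refine (norm_add_le _ _).trans ((add_le_add h4 h3).trans (le_of_eq ?_))
  simp; ring

end Grid

/-! ### Energy stability and maximum bound of the schemes -/

/-- The structural properties of the data that yield the stability of the schemes, for the maximum
bound `η`. -/
structure StableData (d : ℕ) (P : Params) (η : ℝ) : Prop where
  dim : d = 2 ∨ d = 3
  ℓ_pos : 0 < P.ℓ
  L_pos : 0 < P.L
  κ_nonneg : 0 ≤ P.κ
  Cstar_pos : 0 < P.Cstar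
  η_nonneg : 0 ≤ η
  bulk_ge : ∀ A : Matrix (Fin d) (Fin d) ℝ, IsQTensor A → -P.Cstar ≤ P.ℓ ^ d * bulkDensity P A
  force_le : ∀ A : Matrix (Fin d) (Fin d) ℝ, IsQTensor A → ‖A‖ ≤ η →
    ‖bulkForce P A + P.κ • A‖ ≤ P.κ * η

/-- The invariants of both schemes: the maximum bound, the cut-off and the energy bound `E₀`. -/
structure IsAdmissible {d : ℕ} (P : Params) (M : ℕ) (η E₀ : ℝ) (Q : GridTensor d) (s : ℝ) :
    Prop where
  grid : IsGridQTensor M Q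
  norm_le : ∀ p, ‖Q p‖ ≤ η
  cutoff_le : -P.Cstar - discElasticEnergy P M Q ≤ s
  energy_le : discElasticEnergy P M Q + s ≤ E₀

section Scheme

variable {d M : ℕ} {P : Params} {η E₀ τ s s' : ℝ} {Q Q' : GridTensor d}

lemma gridVec_congr {h : ℝ} {Φ Ψ : GridTensor d} (H : ∀ p ∈ interiorNodes d M, Φ p = Ψ p) :
    gridVec h M Φ = gridVec h M Ψ := by
  ext q
  simp [gridVec, H q.1 q.1.2]

lemma discElasticEnergy_eq (hℓ : 0 ≤ P.ℓ) (Φ : GridTensor d) :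
    discElasticEnergy P M Φ = P.L / 2 * ‖gradVec (P.ℓ / M) M Φ‖ ^ 2 := by
  rw [discElasticEnergy, norm_gradVec (by positivity)]

lemma expRatio_eq (Φ : GridTensor d) (s : ℝ) :
    expRatio P M Φ s = Real.exp (s - discBulkEnergy P M Φ) := by
  rw [expRatio, Real.exp_sub]

lemma expRatio_pos (Φ : GridTensor d) (s : ℝ) : 0 < expRatio P M Φ s := by
  rw [expRatio_eq]; exact Real.exp_pos _

/-- The interior nodes carry total weight at most ℓ^d, possibly less; positivity of C_* makes the
inequality go the right way. -/
lemma neg_Cstar_le_discBulkEnergy (hP : StableData d P η) (hM : 0 < M) (hQ : ∀ p, IsQTensor (Q p)) :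
    -P.Cstar ≤ discBulkEnergy P M Q := by
  have hℓ := hP.ℓ_pos
  have h1 := weighted_sum_le (d := d) (u := fun p => -bulkDensity P (Q p))
    (c := P.Cstar / P.ℓ ^ d) hℓ hM (by have := hP.Cstar_pos; positivity) fun p _ => by
      rw [le_div_iff₀ (by positivity)]
      linarith [hP.bulk_ge (Q p) (hQ p)]
  rw [div_mul_cancel₀ _ (by positivity), Finset.sum_neg_distrib] at h1
  unfold discBulkEnergy
  linarith

lemma IsAdmissible.expRatio_le (hP : StableData d P η) (hM : 0 < M)
    (hQ : IsAdmissible P M η E₀ Q s) : expRatio P M Q s ≤ Real.exp (E₀ + P.Cstar) := by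
  rw [expRatio_eq]
  have h1 := neg_Cstar_le_discBulkEnergy hP hM hQ.grid.1
  have h2 : 0 ≤ discElasticEnergy P M Q := by
    have := hP.L_pos; unfold discElasticEnergy; positivity
  exact Real.exp_le_exp.2 (by linarith [hQ.energy_le])

lemma IsAdmissible.neg_Cstar_le (hQ : IsAdmissible P M η E₀ Q s) : -P.Cstar ≤ E₀ := by
  linarith [hQ.cutoff_le, hQ.energy_le]

lemma IsGridQTensor.sub (hQ : IsGridQTensor M Q) (hQ' : IsGridQTensor M Q') :
    IsGridQTensor M (Q - Q') :=
  ⟨fun p => (hQ.1 p).sub (hQ'.1 p), fun p hp => by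
    rw [Pi.sub_apply, hQ.2 p hp, hQ'.2 p hp, sub_zero]⟩

/-- The energy inequality of implicit Euler; the discarded term is numerical dissipation. -/
lemma inner_sub_ge {E : Type*} [NormedAddCommGroup E] [InnerProductSpace ℝ E] (x y : E) :
    (‖y‖ ^ 2 - ‖x‖ ^ 2) / 2 ≤ inner ℝ y (y - x) := by
  have := norm_sub_sq_real y x
  rw [inner_sub_right, real_inner_self_eq_norm_sq]
  nlinarith [sq_nonneg ‖y - x‖]

/-- The Crank-Nicolson counterpart of `inner_sub_ge`, without dissipation. -/
lemma inner_half_add_sub {E : Type*} [NormedAddCommGroup E] [InnerProductSpace ℝ E] (x y : E) :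
    inner ℝ ((1 / 2 : ℝ) • (y + x)) (y - x) = (‖y‖ ^ 2 - ‖x‖ ^ 2) / 2 := by
  rw [real_inner_smul_left, inner_add_left, inner_sub_right, inner_sub_right,
    real_inner_self_eq_norm_sq, real_inner_self_eq_norm_sq, real_inner_comm]
  ring

/-- The first-order scheme as an identity between Euclidean vectors. -/
lemma FirstOrderStep.gridVec_eq (hS : FirstOrderStep P M τ Q s Q' s') :
    τ⁻¹ • gridVec (P.ℓ / M) M (Q' - Q)
      = P.L • gridVec (P.ℓ / M) M (discLaplacian (P.ℓ / M) Q')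
        + expRatio P M Q s • (gridVec (P.ℓ / M) M (gridForce P Q)
          - P.κ • gridVec (P.ℓ / M) M (Q' - Q)) := by
  simp only [← map_smul, ← map_sub, ← map_add]
  exact gridVec_congr hS.2.1

/-- The energy identity of the first-order scheme before the cut-off. -/
lemma FirstOrderStep.energy_le (hP : StableData d P η) (hτ : 0 < τ) (hQ : IsGridQTensor M Q)
    (hS : FirstOrderStep P M τ Q s Q' s') :
    discElasticEnergy P M Q'
        + (s - expRatio P M Q s * gridInner (P.ℓ / M) M (gridForce P Q) (Q' - Q))
      ≤ discElasticEnergy P M Q + s := by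
  have hℓ := hP.ℓ_pos.le
  have hh : 0 ≤ P.ℓ / M := by positivity
  have h1 := congrArg (fun v => inner ℝ v (gridVec (P.ℓ / M) M (Q' - Q))) hS.gridVec_eq
  simp only [inner_add_left, inner_smul_left, inner_sub_left, real_inner_self_eq_norm_sq,
    conj_trivial] at h1
  rw [inner_gridVec hh, inner_gridVec hh, gridInner_discLaplacian hh Q' (Q' - Q)
    (hS.1.sub hQ).2] at h1
  have h2 := inner_sub_ge (gradVec (P.ℓ / M) M Q) (gradVec (P.ℓ / M) M Q')
  rw [← map_sub] at h2
  rw [discElasticEnergy_eq hℓ, discElasticEnergy_eq hℓ]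
  set v := ‖gridVec (P.ℓ / M) M (Q' - Q)‖ ^ 2
  have hv : 0 ≤ v := by positivity
  have h3 : 0 ≤ τ⁻¹ * v := by positivity
  have h4 : 0 ≤ expRatio P M Q s * (P.κ * v) :=
    mul_nonneg (expRatio_pos Q s).le (mul_nonneg hP.κ_nonneg hv)
  have h5 := mul_le_mul_of_nonneg_left h2 hP.L_pos.le
  linarith

/-- The first-order scheme preserves the invariants. -/
lemma FirstOrderStep.isAdmissible (hP : StableData d P η) (hτ : 0 < τ)
    (hQ : IsAdmissible P M η E₀ Q s) (hS : FirstOrderStep P M τ Q s Q' s') :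
    IsAdmissible P M η E₀ Q' s' where
  grid := hS.1
  norm_le := by
    have hg := expRatio_pos (P := P) (M := M) Q s
    set g := expRatio P M Q s
    have hκ := hP.κ_nonneg
    have hη := hP.η_nonneg
    -- The scheme solved for the new value. The explicit side has norm at most (τ⁻¹ + gκ)η, without
    -- any restriction on τ.
    refine norm_le_of_resolvent_eq (W := fun p => τ⁻¹ • Q p + g • (bulkForce P (Q p) + P.κ • Q p))
      (α := τ⁻¹ + g * P.κ) hS.1.2 (by positivity) hP.L_pos.le hη (h := P.ℓ / M) (fun p hp => ?_)
      fun p _ => ?_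
    · have := hS.2.1 p hp
      calc (τ⁻¹ + g * P.κ) • Q' p
          = τ⁻¹ • (Q' p - Q p) + (τ⁻¹ • Q p + (g * P.κ) • Q' p) := by module
        _ = _ := by rw [this]; module
    · refine (norm_add_le _ _).trans ?_
      rw [norm_smul, norm_smul, Real.norm_of_nonneg (by positivity), Real.norm_of_nonneg hg.le,
        add_mul, mul_assoc]
      exact add_le_add (mul_le_mul_of_nonneg_left (hQ.norm_le p) (by positivity))
        (mul_le_mul_of_nonneg_left (hP.force_le _ (hQ.grid.1 p) (hQ.norm_le p)) hg.le)
  cutoff_le := by rw [hS.2.2]; exact le_max_right _ _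
  energy_le := by
    rw [hS.2.2, ← max_add_add_left]
    -- If the cut-off is active, the modified energy equals −C_*, which is at most E₀ by
    -- admissibility of the old pair.
    exact max_le ((hS.energy_le hP hτ hQ.grid).trans hQ.energy_le)
      (by linarith [hQ.neg_Cstar_le])

/-- The corrector of the second-order scheme. -/
structure CorrectorStep (P : Params) (M : ℕ) (τ : ℝ) (Qs : GridTensor d) (ss : ℝ)
    (Q : GridTensor d) (s : ℝ) (Q' : GridTensor d) (s' : ℝ) : Prop where
  grid : IsGridQTensor M Q'
  eq : ∀ p ∈ interiorNodes d M,
    τ⁻¹ • (Q' p - Q p) = P.L • discLaplacian (P.ℓ / M) ((1 / 2 : ℝ) • (Q' + Q)) p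
      + expRatio P M Qs ss •
        (bulkForce P (Qs p) - P.κ • ((1 / 2 : ℝ) • (Q' p + Q p) - Qs p))
  aux : s' = max
    (s - expRatio P M Qs ss * gridInner (P.ℓ / M) M (gridForce P Qs) (Q' - Q)
      + P.κ * expRatio P M Qs ss
        * gridInner (P.ℓ / M) M ((1 / 2 : ℝ) • (Q' + Q) - Qs) (Q' - Q))
    (-P.Cstar - discElasticEnergy P M Q')

lemma SecondOrderStep.exists_corrector (hS : SecondOrderStep P M τ Q s Q' s') :
    ∃ Qs ss, FirstOrderStep P M (τ / 2) Q s Qs ss ∧ CorrectorStep P M τ Qs ss Q s Q' s' := by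
  obtain ⟨Qs, ss, h1, h2, h3, h4⟩ := hS
  exact ⟨Qs, ss, h1, h2, h3, h4⟩

variable {Qs : GridTensor d} {ss : ℝ}

lemma CorrectorStep.gridVec_eq (hS : CorrectorStep P M τ Qs ss Q s Q' s') :
    τ⁻¹ • gridVec (P.ℓ / M) M (Q' - Q)
      = P.L • gridVec (P.ℓ / M) M (discLaplacian (P.ℓ / M) ((1 / 2 : ℝ) • (Q' + Q)))
        + expRatio P M Qs ss • (gridVec (P.ℓ / M) M (gridForce P Qs)
          - P.κ • gridVec (P.ℓ / M) M ((1 / 2 : ℝ) • (Q' + Q) - Qs)) := by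
  simp only [← map_smul, ← map_sub, ← map_add]
  exact gridVec_congr hS.eq

/-- Pairing with the increment cancels the force and the stabilization against the two corrections
in s, which were chosen for this purpose. The Laplacian gives the elastic difference exactly, and
only the kinetic term is dropped. -/
lemma CorrectorStep.energy_le (hP : StableData d P η) (hτ : 0 < τ) (hQ : IsGridQTensor M Q)
    (hS : CorrectorStep P M τ Qs ss Q s Q' s') :
    discElasticEnergy P M Q'
        + (s - expRatio P M Qs ss * gridInner (P.ℓ / M) M (gridForce P Qs) (Q' - Q)
          + P.κ * expRatio P M Qs ss
            * gridInner (P.ℓ / M) M ((1 / 2 : ℝ) • (Q' + Q) - Qs) (Q' - Q))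
      ≤ discElasticEnergy P M Q + s := by
  have hℓ := hP.ℓ_pos.le
  have hh : 0 ≤ P.ℓ / M := by positivity
  have h1 := congrArg (fun v => inner ℝ v (gridVec (P.ℓ / M) M (Q' - Q))) hS.gridVec_eq
  simp only [inner_add_left, inner_smul_left, inner_sub_left, real_inner_self_eq_norm_sq,
    conj_trivial] at h1
  rw [inner_gridVec hh, inner_gridVec hh, inner_gridVec hh, gridInner_discLaplacian hh _ (Q' - Q)
    (hS.grid.sub hQ).2, map_smul, map_add,
    map_sub (gradVec (P.ℓ / M) M), inner_half_add_sub] at h1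
  rw [discElasticEnergy_eq hℓ, discElasticEnergy_eq hℓ]
  have h3 : 0 ≤ τ⁻¹ * ‖gridVec (P.ℓ / M) M (Q' - Q)‖ ^ 2 := by positivity
  linarith

/-- The corrector preserves the invariants under the step size condition. -/
lemma CorrectorStep.isAdmissible (hP : StableData d P η) (hM : 0 < M) (hτ : 0 < τ)
    (hstep : τ ≤ (P.κ * Real.exp (E₀ + P.Cstar) / 2 + 2 ^ (d - 1) * P.L / (P.ℓ / M) ^ 2)⁻¹)
    (hQ : IsAdmissible P M η E₀ Q s) (hQs : IsAdmissible P M η E₀ Qs ss)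
    (hS : CorrectorStep P M τ Qs ss Q s Q' s') :
    IsAdmissible P M η E₀ Q' s' where
  grid := hS.grid
  norm_le := by
    have hg := expRatio_pos (P := P) (M := M) Qs ss
    have hgG := hQs.expRatio_le hP hM
    set g := expRatio P M Qs ss
    set G := Real.exp (E₀ + P.Cstar)
    have hκ := hP.κ_nonneg
    have hη := hP.η_nonneg
    have hL := hP.L_pos
    have hℓ := hP.ℓ_pos
    have hM' : (0 : ℝ) < M := by exact_mod_cast hM
    have hh : 0 < P.ℓ / M := by positivity
    -- The step size condition is exactly what makes the explicit half of the Crank-Nicolson step a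
    -- contraction.
    have hcoef : 2 * d * (P.L / 2) * (P.ℓ / M)⁻¹ ^ 2 ≤ τ⁻¹ - g * P.κ / 2 := by
      have h1 : P.κ * G / 2 + 2 ^ (d - 1) * P.L / (P.ℓ / M) ^ 2 ≤ τ⁻¹ := by
        rw [le_inv_comm₀ _ hτ]
        · exact hstep
        · positivity
      -- The stencil requires only dL/h²; the stated condition has 2^(d−1), which is 2 for d = 2 and
      -- 4 for d = 3.
      have h2 : (d : ℝ) ≤ 2 ^ (d - 1) := by
        rcases hP.dim with rfl | rfl <;> norm_num
      have h3 : (d : ℝ) * (P.L / (P.ℓ / M) ^ 2) ≤ 2 ^ (d - 1) * (P.L / (P.ℓ / M) ^ 2) := by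
        gcongr
      have h4 : P.κ * g ≤ P.κ * G := by gcongr
      have h5 : 2 * d * (P.L / 2) * (P.ℓ / M)⁻¹ ^ 2 = d * (P.L / (P.ℓ / M) ^ 2) := by
        rw [inv_pow]; ring
      have h6 : 2 ^ (d - 1) * P.L / (P.ℓ / M) ^ 2 = 2 ^ (d - 1) * (P.L / (P.ℓ / M) ^ 2) := by ring
      linarith
    refine norm_le_of_resolvent_eq
      (W := fun p => ((τ⁻¹ - g * P.κ / 2) • Q p + (P.L / 2) • discLaplacian (P.ℓ / M) Q p)
        + g • (bulkForce P (Qs p) + P.κ • Qs p))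
      (α := τ⁻¹ + g * P.κ / 2) (μ := P.L / 2) hS.grid.2 (by positivity) (by positivity) hη
      (h := P.ℓ / M) (fun p hp => ?_) fun p _ => ?_
    · have := hS.eq p hp
      rw [discLaplacian_smul, discLaplacian_add] at this
      calc (τ⁻¹ + g * P.κ / 2) • Q' p
          = τ⁻¹ • (Q' p - Q p) + (τ⁻¹ • Q p + (g * P.κ / 2) • Q' p) := by module
        _ = _ := by
            rw [this]
            simp only [Pi.smul_apply, Pi.add_apply]
            module
    · refine (norm_add_le _ _).trans ?_
      have h1 := norm_smul_add_discLaplacian_le (by positivity) hcoef hQ.norm_le p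
      have h2 : ‖g • (bulkForce P (Qs p) + P.κ • Qs p)‖ ≤ g * (P.κ * η) := by
        rw [norm_smul, Real.norm_of_nonneg hg.le]
        exact mul_le_mul_of_nonneg_left (hP.force_le _ (hQs.grid.1 p) (hQs.norm_le p)) hg.le
      refine (add_le_add h1 h2).trans (le_of_eq ?_)
      ring
  cutoff_le := by rw [hS.aux]; exact le_max_right _ _
  energy_le := by
    rw [hS.aux, ← max_add_add_left]
    exact max_le ((hS.energy_le hP hτ hQ.grid).trans hQ.energy_le)
      (by linarith [hQ.neg_Cstar_le])

/-! ### The consistency of the auxiliary variable -/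

/-- Raising x to a threshold below the target e only moves it closer. It is applied with e = E₁ₕ,
which lies above the cut-off. -/
lemma abs_max_sub_le {x c e : ℝ} (h : c ≤ e) : |max x c - e| ≤ |x - e| := by
  rcases le_total x c with hx | hx
  · rw [max_eq_right hx, abs_sub_comm, abs_of_nonneg (by linarith), abs_sub_comm,
      abs_of_nonneg (by linarith)]
    linarith
  · rw [max_eq_left hx]

/-- The linear bound serves where x is a defect to be propagated, the constant bound where the other
factor is already small. -/
lemma abs_one_sub_exp_le {x G : ℝ} (h1 : 1 ≤ G) (h : Real.exp x ≤ G) :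
    |1 - Real.exp x| ≤ G * |x| ∧ |1 - Real.exp x| ≤ G := by
  have hp := Real.exp_pos x
  constructor
  · rcases le_total 0 x with hx | hx
    · have h2 := Real.add_one_le_exp (-x)
      have h3 : Real.exp x * Real.exp (-x) = 1 := by rw [← Real.exp_add]; simp
      have h4 : Real.exp x * (-x + 1) ≤ Real.exp x * Real.exp (-x) := by gcongr
      have h5 : Real.exp x * x ≤ G * x := by gcongr
      have h6 := Real.one_le_exp hx
      rw [abs_of_nonneg hx, abs_sub_comm, abs_of_nonneg (by linarith)]
      linarith
    · have h2 := Real.add_one_le_exp x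
      have h6 := Real.exp_le_one_iff.2 hx
      rw [abs_of_nonpos hx, abs_of_nonneg (by linarith)]
      nlinarith
  · rw [abs_le]; constructor <;> linarith

lemma abs_gridInner_le {h : ℝ} (hh : 0 ≤ h) (Φ Ψ : GridTensor d) :
    |gridInner h M Φ Ψ| ≤ ‖gridVec h M Φ‖ * ‖gridVec h M Ψ‖ := by
  rw [← inner_gridVec hh]; exact abs_real_inner_le_norm _ _

lemma gridInner_sub_left {h : ℝ} (hh : 0 ≤ h) (Φ Φ' Ψ : GridTensor d) :
    gridInner h M (Φ - Φ') Ψ = gridInner h M Φ Ψ - gridInner h M Φ' Ψ := by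
  rw [← inner_gridVec hh, map_sub, inner_sub_left, inner_gridVec hh, inner_gridVec hh]

/-- A weighted sum of pointwise energy defects. -/
lemma abs_discBulkEnergy_sub_le (hℓ : 0 < P.ℓ) {Φ : GridTensor d} {K : ℝ} {u : (Fin d → ℤ) → ℝ}
    (H : ∀ p ∈ interiorNodes d M, |bulkDensity P (Q' p) - bulkDensity P (Q p)
      + frobInner (Φ p) (Q' p - Q p)| ≤ K * u p) :
    |discBulkEnergy P M Q' - discBulkEnergy P M Q + gridInner (P.ℓ / M) M Φ (Q' - Q)|
      ≤ K * ((P.ℓ / M) ^ d * ∑ p ∈ interiorNodes d M, u p) := by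
  rw [discBulkEnergy, discBulkEnergy, gridInner_eq_sum, ← mul_sub, ← mul_add,
    ← Finset.sum_sub_distrib, ← Finset.sum_add_distrib, abs_mul,
    abs_of_nonneg (show 0 ≤ (P.ℓ / M) ^ d by positivity), mul_left_comm]
  refine mul_le_mul_of_nonneg_left ?_ (by positivity)
  rw [Finset.mul_sum]
  exact (Finset.abs_sum_le_sum_abs _ _).trans (Finset.sum_le_sum H)

end Scheme

/-! ### The error recursion -/

/-- One step of the error recursion: `x, w, σ` are the discrete `L²` error, the discrete `H¹` error
and the defect of the auxiliary variable, `δ` is the norm of the difference quotient of the error, and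
`ρ` is the consistency order. -/
structure ErrorStep (A L τ ρ x w σ x' w' σ' δ : ℝ) : Prop where
  energy : τ * δ ^ 2 + L * w' ^ 2 ≤ L * w ^ 2 + τ * (A * (σ + x + ρ)) ^ 2
  err_le : x' ≤ x + τ * δ
  aux_le : σ' ≤ σ + A * τ * (σ + x + ρ + δ)

/-- Young's inequality on the cross term. The remaining τ² becomes Tτ, whence the factor 1 + T. -/
lemma add_mul_sq_le {τ T x y z : ℝ} (hτ : 0 < τ) (hτT : τ ≤ T) (hz : 0 ≤ z) (h : z ≤ x + τ * y) :
    z ^ 2 ≤ (1 + τ) * x ^ 2 + τ * (1 + T) * y ^ 2 := by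
  have h1 : z ^ 2 ≤ (x + τ * y) ^ 2 := pow_le_pow_left₀ hz h 2
  have h2 : τ * τ * y ^ 2 ≤ τ * T * y ^ 2 := by gcongr
  have h3 := mul_nonneg hτ.le (sq_nonneg (x - y))
  linarith

/-- The weight ε is chosen so that the δ² terms from x′² and σ′² sum to exactly τδ², which the
energy inequality supplies. Carrying ρ² on both sides makes the recursion homogeneous. -/
lemma ErrorStep.gronwall_step {A L T τ ρ x w σ x' w' σ' δ : ℝ}
    (h : ErrorStep A L τ ρ x w σ x' w' σ' δ) (hL : 0 ≤ L) (hτ : 0 < τ) (hτT : τ ≤ T)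
    (hx' : 0 ≤ x') (hσ' : 0 ≤ σ') {ε : ℝ} (hε : 0 < ε)
    (hεA : ε * ((1 + T) * (1 + 4 * A ^ 2)) = 1) :
    L * w' ^ 2 + ε * (x' ^ 2 + σ' ^ 2) + ρ ^ 2
      ≤ (1 + (1 + (3 * A ^ 2 + 1) / ε) * τ) * (L * w ^ 2 + ε * (x ^ 2 + σ ^ 2) + ρ ^ 2) := by
  have hT1 : 0 ≤ 1 + T := by linarith
  set S := σ ^ 2 + x ^ 2 + ρ ^ 2 with hS
  have hS0 : 0 ≤ S := by positivity
  have h1 := mul_le_mul_of_nonneg_left (add_mul_sq_le hτ hτT hx' h.err_le) hε.le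
  have h2 : σ' ^ 2 ≤ (1 + τ) * σ ^ 2 + τ * (1 + T) * (A * (σ + x + ρ + δ)) ^ 2 :=
    add_mul_sq_le hτ hτT hσ' (h.aux_le.trans (le_of_eq (by ring)))
  have h3 : (A * (σ + x + ρ + δ)) ^ 2 ≤ 4 * A ^ 2 * (S + δ ^ 2) := by
    have : (σ + x + ρ + δ) ^ 2 ≤ 4 * (S + δ ^ 2) := by
      have := sq_nonneg (σ - x); have := sq_nonneg (σ - ρ); have := sq_nonneg (σ - δ)
      have := sq_nonneg (x - ρ); have := sq_nonneg (x - δ); have := sq_nonneg (ρ - δ)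
      linarith
    calc _ = A ^ 2 * (σ + x + ρ + δ) ^ 2 := by ring
      _ ≤ A ^ 2 * (4 * (S + δ ^ 2)) := by gcongr
      _ = _ := by ring
  have h4 : (A * (σ + x + ρ)) ^ 2 ≤ 3 * A ^ 2 * S := by
    have : (σ + x + ρ) ^ 2 ≤ 3 * S := by
      have := sq_nonneg (σ - x); have := sq_nonneg (σ - ρ); have := sq_nonneg (x - ρ)
      linarith
    calc _ = A ^ 2 * (σ + x + ρ) ^ 2 := by ring
      _ ≤ A ^ 2 * (3 * S) := by gcongr
      _ = _ := by ring
  have h6 : ε * σ' ^ 2 ≤ ε * ((1 + τ) * σ ^ 2 + τ * (1 + T) * (4 * A ^ 2 * (S + δ ^ 2))) := by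
    gcongr
    exact h2.trans (by gcongr)
  have h7 : τ * (A * (σ + x + ρ)) ^ 2 ≤ τ * (3 * A ^ 2 * S) := by gcongr
  have h8 : ε * (1 + T) * (4 * A ^ 2) ≤ 1 := by linarith [mul_nonneg hε.le hT1]
  have hε1 : ε ≤ 1 := by
    have h9 : 0 ≤ ε * (T + (1 + T) * (4 * A ^ 2)) :=
      mul_nonneg hε.le (add_nonneg (hτ.le.trans hτT) (by positivity))
    linarith
  have h9 : τ * S * (ε * (1 + T) * (4 * A ^ 2)) ≤ τ * S * 1 := by gcongr
  have h10 : L * w' ^ 2 + ε * (x' ^ 2 + σ' ^ 2)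
      ≤ L * w ^ 2 + ε * (1 + τ) * (x ^ 2 + σ ^ 2) + τ * ((3 * A ^ 2 + 1) * S) := by
    have e1 : ε * (τ * (1 + T) * δ ^ 2) + ε * (τ * (1 + T) * (4 * A ^ 2 * δ ^ 2)) = τ * δ ^ 2 := by
      linear_combination (τ * δ ^ 2) * hεA
    calc _ = L * w' ^ 2 + ε * x' ^ 2 + ε * σ' ^ 2 := by ring
      _ ≤ (L * w ^ 2 + τ * (3 * A ^ 2 * S) - τ * δ ^ 2)
          + ε * ((1 + τ) * x ^ 2 + τ * (1 + T) * δ ^ 2)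
          + ε * ((1 + τ) * σ ^ 2 + τ * (1 + T) * (4 * A ^ 2 * (S + δ ^ 2))) :=
          add_le_add (add_le_add (by linarith [h.energy]) h1) h6
      _ = L * w ^ 2 + ε * (1 + τ) * (x ^ 2 + σ ^ 2) + τ * (3 * A ^ 2 * S)
          + τ * S * (ε * (1 + T) * (4 * A ^ 2)) := by linear_combination e1
      _ ≤ L * w ^ 2 + ε * (1 + τ) * (x ^ 2 + σ ^ 2) + τ * (3 * A ^ 2 * S) + τ * S * 1 := by
          gcongr
      _ = _ := by ring
  set q := (3 * A ^ 2 + 1) / ε with hqdef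
  have hq : 0 ≤ q := by positivity
  have h11 : (3 * A ^ 2 + 1) * S ≤ q * (ε * (x ^ 2 + σ ^ 2) + ρ ^ 2) := by
    have : (3 * A ^ 2 + 1) * S = q * (ε * S) := by
      rw [← mul_assoc, hqdef, div_mul_cancel₀ _ hε.ne']
    rw [this, hS]
    refine mul_le_mul_of_nonneg_left ?_ hq
    have := mul_le_mul_of_nonneg_right hε1 (sq_nonneg ρ)
    linarith
  have h13 : 0 ≤ τ * (L * w ^ 2) + τ * ρ ^ 2 + q * (τ * (L * w ^ 2)) := by positivity
  calc _ ≤ L * w ^ 2 + ε * (1 + τ) * (x ^ 2 + σ ^ 2)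
        + τ * (q * (ε * (x ^ 2 + σ ^ 2) + ρ ^ 2)) + ρ ^ 2
        + (τ * (L * w ^ 2) + τ * ρ ^ 2 + q * (τ * (L * w ^ 2))) := by
        have := mul_le_mul_of_nonneg_left h11 hτ.le
        linarith
    _ = _ := by ring

/-- The discrete Gronwall argument: errors that vanish initially stay of the order `ρ`. -/
lemma exists_gronwall_const (A : ℝ) {L T : ℝ} (hL : 0 < L) (hT : 0 < T) :
    ∃ C : ℝ, 0 < C ∧ ∀ (τ ρ : ℝ) (x w σ : ℕ → ℝ), 0 < τ → 0 ≤ ρ → (∀ n, 0 ≤ x n) →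
      (∀ n, 0 ≤ σ n) → x 0 = 0 → w 0 = 0 → σ 0 = 0 →
      (∀ n : ℕ, (n + 1 : ℝ) * τ ≤ T → ∃ δ,
        ErrorStep A L τ ρ (x n) (w n) (σ n) (x (n + 1)) (w (n + 1)) (σ (n + 1)) δ) →
      ∀ n : ℕ, n * τ ≤ T → x n ≤ C * ρ ∧ w n ≤ C * ρ ∧ σ n ≤ C * ρ := by
  set ε := ((1 + T) * (1 + 4 * A ^ 2))⁻¹ with hε
  have hε0 : 0 < ε := by positivity
  have hεA : ε * ((1 + T) * (1 + 4 * A ^ 2)) = 1 := inv_mul_cancel₀ (by positivity)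
  set K := 1 + (3 * A ^ 2 + 1) / ε with hK
  have hK0 : 0 < K := by positivity
  -- The first root recovers x and σ, which enter the functional with weight ε; the second recovers
  -- w, which has weight L.
  refine ⟨√(Real.exp (K * T) / ε) + √(Real.exp (K * T) / L), by positivity, ?_⟩
  intro τ ρ x w σ hτ hρ hx hσ hx0 hw0 hσ0 hstep
  set Y : ℕ → ℝ := fun n => L * w n ^ 2 + ε * (x n ^ 2 + σ n ^ 2) + ρ ^ 2 with hY
  have hYn : ∀ n : ℕ, n * τ ≤ T → Y n ≤ (1 + K * τ) ^ n * ρ ^ 2 := by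
    intro n
    induction n with
    | zero => intro _; simp [hY, hx0, hw0, hσ0]
    | succ n ih =>
      intro hn
      push_cast at hn
      obtain ⟨δ, hδ⟩ := hstep n hn
      have hτT : τ ≤ T := by nlinarith [(Nat.cast_nonneg n : (0 : ℝ) ≤ n)]
      have h1 := hδ.gronwall_step hL.le hτ hτT (hx _) (hσ _) hε0 hεA
      have h2 := ih (by nlinarith)
      calc Y (n + 1) ≤ (1 + K * τ) * Y n := h1
        _ ≤ (1 + K * τ) * ((1 + K * τ) ^ n * ρ ^ 2) := by gcongr
        _ = _ := by ring
  intro n hn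
  have h1 : Y n ≤ Real.exp (K * T) * ρ ^ 2 := by
    refine (hYn n hn).trans ?_
    gcongr
    calc (1 + K * τ) ^ n ≤ (Real.exp (K * τ)) ^ n := by
          gcongr; linarith [Real.add_one_le_exp (K * τ)]
      _ = Real.exp (K * (n * τ)) := by rw [← Real.exp_nat_mul]; ring_nf
      _ ≤ _ := by gcongr
  have h2 : ∀ y c : ℝ, 0 < c → c * y ^ 2 ≤ Y n → y ≤ √(Real.exp (K * T) / c) * ρ := by
    intro y c hc hy
    apply le_of_sq_le_sq _ (by positivity)
    rw [mul_pow, Real.sq_sqrt (by positivity), div_mul_eq_mul_div, le_div_iff₀ hc, mul_comm]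
    exact hy.trans h1
  have n1 : 0 ≤ L * w n ^ 2 := by positivity
  have n2 : 0 ≤ ε * x n ^ 2 := by positivity
  have n3 : 0 ≤ ε * σ n ^ 2 := by positivity
  have n4 : 0 ≤ ρ ^ 2 := by positivity
  have a1 := h2 (x n) ε hε0 (by simp only [hY]; linarith)
  have a2 := h2 (w n) L hL (by simp only [hY]; linarith)
  have a3 := h2 (σ n) ε hε0 (by simp only [hY]; linarith)
  have p1 : 0 ≤ √(Real.exp (K * T) / ε) * ρ := by positivity
  have p2 : 0 ≤ √(Real.exp (K * T) / L) * ρ := by positivity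
  refine ⟨?_, ?_, ?_⟩ <;> linarith

/-- The energy estimate behind both schemes. -/
lemma energy_estimate {E : Type*} [NormedAddCommGroup E] [InnerProductSpace ℝ E]
    {v D z : E} {τ L c q : ℝ} (hτ : 0 < τ) (hL : 0 ≤ L) (hc : 0 ≤ c)
    (heq : τ⁻¹ • v = L • D + z - c • v) (hD : inner ℝ D v ≤ -q / 2) :
    τ * (‖v‖ / τ) ^ 2 + L * q ≤ τ * ‖z‖ ^ 2 := by
  have h1 := congrArg (fun y => inner ℝ y v) heq
  simp only [inner_add_left, inner_smul_left, inner_sub_left, real_inner_self_eq_norm_sq,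
    conj_trivial] at h1
  have h2 : inner ℝ z v ≤ ‖z‖ * ‖v‖ := real_inner_le_norm _ _
  have h3 : 0 ≤ c * ‖v‖ ^ 2 := by positivity
  have h4 := mul_le_mul_of_nonneg_left hD hL
  set δ := ‖v‖ / τ with hδ
  have hv : ‖v‖ = τ * δ := by rw [hδ]; field_simp
  rw [hv] at h1 h2 h3
  have e : τ⁻¹ * (τ * δ) ^ 2 = τ * δ ^ 2 := by field_simp
  rw [e] at h1
  -- Young's inequality 2‖z‖δ ≤ ‖z‖² + δ², applied after doubling the tested equation.
  nlinarith [mul_nonneg hτ.le (sq_nonneg (‖z‖ - δ))]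

/-- The `L²` stability of the implicit Euler step. -/
lemma norm_le_of_implicit_step {E : Type*} [NormedAddCommGroup E] [InnerProductSpace ℝ E]
    {e e' D z : E} {τ L c : ℝ} (hτ : 0 < τ) (hL : 0 ≤ L) (hc : 0 ≤ c)
    (heq : τ⁻¹ • (e' - e) = L • D + z - c • (e' - e)) (hD : inner ℝ D e' ≤ 0) :
    ‖e'‖ ≤ ‖e‖ + τ * ‖z‖ := by
  have h1 := congrArg (fun y => inner ℝ y e') heq
  simp only [inner_add_left, inner_smul_left, inner_sub_left, real_inner_self_eq_norm_sq,
    conj_trivial] at h1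
  have h2 : inner ℝ z e' ≤ ‖z‖ * ‖e'‖ := real_inner_le_norm _ _
  have h3 : inner ℝ e e' ≤ ‖e‖ * ‖e'‖ := real_inner_le_norm _ _
  have h4 := mul_nonpos_of_nonneg_of_nonpos hL hD
  -- The negation makes ‖e'‖ positive, so that it cancels, and ‖e'‖ − ‖e‖ nonnegative, so that the
  -- stabilizing term can be dropped.
  by_contra! hlt
  have h0 : 0 < ‖e'‖ := (by positivity : 0 ≤ ‖e‖ + τ * ‖z‖).trans_lt hlt
  have hτ' : 0 < τ⁻¹ := by positivity
  have h5 : (τ⁻¹ + c) * (‖e'‖ ^ 2 - ‖e‖ * ‖e'‖) ≤ (τ⁻¹ + c) * (‖e'‖ ^ 2 - inner ℝ e e') := by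
    gcongr
  have h6 : (τ⁻¹ + c) * (‖e'‖ - ‖e‖) * ‖e'‖ ≤ ‖z‖ * ‖e'‖ := by nlinarith
  have h7 := le_of_mul_le_mul_right h6 h0
  have h8 : τ * ‖z‖ < ‖e'‖ - ‖e‖ := by linarith
  have h9 : τ⁻¹ * (τ * ‖z‖) < τ⁻¹ * (‖e'‖ - ‖e‖) := by gcongr
  rw [inv_mul_cancel_left₀ hτ.ne'] at h9
  have h10 : 0 ≤ c * (‖e'‖ - ‖e‖) := mul_nonneg hc (by nlinarith [norm_nonneg z])
  nlinarith

/-! ### The error of one step -/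

/-- Bounds for the bulk force and the bulk energy on the ball of radius `R`. -/
structure ForceBounds (d : ℕ) (P : Params) (R Λ : ℝ) : Prop where
  lip : ∀ A B : Matrix (Fin d) (Fin d) ℝ, ‖A‖ ≤ R → ‖B‖ ≤ R →
    ‖bulkForce P A - bulkForce P B‖ ≤ Λ * ‖A - B‖
  bound : ∀ A : Matrix (Fin d) (Fin d) ℝ, ‖A‖ ≤ R → ‖bulkForce P A‖ ≤ Λ
  density_one : ∀ A B : Matrix (Fin d) (Fin d) ℝ, IsQTensor A → IsQTensor B → ‖A‖ ≤ R → ‖B‖ ≤ R →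
    |bulkDensity P B - bulkDensity P A + frobInner (bulkForce P A) (B - A)| ≤ Λ * ‖B - A‖ ^ 2
  density_mid : ∀ A B : Matrix (Fin d) (Fin d) ℝ, IsQTensor A → IsQTensor B → ‖A‖ ≤ R → ‖B‖ ≤ R →
    |bulkDensity P B - bulkDensity P A
      + frobInner (bulkForce P ((1 / 2 : ℝ) • (B + A))) (B - A)| ≤ Λ * ‖B - A‖ ^ 3

lemma ForceBounds.mono {d : ℕ} {P : Params} {R Λ Λ' : ℝ} (h : ForceBounds d P R Λ) (hΛ : Λ ≤ Λ') :
    ForceBounds d P R Λ' where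
  lip A B hA hB := (h.lip A B hA hB).trans (by gcongr)
  bound A hA := (h.bound A hA).trans hΛ
  density_one A B hA hB hA' hB' := (h.density_one A B hA hB hA' hB').trans (by gcongr)
  density_mid A B hA hB hA' hB' := (h.density_mid A B hA hB hA' hB').trans (by gcongr)

lemma exists_forceBounds (d : ℕ) (P : Params) {R : ℝ} (hR : 0 ≤ R) :
    ∃ Λ, 0 ≤ Λ ∧ ForceBounds d P R Λ := by
  obtain ⟨K₁, h1, H1⟩ := exists_lipschitz_on_ball (contDiff_bulkForce (d := d) P) R
  obtain ⟨K₂, h2, H2⟩ := exists_abs_bulkDensity_sub_le d P R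
  have h3 : 0 ≤ |P.b| + |P.c| * R := by positivity
  have h4 : 0 ≤ K₁ * R := by positivity
  refine ⟨K₁ + K₁ * R + K₂ + (|P.b| + |P.c| * R), by positivity, ?_, ?_, ?_, ?_⟩
  · intro A B hA hB
    exact (H1 A B hA hB).trans (by gcongr; linarith)
  · intro A hA
    have := H1 A 0 hA (by simpa using hR)
    rw [bulkForce_zero, sub_zero, sub_zero] at this
    have h5 : K₁ * ‖A‖ ≤ K₁ * R := by gcongr
    linarith
  · intro A B hA hB hA' hB'
    exact (H2 A B hA hB hA' hB').trans (by gcongr; linarith)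
  · intro A B hA hB hA' hB'
    exact (abs_bulkDensity_sub_midpoint_le P R hA hB hA' hB').trans
      (mul_le_mul_of_nonneg_right (by linarith) (by positivity))

/-- A curve of grid functions that satisfies the equations of both schemes up to the consistency
errors. -/
structure IsConsistent {d : ℕ} (P : Params) (M : ℕ) (R Λ T : ℝ) (F : ℝ → GridTensor d) :
    Prop where
  grid : ∀ t ∈ Set.Icc 0 T, IsGridQTensor M (F t)
  norm_le : ∀ t ∈ Set.Icc 0 T, ∀ p, ‖F t p‖ ≤ R
  lip : ∀ t τ, 0 ≤ t → 0 < τ → t + τ ≤ T → ∀ p ∈ interiorNodes d M,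
    ‖F (t + τ) p - F t p‖ ≤ Λ * τ
  mid : ∀ t τ, 0 ≤ t → 0 < τ → t + τ ≤ T → ∀ p ∈ interiorNodes d M,
    ‖(1 / 2 : ℝ) • (F (t + τ) p + F t p) - F (t + τ / 2) p‖ ≤ Λ * τ ^ 2
  backward : ∀ t τ, 0 ≤ t → 0 < τ → t + τ ≤ T → ∀ p ∈ interiorNodes d M,
    ‖τ⁻¹ • (F (t + τ) p - F t p) - P.L • discLaplacian (P.ℓ / M) (F (t + τ)) p
      - bulkForce P (F t p)‖ ≤ Λ * (τ + (P.ℓ / M) ^ 2)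
  centered : ∀ t τ, 0 ≤ t → 0 < τ → t + τ ≤ T → ∀ p ∈ interiorNodes d M,
    ‖τ⁻¹ • (F (t + τ) p - F t p)
      - P.L • discLaplacian (P.ℓ / M) ((1 / 2 : ℝ) • (F (t + τ) + F t)) p
      - bulkForce P (F (t + τ / 2) p)‖ ≤ Λ * (τ ^ 2 + (P.ℓ / M) ^ 2)

/-- The standing assumptions of the error analysis; the constant `Λ` bounds all data. -/
structure ErrorSetting (d : ℕ) (P : Params) (M : ℕ) (η E₀ R Λ T : ℝ) (F : ℝ → GridTensor d) :
    Prop where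
  stable : StableData d P η
  M_pos : 0 < M
  one_le : 1 ≤ Λ
  η_le : η ≤ R
  R_le : R ≤ Λ
  κ_le : P.κ ≤ Λ
  vol_le : √(P.ℓ ^ d) ≤ Λ
  T_le : T ≤ Λ
  ratio_le : Real.exp (E₀ + P.Cstar) ≤ Λ
  force : ForceBounds d P R Λ
  cons : IsConsistent P M R Λ T F

section Step

variable {d M : ℕ} {P : Params} {η E₀ R Λ T t τ s s' ss : ℝ} {F : ℝ → GridTensor d}
  {Q Q' Qs : GridTensor d}

/-- The defect of the auxiliary variable. -/
def auxDefect (P : Params) (M : ℕ) (Q : GridTensor d) (s : ℝ) : ℝ := |s - discBulkEnergy P M Q|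

lemma IsAdmissible.norm_le_R (H : ErrorSetting d P M η E₀ R Λ T F)
    (hQ : IsAdmissible P M η E₀ Q s) (p : Fin d → ℤ) : ‖Q p‖ ≤ R := (hQ.norm_le p).trans H.η_le

lemma ErrorSetting.norm_gridVec_le (H : ErrorSetting d P M η E₀ R Λ T F) {c : ℝ} (hc : 0 ≤ c)
    {Φ : GridTensor d} (hΦ : ∀ p ∈ interiorNodes d M, ‖Φ p‖ ≤ c) :
    ‖gridVec (P.ℓ / M) M Φ‖ ≤ c * Λ :=
  (QTensorFlow.norm_gridVec_le H.stable.ℓ_pos H.M_pos hc hΦ).trans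
    (mul_le_mul_of_nonneg_left H.vol_le hc)

lemma ErrorSetting.norm_force_sub_le (H : ErrorSetting d P M η E₀ R Λ T F) {Φ Ψ : GridTensor d}
    (hΦ : ∀ p, ‖Φ p‖ ≤ R) (hΨ : ∀ p, ‖Ψ p‖ ≤ R) :
    ‖gridVec (P.ℓ / M) M (gridForce P Φ - gridForce P Ψ)‖
      ≤ Λ * ‖gridVec (P.ℓ / M) M (Φ - Ψ)‖ := by
  have := H.stable.ℓ_pos
  exact norm_gridVec_le_mul (by positivity) (zero_le_one.trans H.one_le) fun p _ =>
    H.force.lip _ _ (hΦ p) (hΨ p)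

lemma ErrorSetting.norm_force_le (H : ErrorSetting d P M η E₀ R Λ T F) {Φ : GridTensor d}
    (hΦ : ∀ p, ‖Φ p‖ ≤ R) : ‖gridVec (P.ℓ / M) M (gridForce P Φ)‖ ≤ Λ * Λ :=
  H.norm_gridVec_le (zero_le_one.trans H.one_le) fun p _ => H.force.bound _ (hΦ p)

/-- For the exact flow the factor is 1, and g = exp(s − E₁ₕ[Q]). The defect of the auxiliary
variable therefore measures the error in g. -/
lemma ErrorSetting.abs_one_sub_ratio_le (H : ErrorSetting d P M η E₀ R Λ T F)
    (hQ : IsAdmissible P M η E₀ Q s) :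
    |expRatio P M Q s - 1| ≤ Λ * auxDefect P M Q s ∧ |expRatio P M Q s - 1| ≤ Λ := by
  have h := (hQ.expRatio_le H.stable H.M_pos).trans H.ratio_le
  rw [expRatio_eq] at h
  rw [expRatio_eq, abs_sub_comm]
  exact abs_one_sub_exp_le H.one_le h

lemma ErrorSetting.ratio_mul_κ_le (H : ErrorSetting d P M η E₀ R Λ T F)
    (hQ : IsAdmissible P M η E₀ Q s) :
    0 ≤ expRatio P M Q s * P.κ ∧ expRatio P M Q s * P.κ ≤ Λ * Λ := by
  have h := (hQ.expRatio_le H.stable H.M_pos).trans H.ratio_le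
  have := expRatio_pos (P := P) (M := M) Q s
  have := H.stable.κ_nonneg
  have := H.κ_le
  exact ⟨by positivity, by gcongr; linarith⟩

/-- The increment is that of the error plus that of the exact solution, and the latter is O(τ). -/
lemma norm_increment_le (H : ErrorSetting d P M η E₀ R Λ T F) (ht : 0 ≤ t) (hτ : 0 < τ)
    (htT : t + τ ≤ T) (Q Q' : GridTensor d) :
    ‖gridVec (P.ℓ / M) M (Q' - Q)‖
      ≤ ‖gridVec (P.ℓ / M) M (Q' - F (t + τ)) - gridVec (P.ℓ / M) M (Q - F t)‖ + Λ * τ * Λ := by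
  have hΛ := zero_le_one.trans H.one_le
  have h1 := H.norm_gridVec_le (Φ := F (t + τ) - F t) (c := Λ * τ) (by positivity)
    fun p hp => H.cons.lip t τ ht hτ htT p hp
  have h2 : gridVec (P.ℓ / M) M (Q' - Q) = (gridVec (P.ℓ / M) M (Q' - F (t + τ))
      - gridVec (P.ℓ / M) M (Q - F t)) + gridVec (P.ℓ / M) M (F (t + τ) - F t) := by
    simp only [map_sub]; abel
  rw [h2]
  exact (norm_add_le _ _).trans (by gcongr)

/-- A crude consequence of the maximum bound, used to lower the degree of quadratic terms. -/
lemma norm_increment_le_two (H : ErrorSetting d P M η E₀ R Λ T F)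
    (hQ : IsAdmissible P M η E₀ Q s) (hQ' : IsAdmissible P M η E₀ Q' s') :
    ‖gridVec (P.ℓ / M) M (Q' - Q)‖ ≤ 2 * Λ * Λ := by
  have hΛ := zero_le_one.trans H.one_le
  refine H.norm_gridVec_le (by positivity) fun p _ => (norm_sub_le _ _).trans ?_
  linarith [hQ.norm_le_R H p, hQ'.norm_le_R H p, H.R_le]

/-- The error equation of the first-order step, with the residual `z`. -/
lemma FirstOrderStep.exists_error_eq (H : ErrorSetting d P M η E₀ R Λ T F) (ht : 0 ≤ t)
    (hτ : 0 < τ) (htT : t + τ ≤ T) (hQ : IsAdmissible P M η E₀ Q s)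
    (hS : FirstOrderStep P M τ Q s Q' s') :
    ∃ z, τ⁻¹ • (gridVec (P.ℓ / M) M (Q' - F (t + τ)) - gridVec (P.ℓ / M) M (Q - F t))
        = P.L • gridVec (P.ℓ / M) M (discLaplacian (P.ℓ / M) (Q' - F (t + τ))) + z
          - (expRatio P M Q s * P.κ) • (gridVec (P.ℓ / M) M (Q' - F (t + τ))
            - gridVec (P.ℓ / M) M (Q - F t)) ∧
      ‖z‖ ≤ 4 * Λ ^ 4 * (auxDefect P M Q s + ‖gridVec (P.ℓ / M) M (Q - F t)‖
        + (τ + (P.ℓ / M) ^ 2)) := by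
  have hΛ1 := H.one_le
  have hΛ := zero_le_one.trans hΛ1
  have htt : t ∈ Set.Icc 0 T := ⟨ht, by linarith⟩
  have heq := hS.gridVec_eq
  have hg := H.abs_one_sub_ratio_le hQ
  have hgκ := H.ratio_mul_κ_le hQ
  set g := expRatio P M Q s
  set r : GridTensor d := τ⁻¹ • (F (t + τ) - F t)
    - P.L • discLaplacian (P.ℓ / M) (F (t + τ)) - gridForce P (F t) with hr
  -- Only the exact increment in the stabilizing term joins the residual. Its error part stays in
  -- the equation, where it is dissipative.
  refine ⟨(g - 1) • gridVec (P.ℓ / M) M (gridForce P Q)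
    + gridVec (P.ℓ / M) M (gridForce P Q - gridForce P (F t))
    - (g * P.κ) • gridVec (P.ℓ / M) M (F (t + τ) - F t) - gridVec (P.ℓ / M) M r, ?_, ?_⟩
  · rw [discLaplacian_sub, hr]
    simp only [map_sub, map_smul] at heq ⊢
    linear_combination (norm := module) heq
  · have b1 := H.norm_force_le (hQ.norm_le_R H)
    have b2 := H.norm_force_sub_le (hQ.norm_le_R H) (H.cons.norm_le t htt)
    have b3 := H.norm_gridVec_le (Φ := F (t + τ) - F t) (c := Λ * τ) (by positivity)
      fun p hp => H.cons.lip t τ ht hτ htT p hp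
    have b4 := H.norm_gridVec_le (Φ := r) (c := Λ * (τ + (P.ℓ / M) ^ 2)) (by positivity)
      fun p hp => H.cons.backward t τ ht hτ htT p hp
    set x := ‖gridVec (P.ℓ / M) M (Q - F t)‖
    have hx : 0 ≤ x := norm_nonneg _
    have hσ : 0 ≤ auxDefect P M Q s := abs_nonneg _
    set σ := auxDefect P M Q s
    have hh : 0 ≤ (P.ℓ / M) ^ 2 := sq_nonneg _
    set k := (P.ℓ / M) ^ 2
    have c1 : ‖(g - 1) • gridVec (P.ℓ / M) M (gridForce P Q)‖ ≤ Λ * σ * (Λ * Λ) := by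
      rw [norm_smul, Real.norm_eq_abs]; gcongr; exact hg.1
    have c3 : ‖(g * P.κ) • gridVec (P.ℓ / M) M (F (t + τ) - F t)‖ ≤ Λ * Λ * (Λ * τ * Λ) := by
      rw [norm_smul, Real.norm_of_nonneg hgκ.1]
      exact mul_le_mul hgκ.2 b3 (norm_nonneg _) (by positivity)
    have c := (norm_sub_le _ _).trans (add_le_add ((norm_sub_le _ _).trans (add_le_add
      ((norm_add_le _ _).trans (add_le_add c1 b2)) c3)) b4)
    refine c.trans ?_
    have e1 : Λ ^ 3 * σ ≤ Λ ^ 4 * σ := by gcongr; norm_num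
    have e2 : Λ ^ 1 * x ≤ Λ ^ 4 * x := by gcongr; norm_num
    have e3 : Λ ^ 2 * (τ + k) ≤ Λ ^ 4 * (τ + k) := by gcongr; norm_num
    have e4 : 0 ≤ Λ ^ 4 * σ := by positivity
    have e5 : 0 ≤ Λ ^ 4 * x := by positivity
    have e6 : 0 ≤ Λ ^ 4 * k := by positivity
    have e7 : 0 ≤ Λ ^ 4 * τ := by positivity
    linarith

/-- The evolution of the defect of the auxiliary variable in the first-order step. -/
lemma FirstOrderStep.auxDefect_le (H : ErrorSetting d P M η E₀ R Λ T F)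
    (hQ : IsAdmissible P M η E₀ Q s) (hQ' : IsAdmissible P M η E₀ Q' s')
    (hS : FirstOrderStep P M τ Q s Q' s') :
    auxDefect P M Q' s' ≤ auxDefect P M Q s
      + |expRatio P M Q s - 1| * (Λ * Λ * ‖gridVec (P.ℓ / M) M (Q' - Q)‖)
      + Λ * ‖gridVec (P.ℓ / M) M (Q' - Q)‖ ^ 2 := by
  have hℓ := H.stable.ℓ_pos
  have hh : 0 ≤ P.ℓ / M := by positivity
  have hb1 := neg_Cstar_le_discBulkEnergy H.stable H.M_pos hQ'.grid.1
  have hb2 : 0 ≤ discElasticEnergy P M Q' := by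
    have := H.stable.L_pos; unfold discElasticEnergy; positivity
  have h1 : auxDefect P M Q' s' ≤ |s - expRatio P M Q s
      * gridInner (P.ℓ / M) M (gridForce P Q) (Q' - Q) - discBulkEnergy P M Q'| := by
    rw [auxDefect, hS.2.2]
    exact abs_max_sub_le (by linarith)
  have h2 := abs_discBulkEnergy_sub_le (M := M) (Q := Q) (Q' := Q') (Φ := gridForce P Q) (K := Λ)
    (u := fun p => ‖Q' p - Q p‖ ^ 2) hℓ fun p _ => H.force.density_one _ _ (hQ.grid.1 p)
      (hQ'.grid.1 p) (hQ.norm_le_R H p) (hQ'.norm_le_R H p)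
  have h3 := norm_gridVec_sq (M := M) hh (Q' - Q)
  simp only [Pi.sub_apply] at h3
  rw [← h3] at h2
  have h4 : |gridInner (P.ℓ / M) M (gridForce P Q) (Q' - Q)|
      ≤ Λ * Λ * ‖gridVec (P.ℓ / M) M (Q' - Q)‖ :=
    (abs_gridInner_le hh _ _).trans (by gcongr; exact H.norm_force_le (hQ.norm_le_R H))
  set g := expRatio P M Q s
  set f := gridInner (P.ℓ / M) M (gridForce P Q) (Q' - Q)
  have h5 : |(g - 1) * f| ≤ |g - 1| * (Λ * Λ * ‖gridVec (P.ℓ / M) M (Q' - Q)‖) := by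
    rw [abs_mul]; gcongr
  -- Old defect, deviation of g from 1, and Taylor remainder of the energy.
  have h6 : s - g * f - discBulkEnergy P M Q' = (s - discBulkEnergy P M Q) - (g - 1) * f
      - (discBulkEnergy P M Q' - discBulkEnergy P M Q + f) := by ring
  rw [h6] at h1
  exact h1.trans ((abs_sub _ _).trans (add_le_add ((abs_sub _ _).trans (add_le_add le_rfl h5)) h2))

end Step

/-! ### One-step error recursion of the first scheme; predictor and corrector estimates -/

section StepConclusions

variable {d M : ℕ} {P : Params} {η E₀ R Λ T t τ s s' ss : ℝ} {F : ℝ → GridTensor d}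
  {Q Q' Qs : GridTensor d}

lemma inner_discLaplacian_self_nonpos {h : ℝ} (hh : 0 ≤ h) {Φ : GridTensor d}
    (hΦ : IsGridQTensor M Φ) :
    inner ℝ (gridVec h M (discLaplacian h Φ)) (gridVec h M Φ) ≤ 0 := by
  rw [inner_gridVec hh, gridInner_discLaplacian hh _ _ hΦ.2, real_inner_self_eq_norm_sq]
  exact neg_nonpos.2 (sq_nonneg _)

/-- This and the next lemma supply the Laplacian hypothesis of `energy_estimate`, by inequality for
implicit Euler and by equality for Crank-Nicolson. -/
lemma inner_discLaplacian_sub_le {h : ℝ} (hh : 0 ≤ h) {Φ Ψ : GridTensor d}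
    (hΦ : IsGridQTensor M Φ) (hΨ : IsGridQTensor M Ψ) :
    inner ℝ (gridVec h M (discLaplacian h Ψ)) (gridVec h M Ψ - gridVec h M Φ)
      ≤ -(‖gradVec h M Ψ‖ ^ 2 - ‖gradVec h M Φ‖ ^ 2) / 2 := by
  rw [← map_sub, inner_gridVec hh, gridInner_discLaplacian hh _ _ (hΨ.sub hΦ).2, map_sub]
  linarith [inner_sub_ge (gradVec h M Φ) (gradVec h M Ψ)]

lemma inner_discLaplacian_half_sub {h : ℝ} (hh : 0 ≤ h) {Φ Ψ : GridTensor d}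
    (hΦ : IsGridQTensor M Φ) (hΨ : IsGridQTensor M Ψ) :
    inner ℝ (gridVec h M (discLaplacian h ((1 / 2 : ℝ) • (Ψ + Φ)))) (gridVec h M Ψ - gridVec h M Φ)
      = -(‖gradVec h M Ψ‖ ^ 2 - ‖gradVec h M Φ‖ ^ 2) / 2 := by
  rw [← map_sub, inner_gridVec hh, gridInner_discLaplacian hh _ _ (hΨ.sub hΦ).2, map_sub, map_smul,
    map_add, inner_half_add_sub]
  ring

/-- The discrete `L²` norm of the error. -/
def errNorm (P : Params) (M : ℕ) (Q G : GridTensor d) : ℝ := ‖gridVec (P.ℓ / M) M (Q - G)‖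

/-- The discrete `H¹` seminorm of the error. -/
def errGrad (P : Params) (M : ℕ) (Q G : GridTensor d) : ℝ := ‖gradVec (P.ℓ / M) M (Q - G)‖

/-- The error recursion of the first-order scheme. -/
lemma FirstOrderStep.exists_errorStep (H : ErrorSetting d P M η E₀ R Λ T F) (ht : 0 ≤ t)
    (hτ : 0 < τ) (htT : t + τ ≤ T) (hQ : IsAdmissible P M η E₀ Q s)
    (hS : FirstOrderStep P M τ Q s Q' s') :
    ∃ δ, ErrorStep (10 * Λ ^ 5) P.L τ (τ + (P.ℓ / M) ^ 2)
      (errNorm P M Q (F t)) (errGrad P M Q (F t)) (auxDefect P M Q s)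
      (errNorm P M Q' (F (t + τ))) (errGrad P M Q' (F (t + τ))) (auxDefect P M Q' s') δ := by
  have hΛ1 := H.one_le
  have hΛ := zero_le_one.trans hΛ1
  have hℓ := H.stable.ℓ_pos
  have hh : 0 ≤ P.ℓ / M := by positivity
  have hQ' := hS.isAdmissible H.stable hτ hQ
  obtain ⟨z, hz, hzn⟩ := hS.exists_error_eq H ht hτ htT hQ
  have hg := H.abs_one_sub_ratio_le hQ
  have haux := hS.auxDefect_le H hQ hQ'
  have hinc := norm_increment_le H ht hτ htT Q Q'
  have hinc2 := norm_increment_le_two H hQ hQ'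
  have heG := hQ.grid.sub (H.cons.grid t ⟨ht, by linarith⟩)
  have heG' := hQ'.grid.sub (H.cons.grid (t + τ) ⟨by linarith, htT⟩)
  have hen := energy_estimate hτ H.stable.L_pos.le (H.ratio_mul_κ_le hQ).1 hz
    (inner_discLaplacian_sub_le hh heG heG')
  set v := gridVec (P.ℓ / M) M (Q' - F (t + τ)) - gridVec (P.ℓ / M) M (Q - F t) with hv
  have hvδ : ‖v‖ = τ * (‖v‖ / τ) := by field_simp
  have hδ0 : 0 ≤ ‖v‖ / τ := by positivity
  refine ⟨‖v‖ / τ, ?_, ?_, ?_⟩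
  · have hz2 : ‖z‖ ≤ 10 * Λ ^ 5 * (auxDefect P M Q s + errNorm P M Q (F t)
        + (τ + (P.ℓ / M) ^ 2)) := by
      refine hzn.trans (mul_le_mul_of_nonneg_right ?_ ?_)
      · have : Λ ^ 4 ≤ Λ ^ 5 := by gcongr; norm_num
        linarith [pow_nonneg hΛ 5]
      · have : 0 ≤ auxDefect P M Q s := abs_nonneg _
        positivity
    have hz3 : τ * ‖z‖ ^ 2 ≤ τ * (10 * Λ ^ 5 * (auxDefect P M Q s + errNorm P M Q (F t)
        + (τ + (P.ℓ / M) ^ 2))) ^ 2 := by gcongr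
    unfold errGrad
    linarith
  · rw [← hvδ, errNorm, errNorm, hv]
    exact norm_le_insert' _ _
  · generalize ‖v‖ / τ = δ at hvδ hδ0 ⊢
    rw [hvδ] at hinc
    set y := ‖gridVec (P.ℓ / M) M (Q' - Q)‖
    have hy0 : 0 ≤ y := norm_nonneg _
    have hx0 : 0 ≤ errNorm P M Q (F t) := norm_nonneg _
    have hσ0 : 0 ≤ auxDefect P M Q s := abs_nonneg _
    set σ := auxDefect P M Q s
    set a := |expRatio P M Q s - 1|
    have ha0 : 0 ≤ a := abs_nonneg _
    have hk : 0 ≤ (P.ℓ / M) ^ 2 := sq_nonneg _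
    have hτΛ : τ ≤ Λ := by linarith [H.T_le]
    -- The constant bound on |g − 1| meets the error increment τδ; the bound by σ meets the exact
    -- increment, of size τ. Every product then keeps one factor τ.
    have a1 : a * y ≤ Λ * (τ * δ) + Λ * σ * (Λ * τ * Λ) := by
      calc a * y ≤ a * (τ * δ + Λ * τ * Λ) := by gcongr
        _ = a * (τ * δ) + a * (Λ * τ * Λ) := by ring
        _ ≤ _ := by gcongr; exacts [hg.2, hg.1]
    -- One factor of each product with τδ is bounded by a constant. The leftover τ² is τ times the
    -- first-order consistency error.
    have a2 : y ^ 2 ≤ 2 * Λ * Λ * (τ * δ) + (Λ * Λ * (Λ * (τ * δ)) + Λ * τ * Λ * (τ * Λ * Λ)) := by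
      have b1 : Λ * τ * Λ * (τ * δ) ≤ Λ * Λ * (Λ * (τ * δ)) := by
        calc _ = Λ * Λ * (τ * (τ * δ)) := by ring
          _ ≤ _ := by gcongr
      calc y ^ 2 = y * y := sq y
        _ ≤ y * (τ * δ + Λ * τ * Λ) := by gcongr
        _ = y * (τ * δ) + Λ * τ * Λ * y := by ring
        _ ≤ 2 * Λ * Λ * (τ * δ) + Λ * τ * Λ * (τ * δ + Λ * τ * Λ) := by gcongr
        _ ≤ _ := by linarith
    have a3 := mul_le_mul_of_nonneg_left a1 (mul_nonneg hΛ hΛ)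
    have a4 := mul_le_mul_of_nonneg_left a2 hΛ
    have hτδ : 0 ≤ τ * δ := by positivity
    have e3 : Λ ^ 3 * (τ * δ) ≤ Λ ^ 5 * (τ * δ) := by gcongr; norm_num
    have e4 : Λ ^ 4 * (τ * δ) ≤ Λ ^ 5 * (τ * δ) := by gcongr; norm_num
    have n1 : 0 ≤ Λ ^ 5 * (τ * δ) := by positivity
    have n2 : 0 ≤ Λ ^ 5 * (τ * σ) := by positivity
    have n3 : 0 ≤ Λ ^ 5 * (τ * errNorm P M Q (F t)) := by positivity
    have n4 : 0 ≤ Λ ^ 5 * (τ * (P.ℓ / M) ^ 2) := by positivity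
    have n5 : 0 ≤ Λ ^ 5 * (τ * τ) := by positivity
    linarith

/-- The error of the predictor of the second-order scheme. -/
lemma FirstOrderStep.predictor_le (H : ErrorSetting d P M η E₀ R Λ T F) (ht : 0 ≤ t)
    (hτ : 0 < τ) (htT : t + τ ≤ T) (hQ : IsAdmissible P M η E₀ Q s)
    (hS : FirstOrderStep P M τ Q s Q' s') :
    errNorm P M Q' (F (t + τ)) ≤ 5 * Λ ^ 5 *
        (auxDefect P M Q s + errNorm P M Q (F t) + (τ ^ 2 + (P.ℓ / M) ^ 2)) ∧
      auxDefect P M Q' s' ≤ 22 * Λ ^ 9 *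
        (auxDefect P M Q s + errNorm P M Q (F t) + (τ ^ 2 + (P.ℓ / M) ^ 2)) := by
  have hΛ1 := H.one_le
  have hΛ := zero_le_one.trans hΛ1
  have hℓ := H.stable.ℓ_pos
  have hh : 0 ≤ P.ℓ / M := by positivity
  have hQ' := hS.isAdmissible H.stable hτ hQ
  obtain ⟨z, hz, hzn⟩ := hS.exists_error_eq H ht hτ htT hQ
  have hg := H.abs_one_sub_ratio_le hQ
  have haux := hS.auxDefect_le H hQ hQ'
  have hinc := norm_increment_le H ht hτ htT Q Q'
  have hinc2 := norm_increment_le_two H hQ hQ'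
  have heG' := hQ'.grid.sub (H.cons.grid (t + τ) ⟨by linarith, htT⟩)
  have hn := norm_le_of_implicit_step hτ H.stable.L_pos.le (H.ratio_mul_κ_le hQ).1 hz
    (inner_discLaplacian_self_nonpos hh heG')
  have hsub := norm_sub_le (gridVec (P.ℓ / M) M (Q' - F (t + τ))) (gridVec (P.ℓ / M) M (Q - F t))
  change errNorm P M Q' (F (t + τ)) ≤ errNorm P M Q (F t) + _ at hn
  change _ ≤ 4 * Λ ^ 4 * (_ + errNorm P M Q (F t) + _) at hzn
  change _ ≤ errNorm P M Q' (F (t + τ)) + errNorm P M Q (F t) at hsub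
  set y := ‖gridVec (P.ℓ / M) M (Q' - Q)‖
  have hy0 : 0 ≤ y := norm_nonneg _
  have hx0 : 0 ≤ errNorm P M Q (F t) := norm_nonneg _
  have hx0' : 0 ≤ errNorm P M Q' (F (t + τ)) := norm_nonneg _
  have hσ0 : 0 ≤ auxDefect P M Q s := abs_nonneg _
  set σ := auxDefect P M Q s
  set x := errNorm P M Q (F t)
  set x' := errNorm P M Q' (F (t + τ))
  have hk : 0 ≤ (P.ℓ / M) ^ 2 := sq_nonneg _
  set k := (P.ℓ / M) ^ 2
  have hτΛ : τ ≤ Λ := by linarith [H.T_le]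
  have hx' : x' ≤ 5 * Λ ^ 5 * (σ + x + (τ ^ 2 + k)) := by
    -- The extra factor τ in front of the residual turns its first-order part into τ²; this is the
    -- gain of a single Euler step.
    have h1 : τ * ‖z‖ ≤ 4 * Λ ^ 4 * (τ * (σ + x + k)) + 4 * Λ ^ 4 * τ ^ 2 := by
      refine (mul_le_mul_of_nonneg_left hzn hτ.le).trans (le_of_eq ?_); ring
    have h2 : 4 * Λ ^ 4 * (τ * (σ + x + k)) ≤ 4 * Λ ^ 4 * (Λ * (σ + x + k)) := by gcongr
    have h3 : Λ ^ 4 * τ ^ 2 ≤ Λ ^ 5 * τ ^ 2 := by gcongr; norm_num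
    have h4 : Λ ^ 0 * x ≤ Λ ^ 5 * x := by gcongr; norm_num
    have n1 : 0 ≤ Λ ^ 5 * (σ + τ ^ 2 + k) := by positivity
    linarith
  refine ⟨hx', ?_⟩
  have a1 : |expRatio P M Q s - 1| * (Λ * Λ * y) ≤ Λ * σ * (Λ * Λ * (2 * Λ * Λ)) := by
    gcongr; exact hg.1
  -- The increment is bounded by errors plus O(τ). Its square is kept linear in the errors by the
  -- crude bound and leaves only τ².
  have a2 : y ^ 2 ≤ (2 * Λ ^ 2 + Λ ^ 3) * (x + x') + Λ ^ 4 * τ ^ 2 := by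
    have b : y ≤ (x + x') + Λ * τ * Λ := by linarith
    calc y ^ 2 = y * y := sq y
      _ ≤ y * ((x + x') + Λ * τ * Λ) := by gcongr
      _ = y * (x + x') + Λ * τ * Λ * y := by ring
      _ ≤ 2 * Λ * Λ * (x + x') + Λ * τ * Λ * ((x + x') + Λ * τ * Λ) := by gcongr
      _ = 2 * Λ * Λ * (x + x') + Λ * Λ * (τ * (x + x')) + Λ ^ 4 * τ ^ 2 := by ring
      _ ≤ 2 * Λ * Λ * (x + x') + Λ * Λ * (Λ * (x + x')) + Λ ^ 4 * τ ^ 2 := by gcongr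
      _ = _ := by ring
  set S := σ + x + (τ ^ 2 + k) with hS'
  have hS0 : 0 ≤ S := by positivity
  have hxS : x ≤ S := by rw [hS']; linarith [sq_nonneg τ]
  have hσS : σ ≤ S := by rw [hS']; linarith [sq_nonneg τ]
  have hτS : τ ^ 2 ≤ S := by rw [hS']; linarith
  have a3 : Λ * y ^ 2 ≤ Λ * ((2 * Λ ^ 2 + Λ ^ 3) * (S + 5 * Λ ^ 5 * S) + Λ ^ 4 * S) := by
    refine mul_le_mul_of_nonneg_left (a2.trans ?_) hΛ
    gcongr
  have a4 : Λ * σ * (Λ * Λ * (2 * Λ * Λ)) ≤ Λ * S * (Λ * Λ * (2 * Λ * Λ)) := by gcongr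
  have e0 : Λ ^ 0 * S ≤ Λ ^ 9 * S := by gcongr; norm_num
  have e3 : Λ ^ 3 * S ≤ Λ ^ 9 * S := by gcongr; norm_num
  have e4 : Λ ^ 4 * S ≤ Λ ^ 9 * S := by gcongr; norm_num
  have e5 : Λ ^ 5 * S ≤ Λ ^ 9 * S := by gcongr; norm_num
  have e8 : Λ ^ 8 * S ≤ Λ ^ 9 * S := by gcongr; norm_num
  linarith

/-- The error equation of the corrector step, with the residual `z`. -/
lemma CorrectorStep.exists_error_eq (H : ErrorSetting d P M η E₀ R Λ T F) (ht : 0 ≤ t)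
    (hτ : 0 < τ) (htT : t + τ ≤ T) (hQs : IsAdmissible P M η E₀ Qs ss)
    (hS : CorrectorStep P M τ Qs ss Q s Q' s') :
    ∃ z, τ⁻¹ • (gridVec (P.ℓ / M) M (Q' - F (t + τ)) - gridVec (P.ℓ / M) M (Q - F t))
        = P.L • gridVec (P.ℓ / M) M (discLaplacian (P.ℓ / M)
            ((1 / 2 : ℝ) • ((Q' - F (t + τ)) + (Q - F t)))) + z
          - (expRatio P M Qs ss * P.κ / 2) • (gridVec (P.ℓ / M) M (Q' - F (t + τ))
            - gridVec (P.ℓ / M) M (Q - F t)) ∧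
      ‖z‖ ≤ 3 * Λ ^ 4 * (auxDefect P M Qs ss + errNorm P M Qs (F (t + τ / 2))
        + errNorm P M Q (F t) + (τ ^ 2 + (P.ℓ / M) ^ 2)) := by
  have hΛ1 := H.one_le
  have hΛ := zero_le_one.trans hΛ1
  have htt : t + τ / 2 ∈ Set.Icc 0 T := ⟨by linarith, by linarith⟩
  have heq := hS.gridVec_eq
  have hg := H.abs_one_sub_ratio_le hQs
  have hgκ := H.ratio_mul_κ_le hQs
  set g := expRatio P M Qs ss
  set r : GridTensor d := τ⁻¹ • (F (t + τ) - F t)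
    - P.L • discLaplacian (P.ℓ / M) ((1 / 2 : ℝ) • (F (t + τ) + F t))
    - gridForce P (F (t + τ / 2)) with hr
  set m : GridTensor d := (1 / 2 : ℝ) • (F (t + τ) + F t) - F (t + τ / 2) with hm
  -- Here the midpoint minus the predictor is half the error increment, plus the old error, plus the
  -- midpoint defect m, minus the predictor error. Only the first part stays outside the residual.
  refine ⟨(g - 1) • gridVec (P.ℓ / M) M (gridForce P Qs)
    + gridVec (P.ℓ / M) M (gridForce P Qs - gridForce P (F (t + τ / 2)))
    + (g * P.κ) • gridVec (P.ℓ / M) M (Qs - F (t + τ / 2))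
    - (g * P.κ) • gridVec (P.ℓ / M) M m - gridVec (P.ℓ / M) M r
    - (g * P.κ) • gridVec (P.ℓ / M) M (Q - F t), ?_, ?_⟩
  · rw [hr, hm]
    simp only [discLaplacian_sub, discLaplacian_add, discLaplacian_smul, map_sub, map_smul,
      map_add] at heq ⊢
    linear_combination (norm := module) heq
  · have b1 := H.norm_force_le (hQs.norm_le_R H)
    have b2 := H.norm_force_sub_le (hQs.norm_le_R H) (H.cons.norm_le _ htt)
    have b3 := H.norm_gridVec_le (Φ := m) (c := Λ * τ ^ 2) (by positivity)
      fun p hp => H.cons.mid t τ ht hτ htT p hp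
    have b4 := H.norm_gridVec_le (Φ := r) (c := Λ * (τ ^ 2 + (P.ℓ / M) ^ 2)) (by positivity)
      fun p hp => H.cons.centered t τ ht hτ htT p hp
    change _ ≤ Λ * errNorm P M Qs (F (t + τ / 2)) at b2
    have hx0 : 0 ≤ errNorm P M Q (F t) := norm_nonneg _
    have hxs0 : 0 ≤ errNorm P M Qs (F (t + τ / 2)) := norm_nonneg _
    have hσ : 0 ≤ auxDefect P M Qs ss := abs_nonneg _
    have hk : 0 ≤ (P.ℓ / M) ^ 2 := sq_nonneg _
    have c0 : ∀ Φ : GridTensor d, ∀ c, ‖gridVec (P.ℓ / M) M Φ‖ ≤ c →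
        ‖(g * P.κ) • gridVec (P.ℓ / M) M Φ‖ ≤ Λ * Λ * c := fun Φ c hc => by
      rw [norm_smul, Real.norm_of_nonneg hgκ.1]
      exact mul_le_mul hgκ.2 hc (norm_nonneg _) (by positivity)
    have c1 : ‖(g - 1) • gridVec (P.ℓ / M) M (gridForce P Qs)‖
        ≤ Λ * auxDefect P M Qs ss * (Λ * Λ) := by
      rw [norm_smul, Real.norm_eq_abs]; gcongr; exact hg.1
    have c := (norm_sub_le _ _).trans (add_le_add ((norm_sub_le _ _).trans (add_le_add
      ((norm_sub_le _ _).trans (add_le_add ((norm_add_le _ _).trans (add_le_add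
      ((norm_add_le _ _).trans (add_le_add c1 b2)) (c0 (Qs - F (t + τ / 2)) _ le_rfl)))
      (c0 m _ b3))) b4)) (c0 (Q - F t) _ le_rfl))
    refine c.trans ?_
    change _ + Λ * Λ * errNorm P M Qs (F (t + τ / 2)) + _ + _ + Λ * Λ * errNorm P M Q (F t) ≤ _
    set x := errNorm P M Q (F t)
    set xs := errNorm P M Qs (F (t + τ / 2))
    set σ := auxDefect P M Qs ss
    set k := (P.ℓ / M) ^ 2
    have e1 : Λ ^ 3 * σ ≤ Λ ^ 4 * σ := by gcongr; norm_num
    have e2 : Λ ^ 1 * xs ≤ Λ ^ 4 * xs := by gcongr; norm_num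
    have e2' : Λ ^ 2 * xs ≤ Λ ^ 4 * xs := by gcongr; norm_num
    have e2'' : Λ ^ 2 * x ≤ Λ ^ 4 * x := by gcongr; norm_num
    have e3 : Λ ^ 2 * (τ ^ 2 + k) ≤ Λ ^ 4 * (τ ^ 2 + k) := by gcongr; norm_num
    have e4 : 0 ≤ Λ ^ 4 * σ := by positivity
    have e5 : 0 ≤ Λ ^ 4 * x := by positivity
    have e5' : 0 ≤ Λ ^ 4 * xs := by positivity
    have e6 : 0 ≤ Λ ^ 4 * k := by positivity
    have e7 : 0 ≤ Λ ^ 4 * τ ^ 2 := by positivity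
    linarith

/-- The evolution of the defect of the auxiliary variable in the corrector step. -/
lemma CorrectorStep.auxDefect_le (H : ErrorSetting d P M η E₀ R Λ T F)
    (hQ : IsAdmissible P M η E₀ Q s) (hQ' : IsAdmissible P M η E₀ Q' s')
    (hQs : IsAdmissible P M η E₀ Qs ss) (hS : CorrectorStep P M τ Qs ss Q s Q' s') :
    auxDefect P M Q' s' ≤ auxDefect P M Q s
      + |expRatio P M Qs ss - 1| * (Λ * Λ * ‖gridVec (P.ℓ / M) M (Q' - Q)‖)
      + (Λ + Λ * Λ) * (‖gridVec (P.ℓ / M) M ((1 / 2 : ℝ) • (Q' + Q) - Qs)‖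
        * ‖gridVec (P.ℓ / M) M (Q' - Q)‖)
      + Λ * ((P.ℓ / M) ^ d * ∑ p ∈ interiorNodes d M, ‖Q' p - Q p‖ ^ 3) := by
  have hΛ := zero_le_one.trans H.one_le
  have hℓ := H.stable.ℓ_pos
  have hh : 0 ≤ P.ℓ / M := by positivity
  have hb1 := neg_Cstar_le_discBulkEnergy H.stable H.M_pos hQ'.grid.1
  have hb2 : 0 ≤ discElasticEnergy P M Q' := by
    have := H.stable.L_pos; unfold discElasticEnergy; positivity
  set W : GridTensor d := (1 / 2 : ℝ) • (Q' + Q) with hW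
  have hWR : ∀ p, ‖W p‖ ≤ R := fun p => by
    rw [hW, Pi.smul_apply, Pi.add_apply, norm_smul]
    norm_num
    linarith [norm_add_le (Q' p) (Q p), hQ.norm_le_R H p, hQ'.norm_le_R H p]
  have h1 : auxDefect P M Q' s' ≤ |s - expRatio P M Qs ss
      * gridInner (P.ℓ / M) M (gridForce P Qs) (Q' - Q)
      + P.κ * expRatio P M Qs ss * gridInner (P.ℓ / M) M (W - Qs) (Q' - Q)
      - discBulkEnergy P M Q'| := by
    rw [auxDefect, hS.aux]
    exact abs_max_sub_le (by linarith)
  have h2 := abs_discBulkEnergy_sub_le (M := M) (Q := Q) (Q' := Q') (Φ := gridForce P W) (K := Λ)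
    (u := fun p => ‖Q' p - Q p‖ ^ 3) hℓ fun p _ => H.force.density_mid _ _ (hQ.grid.1 p)
      (hQ'.grid.1 p) (hQ.norm_le_R H p) (hQ'.norm_le_R H p)
  have h4 : |gridInner (P.ℓ / M) M (gridForce P Qs) (Q' - Q)|
      ≤ Λ * Λ * ‖gridVec (P.ℓ / M) M (Q' - Q)‖ :=
    (abs_gridInner_le hh _ _).trans (by gcongr; exact H.norm_force_le (hQs.norm_le_R H))
  have h5 : |gridInner (P.ℓ / M) M (gridForce P W - gridForce P Qs) (Q' - Q)|
      ≤ Λ * ‖gridVec (P.ℓ / M) M (W - Qs)‖ * ‖gridVec (P.ℓ / M) M (Q' - Q)‖ :=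
    (abs_gridInner_le hh _ _).trans (by
      gcongr; exact H.norm_force_sub_le hWR (hQs.norm_le_R H))
  have h6 := abs_gridInner_le hh (M := M) (W - Qs) (Q' - Q)
  rw [gridInner_sub_left hh] at h5
  have hgκ := H.ratio_mul_κ_le hQs
  set g := expRatio P M Qs ss
  set f := gridInner (P.ℓ / M) M (gridForce P Qs) (Q' - Q)
  set fW := gridInner (P.ℓ / M) M (gridForce P W) (Q' - Q)
  set q := gridInner (P.ℓ / M) M (W - Qs) (Q' - Q)
  have h7 : |(g - 1) * f| ≤ |g - 1| * (Λ * Λ * ‖gridVec (P.ℓ / M) M (Q' - Q)‖) := by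
    rw [abs_mul]; gcongr
  have h8 : |g * P.κ * q| ≤ Λ * Λ * (‖gridVec (P.ℓ / M) M (W - Qs)‖
      * ‖gridVec (P.ℓ / M) M (Q' - Q)‖) := by
    rw [abs_mul, abs_of_nonneg hgκ.1]
    exact mul_le_mul hgκ.2 h6 (abs_nonneg _) (by positivity)
  -- The chain rule is centred at the midpoint W, where its remainder is cubic. Replacing f(W) by
  -- f(Qs), like the stabilization, costs |W − Qs| times the increment.
  have h9 : s - g * f + P.κ * g * q - discBulkEnergy P M Q' = (s - discBulkEnergy P M Q)
      - (g - 1) * f + (fW - f) + g * P.κ * q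
      - (discBulkEnergy P M Q' - discBulkEnergy P M Q + fW) := by ring
  rw [h9] at h1
  have h10 := h1.trans ((abs_sub _ _).trans (add_le_add ((abs_add_le _ _).trans (add_le_add
    ((abs_add_le _ _).trans (add_le_add ((abs_sub _ _).trans (add_le_add le_rfl h7)) h5)) h8)) h2))
  refine h10.trans (le_of_eq ?_)
  rw [auxDefect]; ring

end StepConclusions

/-! ### One-step error recursion of the second scheme -/

section Corrector

variable {d M : ℕ} {P : Params} {η E₀ R Λ T t τ s s' ss : ℝ} {F : ℝ → GridTensor d}
  {Q Q' Qs : GridTensor d}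

/-- The cubic remainder of the midpoint rule, in terms of the error increment. -/
lemma weighted_sum_cube_le (H : ErrorSetting d P M η E₀ R Λ T F) (ht : 0 ≤ t) (hτ : 0 < τ)
    (htT : t + τ ≤ T) (hQ : IsAdmissible P M η E₀ Q s) (hQ' : IsAdmissible P M η E₀ Q' s') :
    (P.ℓ / M) ^ d * ∑ p ∈ interiorNodes d M, ‖Q' p - Q p‖ ^ 3 ≤
      16 * Λ * ‖gridVec (P.ℓ / M) M (Q' - F (t + τ)) - gridVec (P.ℓ / M) M (Q - F t)‖ ^ 2
        + 4 * Λ ^ 5 * τ ^ 3 := by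
  have hΛ := zero_le_one.trans H.one_le
  have hℓ := H.stable.ℓ_pos
  have hh : 0 ≤ P.ℓ / M := by positivity
  set D : GridTensor d := (Q' - F (t + τ)) - (Q - F t) with hD
  have h1 : ∀ p ∈ interiorNodes d M,
      ‖Q' p - Q p‖ ^ 3 ≤ 16 * Λ * ‖D p‖ ^ 2 + 4 * (Λ * τ) ^ 3 := fun p hp => by
    have hDp : ‖D p‖ ≤ 4 * Λ := by
      have a1 := hQ.norm_le_R H p
      have a2 := hQ'.norm_le_R H p
      have a3 := H.cons.norm_le t ⟨ht, by linarith⟩ p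
      have a4 := H.cons.norm_le (t + τ) ⟨by linarith, htT⟩ p
      have := H.R_le
      refine (norm_sub_le _ _).trans ?_
      have b1 := norm_sub_le (Q' p) (F (t + τ) p)
      have b2 := norm_sub_le (Q p) (F t p)
      simp only [Pi.sub_apply]
      linarith
    have h2 : ‖Q' p - Q p‖ ≤ ‖D p‖ + Λ * τ := by
      have : Q' p - Q p = D p + (F (t + τ) p - F t p) := by
        simp only [hD, Pi.sub_apply]; abel
      rw [this]
      exact (norm_add_le _ _).trans (by gcongr; exact H.cons.lip t τ ht hτ htT p hp)
    have h3 : 0 ≤ Λ * τ := by positivity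
    have h4 := norm_nonneg (D p)
    calc ‖Q' p - Q p‖ ^ 3 ≤ (‖D p‖ + Λ * τ) ^ 3 := by gcongr
      _ ≤ 4 * (‖D p‖ * ‖D p‖ ^ 2) + 4 * (Λ * τ) ^ 3 := by
        -- Here 4(a³ + b³) − (a + b)³ = 3(a + b)(a − b)². The next line lowers a³ to a² by the
        -- maximum bound.
        nlinarith [mul_nonneg (add_nonneg h4 h3) (sq_nonneg (‖D p‖ - Λ * τ))]
      _ ≤ 4 * (4 * Λ * ‖D p‖ ^ 2) + 4 * (Λ * τ) ^ 3 := by gcongr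
      _ = _ := by ring
  have h5 : gridVec (P.ℓ / M) M (Q' - F (t + τ)) - gridVec (P.ℓ / M) M (Q - F t)
      = gridVec (P.ℓ / M) M D := by
    rw [hD, map_sub _ (Q' - F (t + τ))]
  have h6 := weighted_sum_le (d := d) (u := fun _ => 4 * (Λ * τ) ^ 3) (c := 4 * (Λ * τ) ^ 3)
    H.stable.ℓ_pos H.M_pos (by positivity) fun _ _ => le_rfl
  have h7 : P.ℓ ^ d ≤ Λ ^ 2 := by
    rw [← Real.sq_sqrt (show 0 ≤ P.ℓ ^ d by positivity)]
    gcongr; exact H.vol_le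
  rw [h5, norm_gridVec_sq hh]
  calc _ ≤ (P.ℓ / M) ^ d * ∑ p ∈ interiorNodes d M, (16 * Λ * ‖D p‖ ^ 2 + 4 * (Λ * τ) ^ 3) :=
        mul_le_mul_of_nonneg_left (Finset.sum_le_sum h1) (by positivity)
    _ = 16 * Λ * ((P.ℓ / M) ^ d * ∑ p ∈ interiorNodes d M, ‖D p‖ ^ 2)
        + (P.ℓ / M) ^ d * ∑ p ∈ interiorNodes d M, 4 * (Λ * τ) ^ 3 := by
        rw [Finset.sum_add_distrib, ← Finset.mul_sum]; ring
    _ ≤ 16 * Λ * ((P.ℓ / M) ^ d * ∑ p ∈ interiorNodes d M, ‖D p‖ ^ 2)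
        + 4 * (Λ * τ) ^ 3 * Λ ^ 2 := by
        exact add_le_add le_rfl (h6.trans (by gcongr))
    _ = _ := by ring

/-- W − Qs is the old error, plus half the error increment, minus the predictor error, plus the
midpoint defect of the exact solution, which is O(τ²). -/
lemma norm_half_add_sub_le (H : ErrorSetting d P M η E₀ R Λ T F) (ht : 0 ≤ t) (hτ : 0 < τ)
    (htT : t + τ ≤ T) (Q Q' Qs : GridTensor d) :
    ‖gridVec (P.ℓ / M) M ((1 / 2 : ℝ) • (Q' + Q) - Qs)‖ ≤ errNorm P M Q (F t)
      + ‖gridVec (P.ℓ / M) M (Q' - F (t + τ)) - gridVec (P.ℓ / M) M (Q - F t)‖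
      + errNorm P M Qs (F (t + τ / 2)) + Λ * τ ^ 2 * Λ := by
  have hΛ := zero_le_one.trans H.one_le
  have b3 := H.norm_gridVec_le (Φ := (1 / 2 : ℝ) • (F (t + τ) + F t) - F (t + τ / 2))
    (c := Λ * τ ^ 2) (by positivity) fun p hp => H.cons.mid t τ ht hτ htT p hp
  set m : GridTensor d := (1 / 2 : ℝ) • (F (t + τ) + F t) - F (t + τ / 2) with hm
  set v := gridVec (P.ℓ / M) M (Q' - F (t + τ)) - gridVec (P.ℓ / M) M (Q - F t) with hv
  have h1 : gridVec (P.ℓ / M) M ((1 / 2 : ℝ) • (Q' + Q) - Qs)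
      = gridVec (P.ℓ / M) M (Q - F t) + (1 / 2 : ℝ) • v
        - gridVec (P.ℓ / M) M (Qs - F (t + τ / 2)) + gridVec (P.ℓ / M) M m := by
    rw [hv, hm]; simp only [map_sub, map_smul, map_add]; module
  have h2 : ‖(1 / 2 : ℝ) • v‖ ≤ ‖v‖ := by
    rw [norm_smul]; norm_num; linarith [norm_nonneg v]
  rw [h1]
  exact (norm_add_le _ _).trans (add_le_add ((norm_sub_le _ _).trans (add_le_add
    ((norm_add_le _ _).trans (add_le_add le_rfl h2)) le_rfl)) b3)

/-- Bookkeeping with X = τδ and Y = τ(σ + x + ρ): Λ ≥ 1 raises all powers to the fourteenth, and 140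
generously dominates the coefficients. -/
lemma aux_sum_le {Λ X Y ay qy u σ σ' : ℝ} (hΛ1 : 1 ≤ Λ) (hX : 0 ≤ X) (hY : 0 ≤ Y)
    (a1 : ay ≤ Λ * X + 22 * Λ ^ 12 * Y)
    (a2 : qy ≤ (2 * Λ ^ 2 + Λ ^ 3) * X + (Λ ^ 2 + 5 * Λ ^ 11 + Λ ^ 4) * Y)
    (a3 : u ≤ 64 * Λ ^ 3 * X + 4 * Λ ^ 5 * Y)
    (h : σ' ≤ σ + Λ * Λ * ay + (Λ + Λ * Λ) * qy + Λ * u) :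
    σ' ≤ σ + 140 * Λ ^ 14 * (X + Y) := by
  have hΛ := zero_le_one.trans hΛ1
  have b1 := mul_le_mul_of_nonneg_left a1 (mul_nonneg hΛ hΛ)
  have b2 := mul_le_mul_of_nonneg_left a2 (add_nonneg hΛ (mul_nonneg hΛ hΛ))
  have b3 := mul_le_mul_of_nonneg_left a3 hΛ
  have hpow : ∀ n ≤ 14, ∀ r, 0 ≤ r → Λ ^ n * r ≤ Λ ^ 14 * r := fun n hn r hr => by gcongr
  have e3 := hpow 3 (by norm_num) _ hX
  have e4 := hpow 4 (by norm_num) _ hX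
  have e5 := hpow 5 (by norm_num) _ hX
  have f3 := hpow 3 (by norm_num) _ hY
  have f4 := hpow 4 (by norm_num) _ hY
  have f5 := hpow 5 (by norm_num) _ hY
  have f6 := hpow 6 (by norm_num) _ hY
  have f12 := hpow 12 (by norm_num) _ hY
  have f13 := hpow 13 (by norm_num) _ hY
  have n1 : 0 ≤ Λ ^ 14 * X := by positivity
  have n2 : 0 ≤ Λ ^ 14 * Y := by positivity
  linarith

/-- The error recursion of the second-order scheme. -/
lemma SecondOrderStep.exists_errorStep (H : ErrorSetting d P M η E₀ R Λ T F) (ht : 0 ≤ t)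
    (hτ : 0 < τ) (htT : t + τ ≤ T)
    (hstep : τ ≤ (P.κ * Real.exp (E₀ + P.Cstar) / 2 + 2 ^ (d - 1) * P.L / (P.ℓ / M) ^ 2)⁻¹)
    (hQ : IsAdmissible P M η E₀ Q s) (hS : SecondOrderStep P M τ Q s Q' s') :
    IsAdmissible P M η E₀ Q' s' ∧
    ∃ δ, ErrorStep (140 * Λ ^ 14) P.L τ (τ ^ 2 + (P.ℓ / M) ^ 2)
      (errNorm P M Q (F t)) (errGrad P M Q (F t)) (auxDefect P M Q s)
      (errNorm P M Q' (F (t + τ))) (errGrad P M Q' (F (t + τ))) (auxDefect P M Q' s') δ := by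
  obtain ⟨Qs, ss, hS1, hS2⟩ := hS.exists_corrector
  have hΛ1 := H.one_le
  have hΛ := zero_le_one.trans hΛ1
  have hℓ := H.stable.ℓ_pos
  have hh : 0 ≤ P.ℓ / M := by positivity
  have hτ2 : 0 < τ / 2 := by positivity
  have hQs := hS1.isAdmissible H.stable hτ2 hQ
  have hQ' := hS2.isAdmissible H.stable H.M_pos hτ hstep hQ hQs
  refine ⟨hQ', ?_⟩
  obtain ⟨hp1, hp2⟩ := hS1.predictor_le H ht hτ2 (by linarith) hQ
  obtain ⟨z, hz, hzn⟩ := hS2.exists_error_eq H ht hτ htT hQs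
  have hg := H.abs_one_sub_ratio_le hQs
  have haux := hS2.auxDefect_le H hQ hQ' hQs
  have hinc := norm_increment_le H ht hτ htT Q Q'
  have hcube := weighted_sum_cube_le H ht hτ htT hQ hQ'
  have hhalf := norm_half_add_sub_le H ht hτ htT Q Q' Qs
  have heG := hQ.grid.sub (H.cons.grid t ⟨ht, by linarith⟩)
  have heG' := hQ'.grid.sub (H.cons.grid (t + τ) ⟨by linarith, htT⟩)
  have hhalf2 : ‖gridVec (P.ℓ / M) M ((1 / 2 : ℝ) • (Q' + Q) - Qs)‖ ≤ 2 * Λ * Λ := by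
    refine H.norm_gridVec_le (by positivity) fun p _ => (norm_sub_le _ _).trans ?_
    rw [Pi.smul_apply, Pi.add_apply, norm_smul]
    norm_num
    linarith [norm_add_le (Q' p) (Q p), hQ.norm_le_R H p, hQ'.norm_le_R H p,
      hQs.norm_le_R H p, H.R_le]
  have hv2 : ‖gridVec (P.ℓ / M) M (Q' - F (t + τ)) - gridVec (P.ℓ / M) M (Q - F t)‖
      ≤ 4 * Λ * Λ := by
    rw [← map_sub]
    refine H.norm_gridVec_le (by positivity) fun p _ => (norm_sub_le _ _).trans ?_
    have b1 := norm_sub_le (Q' p) (F (t + τ) p)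
    have b2 := norm_sub_le (Q p) (F t p)
    simp only [Pi.sub_apply]
    linarith [hQ.norm_le_R H p, hQ'.norm_le_R H p, H.cons.norm_le t ⟨ht, by linarith⟩ p,
      H.cons.norm_le (t + τ) ⟨by linarith, htT⟩ p, H.R_le]
  have hen := energy_estimate hτ H.stable.L_pos.le (by linarith [(H.ratio_mul_κ_le hQs).1]) hz
    (inner_discLaplacian_half_sub hh heG heG').le
  set v := gridVec (P.ℓ / M) M (Q' - F (t + τ)) - gridVec (P.ℓ / M) M (Q - F t) with hv
  have hvδ : ‖v‖ = τ * (‖v‖ / τ) := by field_simp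
  have hδ0 : 0 ≤ ‖v‖ / τ := by positivity
  have hx0 : 0 ≤ errNorm P M Q (F t) := norm_nonneg _
  have hxs0 : 0 ≤ errNorm P M Qs (F (t + τ / 2)) := norm_nonneg _
  have hσ0 : 0 ≤ auxDefect P M Q s := abs_nonneg _
  have hσs0 : 0 ≤ auxDefect P M Qs ss := abs_nonneg _
  have hk : 0 ≤ (P.ℓ / M) ^ 2 := sq_nonneg _
  have hx' : errNorm P M Q' (F (t + τ)) ≤ errNorm P M Q (F t) + ‖v‖ := by
    rw [errNorm, errNorm, hv]; exact norm_le_insert' _ _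
  have hgrad : errGrad P M Q' (F (t + τ)) = ‖gradVec (P.ℓ / M) M (Q' - F (t + τ))‖ := rfl
  have hgrad' : errGrad P M Q (F t) = ‖gradVec (P.ℓ / M) M (Q - F t)‖ := rfl
  rw [← hgrad, ← hgrad'] at hen
  set σ := auxDefect P M Q s
  set x := errNorm P M Q (F t)
  set σs := auxDefect P M Qs ss
  set xs := errNorm P M Qs (F (t + τ / 2))
  set k := (P.ℓ / M) ^ 2
  set S := σ + x + (τ ^ 2 + k) with hSdef
  have hS0 : 0 ≤ S := by positivity
  have hxS : x ≤ S := by rw [hSdef]; linarith [sq_nonneg τ]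
  have hτS : τ ^ 2 ≤ S := by rw [hSdef]; linarith
  have hρS : τ ^ 2 + k ≤ S := by rw [hSdef]; linarith
  have hS2 : σ + x + ((τ / 2) ^ 2 + k) ≤ S := by rw [hSdef]; linarith [sq_nonneg τ]
  have hσsS : σs ≤ 22 * Λ ^ 9 * S := hp2.trans (by gcongr)
  have hxsS : xs ≤ 5 * Λ ^ 9 * S :=
    hp1.trans (mul_le_mul (by gcongr; norm_num) hS2 (by positivity) (by positivity))
  refine ⟨‖v‖ / τ, ?_, ?_, ?_⟩
  · have hz2 : ‖z‖ ≤ 140 * Λ ^ 14 * S := by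
      calc ‖z‖ ≤ 3 * Λ ^ 4 * (22 * Λ ^ 9 * S + 5 * Λ ^ 9 * S + S + S) := hzn.trans (by gcongr)
        _ = 81 * (Λ ^ 13 * S) + 6 * (Λ ^ 4 * S) := by ring
        _ ≤ 81 * (Λ ^ 14 * S) + 6 * (Λ ^ 14 * S) := by gcongr <;> norm_num
        _ ≤ _ := by linarith [mul_nonneg (pow_nonneg hΛ 14) hS0]
    have hz3 : τ * ‖z‖ ^ 2 ≤ τ * (140 * Λ ^ 14 * S) ^ 2 := by gcongr
    linarith
  · rwa [← hvδ]
  · generalize ‖v‖ / τ = δ at hvδ hδ0 ⊢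
    rw [hvδ] at hinc hhalf hcube hv2
    set y := ‖gridVec (P.ℓ / M) M (Q' - Q)‖
    set q := ‖gridVec (P.ℓ / M) M ((1 / 2 : ℝ) • (Q' + Q) - Qs)‖
    set u := (P.ℓ / M) ^ d * ∑ p ∈ interiorNodes d M, ‖Q' p - Q p‖ ^ 3
    have hy0 : 0 ≤ y := norm_nonneg _
    have hq0 : 0 ≤ q := norm_nonneg _
    set a := |expRatio P M Qs ss - 1|
    have ha0 : 0 ≤ a := abs_nonneg _
    have hτΛ : τ ≤ Λ := by linarith [H.T_le]
    have hτδ : 0 ≤ τ * δ := by positivity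
    have a1 : a * y ≤ Λ * (τ * δ) + 22 * Λ ^ 12 * (τ * S) := by
      calc a * y ≤ a * (τ * δ + Λ * τ * Λ) := by gcongr
        _ = a * (τ * δ) + a * (Λ * τ * Λ) := by ring
        _ ≤ Λ * (τ * δ) + Λ * (22 * Λ ^ 9 * S) * (Λ * τ * Λ) := by
          gcongr; exacts [hg.2, hg.1.trans (by gcongr)]
        _ = _ := by ring
    -- Against τδ the crude bound on q suffices; against the exact increment of size τ the sharp
    -- bound `hhalf` is needed to keep second order.
    have a2 : q * y ≤ (2 * Λ ^ 2 + Λ ^ 3) * (τ * δ)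
        + (Λ ^ 2 + 5 * Λ ^ 11 + Λ ^ 4) * (τ * S) := by
      calc q * y ≤ q * (τ * δ + Λ * τ * Λ) := by gcongr
        _ = q * (τ * δ) + Λ * τ * Λ * q := by ring
        _ ≤ 2 * Λ * Λ * (τ * δ)
            + Λ * τ * Λ * (S + τ * δ + 5 * Λ ^ 9 * S + Λ * S * Λ) := by
          gcongr
          exact hhalf.trans (by gcongr)
        _ = 2 * Λ * Λ * (τ * δ) + Λ * Λ * (τ * (τ * δ))
            + (Λ ^ 2 + 5 * Λ ^ 11 + Λ ^ 4) * (τ * S) := by ring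
        _ ≤ 2 * Λ * Λ * (τ * δ) + Λ * Λ * (Λ * (τ * δ))
            + (Λ ^ 2 + 5 * Λ ^ 11 + Λ ^ 4) * (τ * S) := by gcongr
        _ = _ := by ring
    -- The cube of the exact increment is τ·τ², hence of the required form; a first-order chain rule
    -- would leave only τ·τ.
    have a3 : u ≤ 64 * Λ ^ 3 * (τ * δ) + 4 * Λ ^ 5 * (τ * S) := by
      calc u ≤ 16 * Λ * (τ * δ * (τ * δ)) + 4 * Λ ^ 5 * (τ * τ ^ 2) := by
            refine hcube.trans (le_of_eq ?_); ring
        _ ≤ 16 * Λ * (4 * Λ * Λ * (τ * δ)) + 4 * Λ ^ 5 * (τ * S) := by gcongr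
        _ = _ := by ring
    have hτS0 : 0 ≤ τ * S := by positivity
    refine (aux_sum_le (σ := σ) hΛ1 hτδ hτS0 a1 a2 a3 (haux.trans (le_of_eq ?_))).trans (le_of_eq ?_)
    · ring
    · ring

end Corrector

/-! ### Difference quotients of functions that are smooth up to the boundary -/

section Differences

variable {V : Type*} [NormedAddCommGroup V] [NormedSpace ℝ V]

/-- The mean value inequality on [0, r], without the factor 1/(k+1); the constants below are
therefore not sharp. -/
lemma norm_le_pow_of_hasDerivWithinAt {φ φ' : ℝ → V} {h C : ℝ} {k : ℕ} (hC : 0 ≤ C)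
    (h0 : φ 0 = 0) (hd : ∀ r ∈ Set.Icc 0 h, HasDerivWithinAt φ (φ' r) (Set.Icc 0 h) r)
    (hb : ∀ r ∈ Set.Icc 0 h, ‖φ' r‖ ≤ C * r ^ k) :
    ∀ r ∈ Set.Icc 0 h, ‖φ r‖ ≤ C * r ^ (k + 1) := by
  intro r hr
  have hsub : Set.Icc 0 r ⊆ Set.Icc 0 h := Set.Icc_subset_Icc_right hr.2
  have := norm_image_sub_le_of_norm_deriv_le_segment' (f := φ) (f' := φ') (a := 0) (b := r)
    (C := C * r ^ k) (fun x hx => (hd x (hsub hx)).mono hsub)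
    (fun x hx => (hb x (hsub (Set.Ico_subset_Icc_self hx))).trans
      (by have := hx.1; gcongr; exact hx.2.le)) r ⟨hr.1, le_rfl⟩
  rw [h0, sub_zero, sub_zero] at this
  exact this.trans (le_of_eq (by ring))

lemma hasDerivWithinAt_comp_neg {g g' : ℝ → V} {h : ℝ}
    (hd : ∀ r ∈ Set.Icc (-h) h, HasDerivWithinAt g (g' r) (Set.Icc (-h) h) r) :
    ∀ r ∈ Set.Icc 0 h, HasDerivWithinAt g (g' r) (Set.Icc 0 h) r ∧
      HasDerivWithinAt (fun r => g (-r)) (-g' (-r)) (Set.Icc 0 h) r := by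
  intro r hr
  have h1 : Set.Icc 0 h ⊆ Set.Icc (-h) h :=
    Set.Icc_subset_Icc_left (by linarith [hr.1, hr.2])
  refine ⟨(hd r (h1 hr)).mono h1, ?_⟩
  have h2 := (hd (-r) ⟨by linarith [hr.2], by linarith [hr.1, hr.2]⟩).scomp (h := fun r => -r) r
    ((hasDerivAt_neg r).hasDerivWithinAt (s := Set.Icc 0 h))
    (fun x hx => ⟨by linarith [hx.2], by linarith [hx.1, hx.2]⟩)
  simpa [Function.comp_def] using h2

variable {g : ℕ → ℝ → V} {h C : ℝ}

/-- First rung of a ladder: the derivative of the second difference is g′(r) − g′(−r), whose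
derivative is bounded by 2C. Using r and −r together gives symmetric differences without Taylor
expansions. -/
lemma norm_second_diff_le (hC : 0 ≤ C)
    (hd : ∀ i < 2, ∀ r ∈ Set.Icc (-h) h, HasDerivWithinAt (g i) (g (i + 1) r) (Set.Icc (-h) h) r)
    (hb : ∀ r ∈ Set.Icc (-h) h, ‖g 2 r‖ ≤ C) :
    ∀ r ∈ Set.Icc 0 h, ‖g 0 r + g 0 (-r) - (2 : ℝ) • g 0 0‖ ≤ 2 * C * r ^ 2 := by
  have d0 := hasDerivWithinAt_comp_neg (hd 0 (by norm_num))
  have d1 := hasDerivWithinAt_comp_neg (hd 1 (by norm_num))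
  have s1 := norm_le_pow_of_hasDerivWithinAt (φ := fun r => g 1 r - g 1 (-r)) (k := 0)
    (φ' := fun r => g 2 r - -g 2 (-r)) (C := 2 * C) (h := h) (by positivity) (by simp)
    (fun r hr => (d1 r hr).1.sub (d1 r hr).2) fun r hr => by
      rw [pow_zero, mul_one, sub_neg_eq_add]
      refine (norm_add_le _ _).trans ?_
      have := hb r ⟨by linarith [hr.1, hr.2], hr.2⟩
      have := hb (-r) ⟨by linarith [hr.1, hr.2], by linarith [hr.1, hr.2]⟩
      linarith
  refine norm_le_pow_of_hasDerivWithinAt (φ' := fun r => g 1 r + -g 1 (-r)) (k := 1)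
    (by positivity) (by simp; module)
    (fun r hr => ((d0 r hr).1.add (d0 r hr).2).sub_const _) fun r hr => ?_
  rw [← sub_eq_add_neg]
  simpa using s1 r hr

/-- Its derivative is the second difference of g′. -/
lemma norm_centered_diff_le (hC : 0 ≤ C)
    (hd : ∀ i < 3, ∀ r ∈ Set.Icc (-h) h, HasDerivWithinAt (g i) (g (i + 1) r) (Set.Icc (-h) h) r)
    (hb : ∀ r ∈ Set.Icc (-h) h, ‖g 3 r‖ ≤ C) :
    ∀ r ∈ Set.Icc 0 h, ‖g 0 r - g 0 (-r) - (2 * r) • g 1 0‖ ≤ 2 * C * r ^ 3 := by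
  have d0 := hasDerivWithinAt_comp_neg (hd 0 (by norm_num))
  have s1 := norm_second_diff_le (g := fun i => g (i + 1)) hC
    (fun i hi => hd (i + 1) (by omega)) hb
  refine norm_le_pow_of_hasDerivWithinAt (k := 2)
    (φ' := fun r => g 1 r - -g 1 (-r) - (2 : ℝ) • g 1 0)
    (by positivity) (by simp) (fun r hr => ((d0 r hr).1.sub (d0 r hr).2).sub ?_) fun r hr => ?_
  · have := (((hasDerivAt_id r).const_mul 2).smul_const (g 1 0)).hasDerivWithinAt
      (s := Set.Icc 0 h)
    simpa using this
  · rw [sub_neg_eq_add]; exact s1 r hr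

/-- Its derivative is the centered difference of g′ with the linear term removed. -/
lemma norm_second_diff_sub_le (hC : 0 ≤ C)
    (hd : ∀ i < 4, ∀ r ∈ Set.Icc (-h) h, HasDerivWithinAt (g i) (g (i + 1) r) (Set.Icc (-h) h) r)
    (hb : ∀ r ∈ Set.Icc (-h) h, ‖g 4 r‖ ≤ C) :
    ∀ r ∈ Set.Icc 0 h, ‖g 0 r + g 0 (-r) - (2 : ℝ) • g 0 0 - r ^ 2 • g 2 0‖ ≤ 2 * C * r ^ 4 := by
  have d0 := hasDerivWithinAt_comp_neg (hd 0 (by norm_num))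
  have s1 := norm_centered_diff_le (g := fun i => g (i + 1)) hC
    (fun i hi => hd (i + 1) (by omega)) hb
  refine norm_le_pow_of_hasDerivWithinAt (k := 3)
    (φ' := fun r => g 1 r + -g 1 (-r) - (2 * r) • g 2 0) (by positivity) (by simp; module)
    (fun r hr => (((d0 r hr).1.add (d0 r hr).2).sub_const _).sub ?_) fun r hr => ?_
  · have := ((hasDerivAt_pow 2 r).smul_const (g 2 0)).hasDerivWithinAt (s := Set.Icc 0 h)
    simpa using this
  · rw [← sub_eq_add_neg]; exact s1 r hr

end Differences

/-! ### Directional derivatives within a compact set, and uniform difference estimates -/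

section DirDeriv

variable {E V : Type*} [NormedAddCommGroup E] [NormedSpace ℝ E] [NormedAddCommGroup V]
  [NormedSpace ℝ V] {K : Set E} {u : E → V}

/-- The derivative within `K` in the direction `v`. -/
def dirDeriv (K : Set E) (v : E) (u : E → V) : E → V := fun z => fderivWithin ℝ u K z v

lemma contDiffOn_dirDeriv (hK : UniqueDiffOn ℝ K) {n : ℕ} (hu : ContDiffOn ℝ (n + 1 : ℕ) u K)
    (v : E) : ContDiffOn ℝ n (dirDeriv K v u) K :=
  (hu.fderivWithin hK (by norm_cast)).clm_apply contDiffOn_const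

lemma contDiffOn_iterate_dirDeriv (hK : UniqueDiffOn ℝ K) (v : E) {n : ℕ} (i : ℕ) :
    ∀ {u : E → V}, ContDiffOn ℝ (n + i : ℕ) u K →
      ContDiffOn ℝ n ((dirDeriv K v)^[i] u) K := by
  induction i with
  | zero => intro u hu; exact hu
  | succ i ih =>
    intro u hu
    rw [Function.iterate_succ_apply]
    exact ih (contDiffOn_dirDeriv hK (by rwa [add_assoc]) v)

lemma hasDerivWithinAt_dirDeriv {n : ℕ} (hn : n ≠ 0) (hu : ContDiffOn ℝ n u K) {z v : E}
    {I : Set ℝ} (hI : ∀ r ∈ I, z + r • v ∈ K) {r : ℝ} (hr : r ∈ I) :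
    HasDerivWithinAt (fun r => u (z + r • v)) (dirDeriv K v u (z + r • v)) I r := by
  have h1 : HasFDerivWithinAt u (fderivWithin ℝ u K (z + r • v)) K (z + r • v) :=
    (hu.differentiableOn (by exact_mod_cast hn) _ (hI r hr)).hasFDerivWithinAt
  have h2 : HasDerivWithinAt (fun r : ℝ => z + r • v) v I r := by
    have := (((hasDerivAt_id r).smul_const v).const_add z).hasDerivWithinAt (s := I)
    simpa using this
  exact h1.comp_hasDerivWithinAt r h2 hI

lemma exists_bound_of_contDiffOn (hc : IsCompact K) {n : ℕ} (hu : ContDiffOn ℝ n u K) :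
    ∃ C, 0 ≤ C ∧ ∀ z ∈ K, ‖u z‖ ≤ C := by
  obtain ⟨C, hC⟩ := hc.exists_bound_of_continuousOn hu.continuousOn
  exact ⟨max C 0, le_max_right _ _, fun z hz => (hC z hz).trans (le_max_left _ _)⟩

/-- Derivatives along a segment. -/
lemma hasDerivWithinAt_iterate (hK : UniqueDiffOn ℝ K) {n : ℕ} (hu : ContDiffOn ℝ n u K) {z v : E}
    {I : Set ℝ} (hI : ∀ r ∈ I, z + r • v ∈ K) (i : ℕ) (hi : i < n) {r : ℝ} (hr : r ∈ I) :
    HasDerivWithinAt (fun r => (dirDeriv K v)^[i] u (z + r • v))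
      ((dirDeriv K v)^[i + 1] u (z + r • v)) I r := by
  rw [Function.iterate_succ_apply']
  refine hasDerivWithinAt_dirDeriv (n := n - i) (by omega) ?_ hI hr
  exact contDiffOn_iterate_dirDeriv hK v i (by rwa [Nat.sub_add_cancel hi.le])

lemma exists_bound_iterate (hK : UniqueDiffOn ℝ K) (hc : IsCompact K) {n : ℕ}
    (hu : ContDiffOn ℝ n u K) (v : E) :
    ∃ C, 0 ≤ C ∧ ∀ z ∈ K, ‖(dirDeriv K v)^[n] u z‖ ≤ C :=
  exists_bound_of_contDiffOn hc (n := 0) (contDiffOn_iterate_dirDeriv hK v n (by rwa [zero_add]))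

/-- Compactness bounds the continuous derivative on K, so the constant depends neither on the base
point nor on the step. The estimates below are uniform for the same reason. -/
lemma exists_norm_sub_le (hK : UniqueDiffOn ℝ K) (hc : IsCompact K) {n : ℕ} (hn : n ≠ 0)
    (hu : ContDiffOn ℝ n u K) (v : E) : ∃ C, 0 ≤ C ∧ ∀ z h, 0 ≤ h →
      (∀ r ∈ Set.Icc 0 h, z + r • v ∈ K) → ‖u (z + h • v) - u z‖ ≤ C * h := by
  have hu1 : ContDiffOn ℝ (1 : ℕ) u K := hu.of_le (by exact_mod_cast Nat.one_le_iff_ne_zero.2 hn)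
  obtain ⟨C, hC, hb⟩ := exists_bound_iterate hK hc hu1 v
  refine ⟨C, hC, fun z h hh hI => ?_⟩
  have := norm_image_sub_le_of_norm_deriv_le_segment' (f := fun r => u (z + r • v))
    (f' := fun r => dirDeriv K v u (z + r • v)) (a := 0) (b := h)
    (C := C) (fun x hx => hasDerivWithinAt_dirDeriv hn hu hI hx)
    (fun x hx => hb _ (hI x (Set.Ico_subset_Icc_self hx))) h ⟨hh, le_rfl⟩
  simpa using this

lemma exists_norm_second_diff_le (hK : UniqueDiffOn ℝ K) (hc : IsCompact K)
    (hu : ContDiffOn ℝ (2 : ℕ) u K) (v : E) : ∃ C, 0 ≤ C ∧ ∀ z h, 0 ≤ h →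
      (∀ r ∈ Set.Icc (-h) h, z + r • v ∈ K) →
        ‖u (z + h • v) + u (z - h • v) - (2 : ℝ) • u z‖ ≤ C * h ^ 2 := by
  obtain ⟨C, hC, hb⟩ := exists_bound_iterate hK hc hu v
  refine ⟨2 * C, by positivity, fun z h hh hI => ?_⟩
  have := norm_second_diff_le (g := fun i r => (dirDeriv K v)^[i] u (z + r • v)) hC
    (fun i hi r hr => hasDerivWithinAt_iterate hK hu hI i hi hr) (fun r hr => hb _ (hI r hr))
    h ⟨hh, le_rfl⟩
  simpa [sub_eq_add_neg] using this

lemma exists_norm_centered_diff_le (hK : UniqueDiffOn ℝ K) (hc : IsCompact K)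
    (hu : ContDiffOn ℝ (3 : ℕ) u K) (v : E) : ∃ C, 0 ≤ C ∧ ∀ z h, 0 ≤ h →
      (∀ r ∈ Set.Icc (-h) h, z + r • v ∈ K) →
        ‖u (z + h • v) - u (z - h • v) - (2 * h) • dirDeriv K v u z‖ ≤ C * h ^ 3 := by
  obtain ⟨C, hC, hb⟩ := exists_bound_iterate hK hc hu v
  refine ⟨2 * C, by positivity, fun z h hh hI => ?_⟩
  have := norm_centered_diff_le (g := fun i r => (dirDeriv K v)^[i] u (z + r • v)) hC
    (fun i hi r hr => hasDerivWithinAt_iterate hK hu hI i hi hr) (fun r hr => hb _ (hI r hr))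
    h ⟨hh, le_rfl⟩
  simpa [sub_eq_add_neg] using this

lemma exists_norm_second_diff_sub_le (hK : UniqueDiffOn ℝ K) (hc : IsCompact K)
    (hu : ContDiffOn ℝ (4 : ℕ) u K) (v : E) : ∃ C, 0 ≤ C ∧ ∀ z h, 0 ≤ h →
      (∀ r ∈ Set.Icc (-h) h, z + r • v ∈ K) →
        ‖u (z + h • v) + u (z - h • v) - (2 : ℝ) • u z - h ^ 2 • dirDeriv K v (dirDeriv K v u) z‖
          ≤ C * h ^ 4 := by
  obtain ⟨C, hC, hb⟩ := exists_bound_iterate hK hc hu v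
  refine ⟨2 * C, by positivity, fun z h hh hI => ?_⟩
  have := norm_second_diff_sub_le (g := fun i r => (dirDeriv K v)^[i] u (z + r • v)) hC
    (fun i hi r hr => hasDerivWithinAt_iterate hK hu hI i hi hr) (fun r hr => hb _ (hI r hr))
    h ⟨hh, le_rfl⟩
  simpa [sub_eq_add_neg] using this

lemma dirDeriv_clm_comp {V' : Type*} [NormedAddCommGroup V'] [NormedSpace ℝ V'] (Λ : V →L[ℝ] V')
    (hK : UniqueDiffOn ℝ K) {n : ℕ} (hn : n ≠ 0) (hu : ContDiffOn ℝ n u K) (v : E) {z : E}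
    (hz : z ∈ K) : dirDeriv K v (fun z => Λ (u z)) z = Λ (dirDeriv K v u z) := by
  have h1 := (hu.differentiableOn (by exact_mod_cast hn) z hz).hasFDerivWithinAt
  have h2 := (Λ.hasFDerivAt.comp_hasFDerivWithinAt z h1).fderivWithin (hK z hz)
  simp only [dirDeriv]
  rw [show (fun z => Λ (u z)) = Λ ∘ u from rfl, h2]
  rfl

lemma dirDeriv_congr {w : E → V} (h : Set.EqOn u w K) (v : E) {z : E} (hz : z ∈ K) :
    dirDeriv K v u z = dirDeriv K v w z := by
  simp only [dirDeriv, fderivWithin_congr h (h hz)]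

end DirDeriv

/-! ### The flow in terms of derivatives within the space-time cylinder -/

section Flow

variable {d : ℕ} {P : Params} {T : ℝ} {Qe : ℝ → (Fin d → ℝ) → Matrix (Fin d) (Fin d) ℝ}

/-- The closed space-time cylinder. -/
def cylinder (d : ℕ) (ℓ T : ℝ) : Set (ℝ × (Fin d → ℝ)) := Set.Icc 0 T ×ˢ cube d ℓ

lemma mem_cube {ℓ : ℝ} {x : Fin d → ℝ} : x ∈ cube d ℓ ↔ ∀ k, 0 ≤ x k ∧ x k ≤ ℓ := by
  simp [cube, Set.mem_Icc, Pi.le_def, forall_and]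

lemma uniqueDiffOn_cube {ℓ : ℝ} (hℓ : 0 < ℓ) : UniqueDiffOn ℝ (cube d ℓ) := by
  rw [cube, ← Set.pi_univ_Icc]
  exact UniqueDiffOn.univ_pi fun _ => uniqueDiffOn_Icc hℓ

lemma uniqueDiffOn_cylinder {ℓ : ℝ} (hℓ : 0 < ℓ) (hT : 0 < T) :
    UniqueDiffOn ℝ (cylinder d ℓ T) := (uniqueDiffOn_Icc hT).prod (uniqueDiffOn_cube hℓ)

lemma isCompact_cube (d : ℕ) (ℓ : ℝ) : IsCompact (cube d ℓ) := isCompact_Icc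

lemma isCompact_cylinder (d : ℕ) (ℓ T : ℝ) : IsCompact (cylinder d ℓ T) :=
  isCompact_Icc.prod (isCompact_cube d ℓ)

lemma cube_mem_nhds {ℓ : ℝ} {x : Fin d → ℝ} (hx : ∀ k, x k ∈ Set.Ioo 0 ℓ) :
    cube d ℓ ∈ nhds x := by
  rw [cube, ← Set.pi_univ_Icc]
  exact set_pi_mem_nhds Set.finite_univ fun k _ => Icc_mem_nhds (hx k).1 (hx k).2

lemma cylinder_mem_nhds {ℓ : ℝ} {t : ℝ} {x : Fin d → ℝ} (ht : t ∈ Set.Ioo 0 T)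
    (hx : ∀ k, x k ∈ Set.Ioo 0 ℓ) : cylinder d ℓ T ∈ nhds (t, x) :=
  prod_mem_nhds (Icc_mem_nhds ht.1 ht.2) (cube_mem_nhds hx)

lemma eventually_interior {ℓ : ℝ} {x : Fin d → ℝ} (hx : ∀ k, x k ∈ Set.Ioo 0 ℓ) :
    ∀ᶠ y in nhds x, ∀ k, y k ∈ Set.Ioo 0 ℓ := by
  have := set_pi_mem_nhds (s := fun _ : Fin d => Set.Ioo 0 ℓ) (x := x) Set.finite_univ
    fun k _ => Ioo_mem_nhds (hx k).1 (hx k).2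
  filter_upwards [this] with y hy k using hy k (Set.mem_univ k)

lemma partialDeriv_eq_dirDeriv {ℓ : ℝ} {w : ℝ × (Fin d → ℝ) → ℝ} {n : ℕ} (hn : n ≠ 0)
    (hw : ContDiffOn ℝ n w (cylinder d ℓ T)) {t : ℝ} {x : Fin d → ℝ} (ht : t ∈ Set.Ioo 0 T)
    (hx : ∀ k, x k ∈ Set.Ioo 0 ℓ) (k : Fin d) :
    partialDeriv k (fun y => w (t, y)) x
      = dirDeriv (cylinder d ℓ T) (0, Pi.single k 1) w (t, x) := by
  have hK := cylinder_mem_nhds (ℓ := ℓ) ht hx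
  have h1 := ((hw.differentiableOn (by exact_mod_cast hn)).differentiableAt hK).hasFDerivAt
  have h2 := (h1.comp x (hasFDerivAt_prodMk_right t x)).fderiv
  simp only [partialDeriv, dirDeriv, fderivWithin_of_mem_nhds hK]
  rw [show (fun y => w (t, y)) = w ∘ fun y => (t, y) from rfl, h2]
  simp

/-- The identity of first derivatives holds near an interior point and may therefore be
differentiated again. -/
lemma partialDeriv_partialDeriv_eq {ℓ : ℝ} (hℓ : 0 < ℓ) (hT : 0 < T) {w : ℝ × (Fin d → ℝ) → ℝ}
    (hw : ContDiffOn ℝ (2 : ℕ) w (cylinder d ℓ T)) {t : ℝ} {x : Fin d → ℝ}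
    (ht : t ∈ Set.Ioo 0 T) (hx : ∀ k, x k ∈ Set.Ioo 0 ℓ) (k l : Fin d) :
    partialDeriv l (partialDeriv k (fun y => w (t, y))) x
      = dirDeriv (cylinder d ℓ T) (0, Pi.single l 1)
          (dirDeriv (cylinder d ℓ T) (0, Pi.single k 1) w) (t, x) := by
  rw [← partialDeriv_eq_dirDeriv one_ne_zero
    (contDiffOn_dirDeriv (uniqueDiffOn_cylinder hℓ hT) hw _) ht hx]
  have : partialDeriv k (fun y => w (t, y))
      =ᶠ[nhds x] fun y => dirDeriv (cylinder d ℓ T) (0, Pi.single k 1) w (t, y) := by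
    filter_upwards [eventually_interior hx] with y hy
    exact partialDeriv_eq_dirDeriv two_ne_zero hw ht hy k
  simp only [partialDeriv] at this ⊢
  rw [this.fderiv_eq]

lemma partialDeriv_comm {w : (Fin d → ℝ) → ℝ} {x : Fin d → ℝ} (hw : ContDiffAt ℝ 2 w x)
    (k l : Fin d) :
    partialDeriv l (partialDeriv k w) x = partialDeriv k (partialDeriv l w) x := by
  have hd : DifferentiableAt ℝ (fderiv ℝ w) x :=
    (hw.fderiv_right (m := 1) (by norm_num)).differentiableAt (by norm_num)
  have h : ∀ k l : Fin d, partialDeriv l (partialDeriv k w) x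
      = fderiv ℝ (fderiv ℝ w) x (Pi.single l 1) (Pi.single k 1) := fun k l => by
    have e := fderiv_clm_apply (c := fderiv ℝ w) (u := fun _ => (Pi.single k 1 : Fin d → ℝ)) hd
      (differentiableAt_const _)
    refine (congrArg (fun A : (Fin d → ℝ) →L[ℝ] ℝ => A (Pi.single l 1)) e).trans ?_
    simp
  rw [h, h]
  exact (hw.isSymmSndFDerivAt (by simp)).eq _ _

lemma partialDeriv_congr {w w' : (Fin d → ℝ) → ℝ} {x : Fin d → ℝ} (h : w =ᶠ[nhds x] w')
    (k : Fin d) : partialDeriv k w =ᶠ[nhds x] partialDeriv k w' := by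
  filter_upwards [h.fderiv (𝕜 := ℝ)] with y hy
  simp only [partialDeriv, hy]

lemma partialDeriv_neg (k : Fin d) (w : (Fin d → ℝ) → ℝ) :
    partialDeriv k (fun y => -w y) = fun y => -partialDeriv k w y := by
  ext y; simp [partialDeriv, fderiv_fun_neg]

/-- In two dimensions all elastic terms reduce to the Laplacian. -/
lemma elastic_two {w : Fin 2 → Fin 2 → (Fin 2 → ℝ) → ℝ} {x : Fin 2 → ℝ}
    (hw : ∀ i j, ContDiffAt ℝ 2 (w i j) x) (hsymm : ∀ᶠ y in nhds x, w 1 0 y = w 0 1 y)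
    (htr : ∀ᶠ y in nhds x, w 1 1 y = -w 0 0 y) (i j : Fin 2) :
    (∑ k, (partialDeriv j (partialDeriv k (w i k)) x + partialDeriv i (partialDeriv k (w j k)) x))
      - 2 / ((2 : ℕ) : ℝ) * (∑ k, ∑ l, partialDeriv l (partialDeriv k (w l k)) x)
        * (if i = j then 1 else 0)
      = ∑ k, partialDeriv k (partialDeriv k (w i j)) x := by
  have h1 : ∀ k l, partialDeriv l (partialDeriv k (w 1 0)) x
      = partialDeriv l (partialDeriv k (w 0 1)) x := fun k l =>
    (partialDeriv_congr (partialDeriv_congr hsymm k) l).eq_of_nhds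
  have h2 : ∀ k l, partialDeriv l (partialDeriv k (w 1 1)) x
      = -partialDeriv l (partialDeriv k (w 0 0)) x := fun k l => by
    rw [(partialDeriv_congr (partialDeriv_congr htr k) l).eq_of_nhds, partialDeriv_neg,
      partialDeriv_neg]
  have h3 := partialDeriv_comm (hw 0 1) 0 1
  have h4 := partialDeriv_comm (hw 0 0) 0 1
  fin_cases i <;> fin_cases j <;> simp [Fin.sum_univ_two, h1, h2, h3, h4] <;> ring

lemma contDiffOn_matrix {E : Type*} [NormedAddCommGroup E] [NormedSpace ℝ E] {n : WithTop ℕ∞}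
    {K : Set E} {U : E → Matrix (Fin d) (Fin d) ℝ}
    (h : ∀ i j, ContDiffOn ℝ n (fun z => U z i j) K) : ContDiffOn ℝ n U K := by
  have : U = fun z => ∑ i, ∑ j, U z i j • Matrix.single i j (1 : ℝ) := by
    ext1 z
    conv_lhs => rw [Matrix.matrix_eq_sum_single (U z)]
    simp [Matrix.smul_single]
  rw [this]
  exact ContDiffOn.sum fun i _ => ContDiffOn.sum fun j _ => (h i j).smul contDiffOn_const

/-- The exact solution as a function on space-time. -/
def spaceTime (Qe : ℝ → (Fin d → ℝ) → Matrix (Fin d) (Fin d) ℝ) :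
    ℝ × (Fin d → ℝ) → Matrix (Fin d) (Fin d) ℝ := fun z => Qe z.1 z.2

lemma IsExactSolution.contDiffOn (h : IsExactSolution P T Qe) :
    ContDiffOn ℝ (4 : ℕ) (spaceTime Qe) (cylinder d P.ℓ T) :=
  contDiffOn_matrix fun i j => h.smooth i j

/-- The flow at interior points, with the elastic terms reduced to the Laplacian. -/
lemma IsExactSolution.flow_eq (hd : d = 2 ∨ d = 3) (hℓ : 0 < P.ℓ) (hT : 0 < T)
    (hL : d = 3 → P.L₂ + P.L₃ = 0) (h : IsExactSolution P T Qe) {t : ℝ} {x : Fin d → ℝ}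
    (ht : t ∈ Set.Ioo 0 T) (hx : ∀ k, x k ∈ Set.Ioo 0 P.ℓ) :
    dirDeriv (cylinder d P.ℓ T) (1, 0) (spaceTime Qe) (t, x)
      = P.L • (∑ k, dirDeriv (cylinder d P.ℓ T) (0, Pi.single k 1)
          (dirDeriv (cylinder d P.ℓ T) (0, Pi.single k 1) (spaceTime Qe)) (t, x))
        + bulkForce P (Qe t x) := by
  have hK := uniqueDiffOn_cylinder (d := d) hℓ hT
  have hn := cylinder_mem_nhds (ℓ := P.ℓ) ht hx
  have hz : (t, x) ∈ cylinder d P.ℓ T := mem_of_mem_nhds hn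
  have hU := h.contDiffOn
  have hU2 : ContDiffOn ℝ (2 : ℕ) (spaceTime Qe) (cylinder d P.ℓ T) := hU.of_le (by norm_num)
  ext i j
  let ent : Matrix (Fin d) (Fin d) ℝ →L[ℝ] ℝ :=
    (Matrix.entryLinearMap ℝ ℝ i j).toContinuousLinearMap
  have hw : ContDiffOn ℝ (2 : ℕ) (fun z => ent (spaceTime Qe z)) (cylinder d P.ℓ T) :=
    (h.smooth i j).of_le (by norm_num)
  have htime : dirDeriv (cylinder d P.ℓ T) (1, 0) (spaceTime Qe) (t, x) i j
      = deriv (fun r => Qe r x i j) t := by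
    refine (dirDeriv_clm_comp ent hK (n := 4) (by norm_num) hU _ hz).symm.trans ?_
    have h1 := ((hw.differentiableOn (by norm_num)).differentiableAt hn).hasFDerivAt
    have h2 := (h1.comp_hasDerivAt t ((hasDerivAt_id t).prodMk (hasDerivAt_const t x))).deriv
    rw [dirDeriv, fderivWithin_of_mem_nhds hn]
    exact h2.symm
  have hspace : ∀ k, dirDeriv (cylinder d P.ℓ T) (0, Pi.single k 1)
      (dirDeriv (cylinder d P.ℓ T) (0, Pi.single k 1) (spaceTime Qe)) (t, x) i j
      = partialDeriv k (partialDeriv k (fun y => Qe t y i j)) x := fun k => by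
    have h1 := partialDeriv_partialDeriv_eq hℓ hT hw ht hx k k
    refine (dirDeriv_clm_comp ent hK (n := 1) one_ne_zero
      (contDiffOn_dirDeriv hK hU2 _) _ hz).symm.trans (Eq.trans (dirDeriv_congr (fun z hz => ?_) _ hz) h1.symm)
    exact (dirDeriv_clm_comp ent hK two_ne_zero hU2 _ hz).symm
  have hsum : (∑ k, dirDeriv (cylinder d P.ℓ T) (0, Pi.single k 1)
      (dirDeriv (cylinder d P.ℓ T) (0, Pi.single k 1) (spaceTime Qe)) (t, x)) i j
      = ∑ k, partialDeriv k (partialDeriv k (fun y => Qe t y i j)) x := by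
    rw [Matrix.sum_apply]
    exact Finset.sum_congr rfl fun k _ => hspace k
  rw [htime, h.evolution t ht x hx i j, Matrix.add_apply, Matrix.smul_apply, hsum, smul_eq_mul,
    Params.L]
  congr 1
  -- For d = 2, `elastic_two` turns the (L₂ + L₃)/2 bracket into the Laplacian, which is how L
  -- arises; for d = 3 its coefficient is zero.
  rcases hd with rfl | rfl
  · have hcd : ∀ i j, ContDiffAt ℝ 2 (fun y => Qe t y i j) x := fun i j => by
      have h1 : ContDiffAt ℝ 4 (fun z : ℝ × (Fin 2 → ℝ) => Qe z.1 z.2 i j) (t, x) :=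
        (h.smooth i j).contDiffAt hn
      exact (h1.of_le (by norm_num)).comp x (contDiffAt_const.prodMk contDiffAt_id)
    have hev : ∀ᶠ y in nhds x, y ∈ cube 2 P.ℓ := cube_mem_nhds hx
    have htI : t ∈ Set.Icc 0 T := Set.Ioo_subset_Icc_self ht
    have := elastic_two (w := fun i j y => Qe t y i j) hcd
      (by filter_upwards [hev] with y hy using (h.isQTensor t htI y hy).2.apply 0 1)
      (by
        filter_upwards [hev] with y hy
        have := (h.isQTensor t htI y hy).1
        simp only [Matrix.trace, Matrix.diag, Fin.sum_univ_two] at this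
        linarith) i j
    rw [this]; ring
  · rw [hL rfl]; ring

end Flow

/-! ### Consistency of the exact solution -/

section Consistency

variable {d M : ℕ} {P : Params} {T t : ℝ} {Qe : ℝ → (Fin d → ℝ) → Matrix (Fin d) (Fin d) ℝ}
  {p : Fin d → ℤ}

/-- The node with index `p`. -/
def node (ℓ : ℝ) (M : ℕ) (p : Fin d → ℤ) : Fin d → ℝ := fun k => (p k : ℝ) * (ℓ / M)

/-- The nodal values of the exact solution. -/
def nodalValues (P : Params) (M : ℕ) (Qe : ℝ → (Fin d → ℝ) → Matrix (Fin d) (Fin d) ℝ) (t : ℝ) :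
    GridTensor d := fun p => if p ∈ interiorNodes d M then Qe t (node P.ℓ M p) else 0

lemma node_apply_mem {ℓ : ℝ} (hℓ : 0 < ℓ) (hM : 0 < M) (k : Fin d) (h0 : 0 ≤ p k) (h1 : p k ≤ M) :
    0 ≤ node ℓ M p k ∧ node ℓ M p k ≤ ℓ := by
  have hM' : (0 : ℝ) < M := by exact_mod_cast hM
  have h0' : (0 : ℝ) ≤ p k := by exact_mod_cast h0
  have h1' : (p k : ℝ) ≤ M := by exact_mod_cast h1
  refine ⟨by unfold node; positivity, ?_⟩
  calc (p k : ℝ) * (ℓ / M) ≤ M * (ℓ / M) := by gcongr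
    _ = ℓ := by field_simp

lemma node_mem_cube {ℓ : ℝ} (hℓ : 0 < ℓ) (hM : 0 < M) (h0 : ∀ k, 0 ≤ p k ∧ p k ≤ M) :
    node ℓ M p ∈ cube d ℓ :=
  mem_cube.2 fun k => node_apply_mem hℓ hM k (h0 k).1 (h0 k).2

lemma node_interior {ℓ : ℝ} (hℓ : 0 < ℓ) (hM : 0 < M) (hp : p ∈ interiorNodes d M) (k : Fin d) :
    node ℓ M p k ∈ Set.Ioo 0 ℓ := by
  have hM' : (0 : ℝ) < M := by exact_mod_cast hM
  have hk := mem_interiorNodes.1 hp k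
  have h0' : (0 : ℝ) < p k := by exact_mod_cast hk.1
  have h1' : (p k : ℝ) < M := by exact_mod_cast hk.2
  refine ⟨by unfold node; positivity, ?_⟩
  calc (p k : ℝ) * (ℓ / M) < M * (ℓ / M) := by gcongr
    _ = ℓ := by field_simp

lemma node_add_single (ℓ : ℝ) (p : Fin d → ℤ) (k : Fin d) :
    node ℓ M (p + Pi.single k 1) = node ℓ M p + (ℓ / M) • Pi.single k 1 := by
  ext j
  by_cases hj : j = k
  · subst hj; simp [node]; ring
  · simp [node, Pi.single_eq_of_ne hj]

lemma node_sub_single (ℓ : ℝ) (p : Fin d → ℤ) (k : Fin d) :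
    node ℓ M (p - Pi.single k 1) = node ℓ M p - (ℓ / M) • Pi.single k 1 := by
  have := node_add_single (M := M) ℓ (p - Pi.single k 1) k
  rw [sub_add_cancel] at this
  rw [this, add_sub_cancel_right]

/-- The segment between the neighbours of an interior node lies in the cube. -/
lemma node_add_smul_mem_cube {ℓ : ℝ} (hℓ : 0 < ℓ) (hM : 0 < M) (hp : p ∈ interiorNodes d M)
    (k : Fin d) {r : ℝ} (hr : r ∈ Set.Icc (-(ℓ / M)) (ℓ / M)) :
    node ℓ M p + r • Pi.single k 1 ∈ cube d ℓ := by
  refine mem_cube.2 fun j => ?_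
  by_cases hj : j = k
  · subst hj
    have hk := mem_interiorNodes.1 hp j
    have h1 := node_apply_mem (p := p - Pi.single j 1) hℓ hM j (by simp; omega) (by simp; omega)
    have h2 := node_apply_mem (p := p + Pi.single j 1) hℓ hM j (by simp; omega) (by simp; omega)
    rw [node_sub_single] at h1
    rw [node_add_single] at h2
    simp only [Pi.sub_apply, Pi.add_apply, Pi.smul_apply, Pi.single_eq_same, smul_eq_mul,
      mul_one] at h1 h2 ⊢
    constructor <;> linarith [hr.1, hr.2]
  · have := node_interior hℓ hM hp j
    simp only [Pi.add_apply, Pi.smul_apply, Pi.single_eq_of_ne hj, smul_zero, add_zero]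
    exact ⟨this.1.le, this.2.le⟩

/-- By the boundary condition, `nodalValues` are the values of the solution at all nodes. -/
lemma nodalValues_eq (h : IsExactSolution P T Qe) (hℓ : 0 < P.ℓ) (hM : 0 < M)
    (ht : t ∈ Set.Icc 0 T) (hp : ∀ k, 0 ≤ p k ∧ p k ≤ M) :
    nodalValues P M Qe t p = Qe t (node P.ℓ M p) := by
  unfold nodalValues
  split_ifs with hp'
  · rfl
  · refine (h.dirichlet t ht _ (node_mem_cube hℓ hM hp) ?_).symm
    simp only [mem_interiorNodes, not_forall] at hp'
    obtain ⟨k, hk⟩ := hp'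
    have hM' : (0 : ℝ) < M := by exact_mod_cast hM
    rcases eq_or_lt_of_le (hp k).1 with h0 | h0
    · exact ⟨k, Or.inl (by simp [node, ← h0])⟩
    · have h1 : p k = M := le_antisymm (hp k).2 (not_lt.1 fun h2 => hk ⟨h0, h2⟩)
      exact ⟨k, Or.inr (by simp only [node, h1, Int.cast_natCast]; field_simp)⟩

/-- Each direction contributes h⁻² times a fourth-order remainder. The boundary condition makes the
zero values stored outside the interior correct at neighbours on the boundary. -/
lemma norm_discLaplacian_sub_le (h : IsExactSolution P T Qe) (hℓ : 0 < P.ℓ) (hM : 0 < M)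
    (ht : t ∈ Set.Icc 0 T) (hp : p ∈ interiorNodes d M)
    {W : Fin d → Matrix (Fin d) (Fin d) ℝ} {C : Fin d → ℝ}
    (hC : ∀ k, ‖spaceTime Qe ((t, node P.ℓ M p) + (P.ℓ / M) • (0, Pi.single k 1))
      + spaceTime Qe ((t, node P.ℓ M p) - (P.ℓ / M) • (0, Pi.single k 1))
      - (2 : ℝ) • spaceTime Qe (t, node P.ℓ M p) - (P.ℓ / M) ^ 2 • W k‖ ≤ C k * (P.ℓ / M) ^ 4) :
    ‖discLaplacian (P.ℓ / M) (nodalValues P M Qe t) p - ∑ k, W k‖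
      ≤ (∑ k, C k) * (P.ℓ / M) ^ 2 := by
  have hM' : (0 : ℝ) < M := by exact_mod_cast hM
  have hh : 0 < P.ℓ / M := by positivity
  have hpk := mem_interiorNodes.1 hp
  have hs : ∀ k j : Fin d, (Pi.single k (1 : ℤ) : Fin d → ℤ) j = 0 ∨
      (Pi.single k (1 : ℤ) : Fin d → ℤ) j = 1 := fun k j => by
    by_cases hj : j = k
    · subst hj; simp
    · simp [Pi.single_eq_of_ne hj]
  rw [discLaplacian_apply, ← Finset.sum_sub_distrib, Finset.sum_mul]
  refine norm_sum_le_of_le _ fun k _ => ?_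
  have e1 : nodalValues P M Qe t (p + Pi.single k 1)
      = spaceTime Qe ((t, node P.ℓ M p) + (P.ℓ / M) • (0, Pi.single k 1)) := by
    rw [nodalValues_eq h hℓ hM ht fun j => ?_, node_add_single]
    · simp [spaceTime]
    · have := hpk j
      rcases hs k j with h | h <;> simp only [Pi.add_apply, h] <;> omega
  have e2 : nodalValues P M Qe t (p - Pi.single k 1)
      = spaceTime Qe ((t, node P.ℓ M p) - (P.ℓ / M) • (0, Pi.single k 1)) := by
    rw [nodalValues_eq h hℓ hM ht fun j => ?_, node_sub_single]
    · simp [spaceTime]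
    · have := hpk j
      rcases hs k j with h | h <;> simp only [Pi.sub_apply, h] <;> omega
  have e3 : nodalValues P M Qe t p = spaceTime Qe (t, node P.ℓ M p) := by
    rw [nodalValues_eq h hℓ hM ht fun j => ⟨(hpk j).1.le, (hpk j).2.le⟩]; rfl
  rw [e1, e2, e3]
  set X := spaceTime Qe ((t, node P.ℓ M p) + (P.ℓ / M) • (0, Pi.single k 1))
      + spaceTime Qe ((t, node P.ℓ M p) - (P.ℓ / M) • (0, Pi.single k 1))
      - (2 : ℝ) • spaceTime Qe (t, node P.ℓ M p) with hX
  have e4 : (P.ℓ / M)⁻¹ ^ 2 • X - W k = (P.ℓ / M)⁻¹ ^ 2 • (X - (P.ℓ / M) ^ 2 • W k) := by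
    have e5 : (P.ℓ / M)⁻¹ ^ 2 * (P.ℓ / M) ^ 2 = 1 := by
      rw [← mul_pow, inv_mul_cancel₀ hh.ne', one_pow]
    rw [smul_sub _ X, smul_smul, e5, one_smul]
  rw [e4, norm_smul, Real.norm_of_nonneg (by positivity)]
  calc _ ≤ (P.ℓ / M)⁻¹ ^ 2 * (C k * (P.ℓ / M) ^ 4) := by gcongr; exact hC k
    _ = C k * (P.ℓ / M) ^ 2 := by field_simp

lemma IsConsistent.mono {R Λ Λ' : ℝ} {F : ℝ → GridTensor d} (h : IsConsistent P M R Λ T F)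
    (hΛ : Λ ≤ Λ') : IsConsistent P M R Λ' T F where
  grid := h.grid
  norm_le := h.norm_le
  lip t τ ht hτ htT p hp := (h.lip t τ ht hτ htT p hp).trans (by gcongr)
  mid t τ ht hτ htT p hp := (h.mid t τ ht hτ htT p hp).trans (by gcongr)
  backward t τ ht hτ htT p hp := (h.backward t τ ht hτ htT p hp).trans (by gcongr)
  centered t τ ht hτ htT p hp := (h.centered t τ ht hτ htT p hp).trans (by gcongr)

/-- The exact solution satisfies the schemes up to the consistency errors. -/
theorem IsExactSolution.exists_isConsistent (h : IsExactSolution P T Qe) (hd : d = 2 ∨ d = 3)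
    (hℓ : 0 < P.ℓ) (hT : 0 < T) (hL0 : 0 ≤ P.L) (hL : d = 3 → P.L₂ + P.L₃ = 0)
    {R Λ₀ : ℝ} (hR : ∀ z ∈ cylinder d P.ℓ T, ‖spaceTime Qe z‖ ≤ R) (hΛ₀ : 0 ≤ Λ₀)
    (hF : ForceBounds d P R Λ₀) :
    ∃ Λ, 0 ≤ Λ ∧ ∀ M : ℕ, 0 < M → IsConsistent P M R Λ T (nodalValues P M Qe) := by
  have hK := uniqueDiffOn_cylinder (d := d) hℓ hT
  have hc := isCompact_cylinder d P.ℓ T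
  have hU := h.contDiffOn
  set K := cylinder d P.ℓ T with hKdef
  set U := spaceTime Qe with hUdef
  set W : Fin d → ℝ × (Fin d → ℝ) → Matrix (Fin d) (Fin d) ℝ := fun k =>
    dirDeriv K (0, Pi.single k 1) (dirDeriv K (0, Pi.single k 1) U) with hW
  have hWC : ∀ k, ContDiffOn ℝ (2 : ℕ) (W k) K := fun k =>
    contDiffOn_dirDeriv hK (contDiffOn_dirDeriv hK hU _) _
  obtain ⟨C₁, p1, H1⟩ := exists_norm_sub_le hK hc (by norm_num) hU (1, 0)
  obtain ⟨C₂, p2, H2⟩ := exists_norm_second_diff_le hK hc (hU.of_le (by norm_num)) (1, 0)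
  obtain ⟨C₃, p3, H3⟩ := exists_norm_centered_diff_le hK hc (hU.of_le (by norm_num)) (1, 0)
  choose C₄ p4 H4 using fun k : Fin d =>
    exists_norm_second_diff_sub_le hK hc hU (0, Pi.single k 1)
  -- The second space derivatives use up two of the four derivatives. They remain C², just enough
  -- for a second difference in time.
  choose C₅ p5 H5 using fun k : Fin d => exists_norm_sub_le hK hc two_ne_zero (hWC k) (1, 0)
  choose C₆ p6 H6 using fun k : Fin d => exists_norm_second_diff_le hK hc (hWC k) (1, 0)
  set D₄ := ∑ k, C₄ k
  set D₅ := ∑ k, C₅ k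
  set D₆ := ∑ k, C₆ k
  have q4 : 0 ≤ D₄ := Finset.sum_nonneg fun k _ => p4 k
  have q5 : 0 ≤ D₅ := Finset.sum_nonneg fun k _ => p5 k
  have q6 : 0 ≤ D₆ := Finset.sum_nonneg fun k _ => p6 k
  refine ⟨C₁ + C₂ + (C₃ * T + C₃) + P.L * D₄ + P.L * D₅ + Λ₀ * C₁ + P.L * D₆, by positivity,
    fun M hM => ?_⟩
  have hM' : (0 : ℝ) < M := by exact_mod_cast hM
  have hh : 0 < P.ℓ / M := by positivity
  have hcube : ∀ p ∈ interiorNodes d M, node P.ℓ M p ∈ cube d P.ℓ := fun p hp =>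
    node_mem_cube hℓ hM fun k => ⟨(mem_interiorNodes.1 hp k).1.le, (mem_interiorNodes.1 hp k).2.le⟩
  have hval : ∀ t, ∀ p ∈ interiorNodes d M, nodalValues P M Qe t p = U (t, node P.ℓ M p) :=
    fun t p hp => by simp only [nodalValues, hp, if_true]; rfl
  have hLap : ∀ t ∈ Set.Icc 0 T, ∀ p ∈ interiorNodes d M,
      ‖discLaplacian (P.ℓ / M) (nodalValues P M Qe t) p - ∑ k, W k (t, node P.ℓ M p)‖
        ≤ D₄ * (P.ℓ / M) ^ 2 := fun t ht p hp =>
    norm_discLaplacian_sub_le h hℓ hM ht hp fun k => H4 k _ _ hh.le fun r hr => by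
      have := node_add_smul_mem_cube hℓ hM hp k hr
      exact ⟨by simpa using ht, by simpa using this⟩
  have htime : ∀ t τ, 0 ≤ t → 0 < τ → t + τ ≤ T → ∀ p ∈ interiorNodes d M,
      ∀ r ∈ Set.Icc (-(τ / 2)) (τ / 2),
        ((t + τ / 2, node P.ℓ M p) : ℝ × (Fin d → ℝ)) + r • (1, 0) ∈ K :=
    fun t τ ht hτ htT p hp r hr => by
      refine ⟨?_, by simpa using hcube p hp⟩
      simp only [Prod.smul_mk, smul_eq_mul, mul_one, Prod.mk_add_mk]
      constructor <;> linarith [hr.1, hr.2]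
  have e1 : ∀ (t τ : ℝ) (x : Fin d → ℝ),
      ((t + τ / 2, x) : ℝ × (Fin d → ℝ)) + (τ / 2) • (1, 0) = (t + τ, x) := fun t τ x => by
    simp only [Prod.smul_mk, smul_eq_mul, mul_one, Prod.mk_add_mk, smul_zero, add_zero]
    congr 1; ring
  have e2 : ∀ (t τ : ℝ) (x : Fin d → ℝ),
      ((t + τ / 2, x) : ℝ × (Fin d → ℝ)) - (τ / 2) • (1, 0) = (t, x) := fun t τ x => by
    simp only [Prod.smul_mk, smul_eq_mul, mul_one, Prod.mk_sub_mk, smul_zero, sub_zero]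
    congr 1; ring
  have e3 : ∀ (t τ : ℝ) (x : Fin d → ℝ),
      ((t, x) : ℝ × (Fin d → ℝ)) + τ • (1, 0) = (t + τ, x) := fun t τ x => by
    simp
  -- The equation is known only on the open interval (0, T). Midpoint times always lie there, even
  -- when t = 0 or t + τ = T.
  have hflow : ∀ t τ, 0 ≤ t → 0 < τ → t + τ ≤ T → ∀ p ∈ interiorNodes d M,
      dirDeriv K (1, 0) U (t + τ / 2, node P.ℓ M p)
        = P.L • (∑ k, W k (t + τ / 2, node P.ℓ M p)) + bulkForce P (U (t + τ / 2, node P.ℓ M p)) :=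
    fun t τ ht hτ htT p hp => h.flow_eq hd hℓ hT hL ⟨by linarith, by linarith⟩
      (node_interior hℓ hM hp)
  have hcent : ∀ t τ, 0 ≤ t → 0 < τ → t + τ ≤ T → ∀ p ∈ interiorNodes d M,
      ‖τ⁻¹ • (U (t + τ, node P.ℓ M p) - U (t, node P.ℓ M p)
        - τ • dirDeriv K (1, 0) U (t + τ / 2, node P.ℓ M p))‖ ≤ C₃ * τ ^ 2 :=
    fun t τ ht hτ htT p hp => by
      have := H3 _ (τ / 2) (by positivity) (htime t τ ht hτ htT p hp)
      rw [e1, e2, mul_div_cancel₀ _ two_ne_zero] at this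
      rw [norm_smul, Real.norm_of_nonneg (by positivity)]
      calc _ ≤ τ⁻¹ * (C₃ * (τ / 2) ^ 3) := by gcongr
        _ = C₃ * τ ^ 2 / 8 := by field_simp; ring
        _ ≤ C₃ * τ ^ 2 := by linarith [mul_nonneg p3 (sq_nonneg τ)]
  refine ⟨fun t ht => ⟨fun p => ?_, fun p hp => if_neg hp⟩, fun t ht p => ?_, ?_, ?_, ?_, ?_⟩
  · by_cases hp : p ∈ interiorNodes d M
    · rw [hval t p hp]; exact h.isQTensor t ht _ (hcube p hp)
    · rw [nodalValues, if_neg hp]; exact isQTensor_zero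
  · by_cases hp : p ∈ interiorNodes d M
    · rw [hval t p hp]; exact hR _ ⟨ht, hcube p hp⟩
    · rw [nodalValues, if_neg hp, norm_zero]
      exact (norm_nonneg _).trans (hR (0, 0) ⟨⟨le_rfl, hT.le⟩, mem_cube.2 fun k =>
        ⟨le_rfl, hℓ.le⟩⟩)
  · intro t τ ht hτ htT p hp
    rw [hval _ p hp, hval _ p hp, ← e3]
    refine (H1 _ τ hτ.le fun r hr => ⟨?_, by simpa using hcube p hp⟩).trans ?_
    · simp only [Prod.smul_mk, smul_eq_mul, mul_one, Prod.mk_add_mk]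
      constructor <;> linarith [hr.1, hr.2]
    · gcongr
      have : 0 ≤ C₃ * T + C₃ := by positivity
      have : 0 ≤ P.L * D₄ + P.L * D₅ + Λ₀ * C₁ + P.L * D₆ := by positivity
      linarith
  · intro t τ ht hτ htT p hp
    rw [hval _ p hp, hval _ p hp, hval _ p hp]
    have := H2 _ (τ / 2) (by positivity) (htime t τ ht hτ htT p hp)
    rw [e1, e2] at this
    have e : (1 / 2 : ℝ) • (U (t + τ, node P.ℓ M p) + U (t, node P.ℓ M p))
        - U (t + τ / 2, node P.ℓ M p) = (1 / 2 : ℝ) • (U (t + τ, node P.ℓ M p)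
          + U (t, node P.ℓ M p) - (2 : ℝ) • U (t + τ / 2, node P.ℓ M p)) := by module
    rw [e, norm_smul, Real.norm_of_nonneg (by norm_num)]
    have h1 : C₂ * τ ^ 2 ≤ (C₁ + C₂ + (C₃ * T + C₃) + P.L * D₄ + P.L * D₅ + Λ₀ * C₁ + P.L * D₆)
        * τ ^ 2 := by
      gcongr
      have : 0 ≤ C₃ * T + C₃ := by positivity
      have : 0 ≤ P.L * D₄ + P.L * D₅ + Λ₀ * C₁ + P.L * D₆ := by positivity
      linarith
    refine le_trans ?_ h1
    linarith [mul_nonneg p2 (sq_nonneg τ)]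
  · intro t τ ht hτ htT p hp
    have hz : (t, node P.ℓ M p) ∈ K := ⟨⟨ht, by linarith⟩, hcube p hp⟩
    have hzm : (t + τ / 2, node P.ℓ M p) ∈ K :=
      ⟨⟨by linarith, by linarith⟩, hcube p hp⟩
    have a1 := hcent t τ ht hτ htT p hp
    have a2 := hLap (t + τ) ⟨by linarith, htT⟩ p hp
    -- The centered difference refers to the midpoint. Moving the Laplacian to t + τ and the force
    -- to t costs one order in τ each.
    have a3 : ‖∑ k, W k (t + τ, node P.ℓ M p) - ∑ k, W k (t + τ / 2, node P.ℓ M p)‖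
        ≤ D₅ * (τ / 2) := by
      rw [← Finset.sum_sub_distrib, Finset.sum_mul]
      refine norm_sum_le_of_le _ fun k _ => ?_
      rw [← e1]
      exact H5 k _ _ (by positivity) fun r hr =>
        htime t τ ht hτ htT p hp r ⟨by linarith [hr.1], hr.2⟩
    have a4 : ‖bulkForce P (U (t + τ / 2, node P.ℓ M p)) - bulkForce P (U (t, node P.ℓ M p))‖
        ≤ Λ₀ * (C₁ * (τ / 2)) := by
      refine (hF.lip _ _ (hR _ hzm) (hR _ hz)).trans ?_
      gcongr
      rw [← e3]
      refine H1 _ _ (by positivity) fun r hr => ⟨?_, by simpa using hcube p hp⟩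
      simp only [Prod.smul_mk, smul_eq_mul, mul_one, Prod.mk_add_mk]
      constructor <;> linarith [hr.1, hr.2]
    rw [hval _ p hp, hval _ p hp]
    have e : τ⁻¹ • (U (t + τ, node P.ℓ M p) - U (t, node P.ℓ M p))
        - P.L • discLaplacian (P.ℓ / M) (nodalValues P M Qe (t + τ)) p
        - bulkForce P (U (t, node P.ℓ M p))
      = τ⁻¹ • (U (t + τ, node P.ℓ M p) - U (t, node P.ℓ M p)
          - τ • dirDeriv K (1, 0) U (t + τ / 2, node P.ℓ M p))
        - P.L • (discLaplacian (P.ℓ / M) (nodalValues P M Qe (t + τ)) p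
          - ∑ k, W k (t + τ, node P.ℓ M p))
        - P.L • (∑ k, W k (t + τ, node P.ℓ M p) - ∑ k, W k (t + τ / 2, node P.ℓ M p))
        + (bulkForce P (U (t + τ / 2, node P.ℓ M p)) - bulkForce P (U (t, node P.ℓ M p))) := by
      rw [hflow t τ ht hτ htT p hp, smul_sub τ⁻¹ _ (τ • _), smul_smul,
        inv_mul_cancel₀ hτ.ne', one_smul]
      module
    rw [e]
    refine (norm_add_le _ _).trans ((add_le_add ((norm_sub_le _ _).trans (add_le_add
      ((norm_sub_le _ _).trans (add_le_add a1 ?_)) ?_)) a4).trans (b := C₃ * τ ^ 2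
        + P.L * (D₄ * (P.ℓ / M) ^ 2) + P.L * (D₅ * (τ / 2)) + Λ₀ * (C₁ * (τ / 2))) ?_)
    · rw [norm_smul, Real.norm_of_nonneg hL0]; gcongr
    · rw [norm_smul, Real.norm_of_nonneg hL0]; gcongr
    · have b1 : C₃ * τ ^ 2 ≤ C₃ * (T * τ) := by
        rw [sq]; gcongr; linarith
      set k := (P.ℓ / M) ^ 2
      have hk : 0 ≤ k := sq_nonneg _
      have n1 : 0 ≤ P.L * D₄ * τ := by positivity
      have n2 : 0 ≤ P.L * D₅ * τ := by positivity
      have n3 : 0 ≤ P.L * D₆ * (τ + k) := by positivity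
      have n4 : 0 ≤ Λ₀ * C₁ * τ := by positivity
      have n5 : 0 ≤ (C₁ + C₂) * (τ + k) := by positivity
      have n6 : 0 ≤ C₃ * (τ + k) := by positivity
      have n7 : 0 ≤ (C₃ * T + P.L * D₅ + Λ₀ * C₁) * k := by positivity
      linarith
  · intro t τ ht hτ htT p hp
    have a1 := hcent t τ ht hτ htT p hp
    have a2 := hLap (t + τ) ⟨by linarith, htT⟩ p hp
    have a2' := hLap t ⟨ht, by linarith⟩ p hp
    -- The average of the end values differs from the midpoint value by a second difference in time,
    -- hence by O(τ²).
    have a3 : ‖∑ k, W k (t + τ, node P.ℓ M p) + ∑ k, W k (t, node P.ℓ M p)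
        - (2 : ℝ) • ∑ k, W k (t + τ / 2, node P.ℓ M p)‖ ≤ D₆ * (τ / 2) ^ 2 := by
      rw [Finset.smul_sum, ← Finset.sum_add_distrib, ← Finset.sum_sub_distrib, Finset.sum_mul]
      refine norm_sum_le_of_le _ fun k _ => ?_
      have := H6 k _ (τ / 2) (by positivity) (htime t τ ht hτ htT p hp)
      rwa [e1, e2] at this
    rw [hval _ p hp, hval _ p hp, hval _ p hp, discLaplacian_smul, discLaplacian_add]
    have e : τ⁻¹ • (U (t + τ, node P.ℓ M p) - U (t, node P.ℓ M p))
        - P.L • ((1 / 2 : ℝ) • (discLaplacian (P.ℓ / M) (nodalValues P M Qe (t + τ))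
          + discLaplacian (P.ℓ / M) (nodalValues P M Qe t))) p
        - bulkForce P (U (t + τ / 2, node P.ℓ M p))
      = τ⁻¹ • (U (t + τ, node P.ℓ M p) - U (t, node P.ℓ M p)
          - τ • dirDeriv K (1, 0) U (t + τ / 2, node P.ℓ M p))
        - (P.L / 2) • (discLaplacian (P.ℓ / M) (nodalValues P M Qe (t + τ)) p
          - ∑ k, W k (t + τ, node P.ℓ M p))
        - (P.L / 2) • (discLaplacian (P.ℓ / M) (nodalValues P M Qe t) p
          - ∑ k, W k (t, node P.ℓ M p))
        - (P.L / 2) • (∑ k, W k (t + τ, node P.ℓ M p) + ∑ k, W k (t, node P.ℓ M p)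
          - (2 : ℝ) • ∑ k, W k (t + τ / 2, node P.ℓ M p)) := by
      rw [hflow t τ ht hτ htT p hp, smul_sub τ⁻¹ _ (τ • _), smul_smul,
        inv_mul_cancel₀ hτ.ne', one_smul, Pi.smul_apply, Pi.add_apply]
      module
    rw [e]
    have hL2 : 0 ≤ P.L / 2 := by positivity
    refine (norm_sub_le _ _).trans ((add_le_add ((norm_sub_le _ _).trans (add_le_add
      ((norm_sub_le _ _).trans (add_le_add a1 ?_)) ?_)) ?_).trans (b := C₃ * τ ^ 2
        + P.L / 2 * (D₄ * (P.ℓ / M) ^ 2) + P.L / 2 * (D₄ * (P.ℓ / M) ^ 2)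
        + P.L / 2 * (D₆ * (τ / 2) ^ 2)) ?_)
    · rw [norm_smul, Real.norm_of_nonneg hL2]; gcongr
    · rw [norm_smul, Real.norm_of_nonneg hL2]; gcongr
    · rw [norm_smul, Real.norm_of_nonneg hL2]; gcongr
    · set k := (P.ℓ / M) ^ 2
      have hk : 0 ≤ k := sq_nonneg _
      have n1 : 0 ≤ P.L * D₄ * τ ^ 2 := by positivity
      have n2 : 0 ≤ P.L * D₅ * (τ ^ 2 + k) := by positivity
      have n3 : 0 ≤ P.L * D₆ * τ ^ 2 := by positivity
      have n3' : 0 ≤ P.L * D₆ * k := by positivity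
      have n4 : 0 ≤ Λ₀ * C₁ * (τ ^ 2 + k) := by positivity
      have n5 : 0 ≤ (C₁ + C₂) * (τ ^ 2 + k) := by positivity
      have n6 : 0 ≤ C₃ * k := by positivity
      have n7 : 0 ≤ C₃ * T * (τ ^ 2 + k) := by positivity
      linarith

end Consistency

/-! ### The quadrature error of the bulk energy -/

section Quadrature

open MeasureTheory

variable {d M : ℕ}

/-- The integral over a box differs from the midpoint value by the mean of the symmetric second
differences. -/
lemma abs_integral_box_sub_le {c δ : Fin d → ℝ} (hδ : 0 ≤ δ) {u : (Fin d → ℝ) → ℝ}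
    (hu : IntegrableOn u (Set.Icc (c - δ) (c + δ))) {B : ℝ}
    (hB : ∀ x ∈ Set.Icc (c - δ) (c + δ), |u x + u (c + c - x) - 2 * u c| ≤ B) :
    |(∫ x in Set.Icc (c - δ) (c + δ), u x) - (∏ k, (2 * δ k)) * u c|
      ≤ B / 2 * ∏ k, (2 * δ k) := by
  set I := Set.Icc (c - δ) (c + δ) with hI
  have hvol : (volume : Measure (Fin d → ℝ)).real I = ∏ k, (2 * δ k) := by
    rw [Measure.real, Real.volume_Icc_pi_toReal (by
      intro k; have := hδ k; simp only [Pi.sub_apply, Pi.add_apply, Pi.zero_apply] at *; linarith)]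
    exact Finset.prod_congr rfl fun k _ => by simp only [Pi.sub_apply, Pi.add_apply]; ring
  -- Reflection through the centre preserves the box and the measure, so u may be symmetrized under
  -- the integral and first-order terms cancel.
  have hpre : (fun x => c + c - x) ⁻¹' I = I := by
    ext x
    simp only [hI, Set.mem_preimage, Set.mem_Icc, Pi.le_def, Pi.sub_apply, Pi.add_apply,
      ← forall_and]
    refine forall_congr' fun k => ?_
    constructor <;> rintro ⟨h1, h2⟩ <;> constructor <;> linarith
  have hmp := volume.measurePreserving_sub_left (c + c)
  have hemb : MeasurableEmbedding fun x : Fin d → ℝ => c + c - x :=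
    (Homeomorph.subLeft (c + c)).measurableEmbedding
  have hrefl : ∫ x in I, u (c + c - x) = ∫ x in I, u x := by
    have := hmp.setIntegral_preimage_emb hemb u I
    rwa [hpre] at this
  have hu' : IntegrableOn (fun x => u (c + c - x)) I := by
    have := (hmp.integrableOn_comp_preimage hemb (f := u) (s := I)).2 hu
    rwa [hpre] at this
  have hlt : volume I < ⊤ := isCompact_Icc.measure_lt_top
  have hconst : IntegrableOn (fun _ : Fin d → ℝ => 2 * u c) I :=
    integrableOn_const hlt.ne
  have key : ∫ x in I, (u x + u (c + c - x) - 2 * u c)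
      = 2 * ((∫ x in I, u x) - (∏ k, (2 * δ k)) * u c) := by
    rw [integral_sub (f := fun x => u x + u (c + c - x)) (hu.add hu') hconst, integral_add hu hu', hrefl, setIntegral_const, hvol,
      smul_eq_mul]
    ring
  have := norm_setIntegral_le_of_norm_le_const hlt
    (f := fun x => u x + u (c + c - x) - 2 * u c) hB
  rw [key, hvol, Real.norm_eq_abs, abs_mul, abs_two] at this
  linarith

/-- The half-open dual cell around a node. -/
def dualCell (ℓ : ℝ) (M : ℕ) (p : Fin d → ℤ) : Set (Fin d → ℝ) :=
  Set.univ.pi fun k => Set.Ico (node ℓ M p k - ℓ / M / 2) (node ℓ M p k + ℓ / M / 2)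

lemma dualCell_ae_eq (ℓ : ℝ) (M : ℕ) (p : Fin d → ℤ) :
    dualCell ℓ M p =ᵐ[volume] Set.Icc (node ℓ M p - fun _ => ℓ / M / 2)
      (node ℓ M p + fun _ => ℓ / M / 2) :=
  Measure.univ_pi_Ico_ae_eq_Icc

lemma measurableSet_dualCell (ℓ : ℝ) (M : ℕ) (p : Fin d → ℤ) :
    MeasurableSet (dualCell ℓ M p) :=
  MeasurableSet.univ_pi fun _ => measurableSet_Ico

lemma box_subset_cube {ℓ : ℝ} (hℓ : 0 < ℓ) (hM : 0 < M) {p : Fin d → ℤ}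
    (hp : p ∈ interiorNodes d M) :
    Set.Icc (node ℓ M p - fun _ => ℓ / M / 2) (node ℓ M p + fun _ => ℓ / M / 2) ⊆ cube d ℓ := by
  intro x hx
  have hM' : (0 : ℝ) < M := by exact_mod_cast hM
  have hh : 0 < ℓ / M := by positivity
  refine mem_cube.2 fun k => ?_
  have h1 := node_add_smul_mem_cube hℓ hM hp k (r := ℓ / M / 2) ⟨by linarith, by linarith⟩
  have h2 := node_add_smul_mem_cube hℓ hM hp k (r := -(ℓ / M / 2)) ⟨by linarith, by linarith⟩
  have h1' := (mem_cube.1 h1 k).2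
  have h2' := (mem_cube.1 h2 k).1
  have h3 := hx.1 k
  have h4 := hx.2 k
  simp only [Pi.add_apply, Pi.smul_apply, Pi.sub_apply, Pi.single_eq_same, smul_eq_mul,
    mul_one] at h1' h2' h3 h4
  constructor <;> linarith

lemma dualCell_subset_cube {ℓ : ℝ} (hℓ : 0 < ℓ) (hM : 0 < M) {p : Fin d → ℤ}
    (hp : p ∈ interiorNodes d M) : dualCell ℓ M p ⊆ cube d ℓ := fun _ hx =>
  box_subset_cube hℓ hM hp ⟨fun k => (hx k (Set.mem_univ k)).1,
    fun k => (hx k (Set.mem_univ k)).2.le⟩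

/-- The cell of a point is found by rounding its coordinates. Disjointness of the half-open cells
and the description of the uncovered layer both follow. -/
lemma mem_dualCell_iff {ℓ : ℝ} (hℓ : 0 < ℓ) (hM : 0 < M) {p : Fin d → ℤ} {x : Fin d → ℝ} :
    x ∈ dualCell ℓ M p ↔ p = fun k => ⌊x k / (ℓ / M) + 1 / 2⌋ := by
  have hM' : (0 : ℝ) < M := by exact_mod_cast hM
  have hh : 0 < ℓ / M := by positivity
  simp only [dualCell, Set.mem_univ_pi, funext_iff]
  refine forall_congr' fun k => ?_
  rw [eq_comm, Int.floor_eq_iff, Set.mem_Ico, ← sub_le_iff_le_add, ← lt_sub_iff_add_lt,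
    le_div_iff₀ hh, div_lt_iff₀ hh, node]
  constructor <;> rintro ⟨h1, h2⟩ <;> constructor <;> linarith

lemma pairwise_disjoint_dualCell {ℓ : ℝ} (hℓ : 0 < ℓ) (hM : 0 < M) (s : Set (Fin d → ℤ)) :
    s.Pairwise (Function.onFun Disjoint (dualCell ℓ M)) := by
  intro p _ q _ hpq
  refine Set.disjoint_left.2 fun x hx hx' => hpq ?_
  rw [(mem_dualCell_iff hℓ hM).1 hx, (mem_dualCell_iff hℓ hM).1 hx']

/-- Points of the cube outside all dual cells of interior nodes are close to the boundary. -/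
lemma exists_near_boundary {ℓ : ℝ} (hℓ : 0 < ℓ) (hM : 0 < M) {x : Fin d → ℝ}
    (hx : x ∉ ⋃ p ∈ interiorNodes d M, dualCell ℓ M p) :
    ∃ k, x k ≤ ℓ / M ∨ ℓ - ℓ / M ≤ x k := by
  have hM' : (0 : ℝ) < M := by exact_mod_cast hM
  have hh : 0 < ℓ / M := by positivity
  by_contra! hc
  refine hx (Set.mem_biUnion (mem_interiorNodes.2 fun k => ?_)
    ((mem_dualCell_iff hℓ hM).2 rfl))
  obtain ⟨h1, h2⟩ := hc k
  have h3 : 1 < x k / (ℓ / M) := (one_lt_div hh).2 h1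
  have h4 : x k / (ℓ / M) < M - 1 := by
    rw [div_lt_iff₀ hh, sub_mul, mul_div_cancel₀ _ hM'.ne']
    linarith
  constructor
  · exact Int.floor_pos.2 (by linarith)
  · rw [Int.floor_lt]; push_cast; linarith

/-- The quadrature error of the sum over the interior nodes. -/
lemma abs_integral_cube_sub_sum_le {ℓ : ℝ} (hℓ : 0 < ℓ) (hM : 0 < M) {u : (Fin d → ℝ) → ℝ}
    (hu : ContinuousOn u (cube d ℓ)) {B : ℝ} (hB : 0 ≤ B)
    (hsymm : ∀ p ∈ interiorNodes d M, ∀ x ∈ Set.Icc (node ℓ M p - fun _ => ℓ / M / 2)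
      (node ℓ M p + fun _ => ℓ / M / 2),
      |u x + u (node ℓ M p + node ℓ M p - x) - 2 * u (node ℓ M p)| ≤ B)
    (hbd : ∀ x ∈ cube d ℓ, (∃ k, x k ≤ ℓ / M ∨ ℓ - ℓ / M ≤ x k) → |u x| ≤ B) :
    |(∫ x in cube d ℓ, u x) - (ℓ / M) ^ d * ∑ p ∈ interiorNodes d M, u (node ℓ M p)|
      ≤ 2 * B * ℓ ^ d := by
  have hM' : (0 : ℝ) < M := by exact_mod_cast hM
  have hh : 0 < ℓ / M := by positivity
  have hint : IntegrableOn u (cube d ℓ) := hu.integrableOn_compact (isCompact_cube d ℓ)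
  set S := ⋃ p ∈ interiorNodes d M, dualCell ℓ M p with hS
  have hSm : MeasurableSet S :=
    Finset.measurableSet_biUnion _ fun p _ => measurableSet_dualCell ℓ M p
  have hSc : S ⊆ cube d ℓ := Set.iUnion₂_subset fun p hp => dualCell_subset_cube hℓ hM hp
  have hsplit : ∫ x in cube d ℓ, u x = (∫ x in cube d ℓ \ S, u x)
      + ∑ p ∈ interiorNodes d M, ∫ x in dualCell ℓ M p, u x := by
    rw [← integral_biUnion_finset _ (fun p _ => measurableSet_dualCell ℓ M p)
      (pairwise_disjoint_dualCell hℓ hM _)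
      (fun p hp => hint.mono_set (dualCell_subset_cube hℓ hM hp)),
      ← setIntegral_union Set.disjoint_sdiff_left hSm (hint.mono_set Set.sdiff_subset)
        (hint.mono_set hSc), Set.sdiff_union_of_subset hSc]
  have hvol : (volume : Measure (Fin d → ℝ)).real (cube d ℓ) = ℓ ^ d := by
    rw [Measure.real, cube, Real.volume_Icc_pi_toReal (a := 0) (b := fun _ : Fin d => ℓ) (fun _ => hℓ.le)]
    simp
  -- The small volume of the layer is not exploited: the integrand is already at most B there. This
  -- also covers M = 1, when there is no interior node.
  have hrest : |∫ x in cube d ℓ \ S, u x| ≤ B * ℓ ^ d := by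
    have hlt : volume (cube d ℓ) < ⊤ := (isCompact_cube d ℓ).measure_lt_top
    refine (norm_setIntegral_le_of_norm_le_const ((measure_mono Set.sdiff_subset).trans_lt hlt)
      (f := u) (C := B) fun x hx => hbd x hx.1 (exists_near_boundary hℓ hM hx.2)).trans ?_
    rw [← hvol]
    gcongr
    · exact hlt.ne
    · exact Set.sdiff_subset
  have hcell : ∀ p ∈ interiorNodes d M,
      |(∫ x in dualCell ℓ M p, u x) - (ℓ / M) ^ d * u (node ℓ M p)| ≤ (ℓ / M) ^ d * B := by
    intro p hp
    have := abs_integral_box_sub_le (c := node ℓ M p) (δ := fun _ => ℓ / M / 2)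
      (fun _ => by simp only [Pi.zero_apply]; positivity)
      (hint.mono_set (box_subset_cube hℓ hM hp)) (hsymm p hp)
    rw [setIntegral_congr_set (dualCell_ae_eq ℓ M p)]
    simp only [mul_div_cancel₀ _ (two_ne_zero' ℝ), Finset.prod_const, Finset.card_univ,
      Fintype.card_fin] at this
    refine this.trans ?_
    rw [mul_comm]
    gcongr
    linarith
  rw [hsplit, add_sub_assoc, Finset.mul_sum, ← Finset.sum_sub_distrib]
  have h1 : |∑ p ∈ interiorNodes d M,
      ((∫ x in dualCell ℓ M p, u x) - (ℓ / M) ^ d * u (node ℓ M p))| ≤ B * ℓ ^ d := by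
    refine (Finset.abs_sum_le_sum_abs _ _).trans ((Finset.sum_le_sum hcell).trans ?_)
    rw [← Finset.mul_sum]
    exact weighted_sum_le hℓ hM hB fun p _ => le_rfl
  have := abs_add_le (∫ x in cube d ℓ \ S, u x) (∑ p ∈ interiorNodes d M,
      ((∫ x in dualCell ℓ M p, u x) - (ℓ / M) ^ d * u (node ℓ M p)))
  linarith

end Quadrature

/-! ### Second differences in arbitrary directions -/

section SecondDifferences

variable {E V : Type*} [NormedAddCommGroup E] [NormedSpace ℝ E] [NormedAddCommGroup V]
  [NormedSpace ℝ V] {K : Set E} {u : E → V}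

/-- Second differences are quadratic in the increment, uniformly in its direction. -/
lemma exists_norm_second_diff_le_sq (hK : UniqueDiffOn ℝ K) (hc : IsCompact K)
    (hu : ContDiffOn ℝ (2 : ℕ) u K) : ∃ C, 0 ≤ C ∧ ∀ z v,
      (∀ r ∈ Set.Icc (-1 : ℝ) 1, z + r • v ∈ K) →
        ‖u (z + v) + u (z - v) - (2 : ℝ) • u z‖ ≤ C * ‖v‖ ^ 2 := by
  have h1 : ContDiffOn ℝ (1 : ℕ) (fderivWithin ℝ u K) K := hu.fderivWithin hK (by norm_cast)
  have h2 : ContDiffOn ℝ (0 : ℕ) (fderivWithin ℝ (fderivWithin ℝ u K) K) K :=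
    h1.fderivWithin hK (by norm_cast)
  obtain ⟨C, hC, hb⟩ := exists_bound_of_contDiffOn hc h2
  refine ⟨2 * C, by positivity, fun z v hz => ?_⟩
  have hiter : ∀ w ∈ K, ‖dirDeriv K v (dirDeriv K v u) w‖ ≤ C * ‖v‖ ^ 2 := by
    intro w hw
    have e : dirDeriv K v (dirDeriv K v u) w
        = fderivWithin ℝ (fderivWithin ℝ u K) K w v v := by
      have := fderivWithin_clm_apply (hK w hw) (c := fderivWithin ℝ u K) (u := fun _ => v)
        (h1.differentiableOn (by norm_num) w hw) (differentiableWithinAt_const _)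
      refine (congrArg (fun A : E →L[ℝ] V => A v) this).trans ?_
      simp
    rw [e]
    calc _ ≤ ‖fderivWithin ℝ (fderivWithin ℝ u K) K w‖ * ‖v‖ * ‖v‖ :=
          ContinuousLinearMap.le_opNorm₂ _ _ _
      _ ≤ C * ‖v‖ * ‖v‖ := by gcongr; exact hb w hw
      _ = C * ‖v‖ ^ 2 := by ring
  -- The increment v serves as the direction and the step is 1, so the size of v enters only through
  -- the bound C‖v‖² on the second derivative.
  have := norm_second_diff_le (g := fun i r => (dirDeriv K v)^[i] u (z + r • v)) (h := 1)
    (C := C * ‖v‖ ^ 2) (by positivity)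
    (fun i hi r hr => hasDerivWithinAt_iterate hK hu hz i hi hr)
    (fun r hr => hiter _ (hz r hr)) 1 ⟨zero_le_one, le_rfl⟩
  simp only [Function.iterate_zero, id_eq, one_smul, neg_smul, zero_smul, add_zero, one_pow,
    mul_one, ← sub_eq_add_neg] at this
  linarith

end SecondDifferences

/-! ### Accuracy of the discrete bulk energy of the exact solution -/

section EnergyConsistency

variable {d : ℕ} {P : Params} {T : ℝ} {Qe : ℝ → (Fin d → ℝ) → Matrix (Fin d) (Fin d) ℝ}

/-- Near the boundary the exact solution is of the order of the distance to the boundary. -/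
lemma IsExactSolution.exists_norm_le_near_boundary (h : IsExactSolution P T Qe) (hℓ : 0 < P.ℓ)
    (hT : 0 < T) : ∃ C, 0 ≤ C ∧ ∀ t ∈ Set.Icc 0 T, ∀ x ∈ cube d P.ℓ, ∀ ε,
      (∃ k, x k ≤ ε ∨ P.ℓ - ε ≤ x k) → ‖Qe t x‖ ≤ C * ε := by
  have hK := uniqueDiffOn_cylinder (d := d) hℓ hT
  have hc := isCompact_cylinder d P.ℓ T
  choose C hC H using fun k : Fin d =>
    exists_norm_sub_le hK hc (by norm_num) h.contDiffOn (0, Pi.single k 1)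
  have hle : ∀ k, C k ≤ ∑ k, C k := fun k =>
    Finset.single_le_sum (fun k _ => hC k) (Finset.mem_univ k)
  refine ⟨∑ k, C k, Finset.sum_nonneg fun k _ => hC k, fun t ht x hx ε => ?_⟩
  rintro ⟨k, hk⟩
  have hxk := mem_cube.1 hx k
  have hmem : ∀ r, 0 ≤ x k + r → x k + r ≤ P.ℓ → x + r • Pi.single k 1 ∈ cube d P.ℓ := by
    intro r h1 h2
    refine mem_cube.2 fun j => ?_
    by_cases hj : j = k
    · subst hj; simpa using ⟨h1, h2⟩
    · simpa [Pi.single_eq_of_ne hj] using mem_cube.1 hx j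
  rcases hk with hk | hk
  -- The point is joined to the nearby face along the k-th axis, and the solution vanishes at the
  -- foot.
  · have h0 : Qe t (x + (-x k) • Pi.single k 1) = 0 :=
      h.dirichlet t ht _ (hmem _ (by linarith) (by linarith)) ⟨k, Or.inl (by simp)⟩
    have h1 := H k (t, x + (-x k) • Pi.single k 1) (x k) hxk.1 fun r hr => by
      refine ⟨by simpa using ht, ?_⟩
      have := hmem (-x k + r) (by linarith [hr.1]) (by linarith [hr.2])
      simpa [add_smul, add_assoc] using this
    have e : ((t, x + (-x k) • Pi.single k 1) : ℝ × (Fin d → ℝ)) + x k • (0, Pi.single k 1)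
        = (t, x) := by simp
    rw [e] at h1
    simp only [spaceTime, h0, sub_zero] at h1
    refine h1.trans ?_
    exact mul_le_mul (hle k) hk hxk.1 ((hC k).trans (hle k))
  · have h0 : Qe t (x + (P.ℓ - x k) • Pi.single k 1) = 0 :=
      h.dirichlet t ht _ (hmem _ (by linarith) (by linarith)) ⟨k, Or.inr (by simp)⟩
    have h1 := H k (t, x) (P.ℓ - x k) (by linarith) fun r hr => by
      refine ⟨by simpa using ht, ?_⟩
      simpa using hmem r (by linarith [hr.1]) (by linarith [hr.2])
    have e : ((t, x) : ℝ × (Fin d → ℝ)) + (P.ℓ - x k) • (0, Pi.single k 1)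
        = (t, x + (P.ℓ - x k) • Pi.single k 1) := by simp
    rw [e] at h1
    simp only [spaceTime, h0, zero_sub, norm_neg] at h1
    refine h1.trans ?_
    exact mul_le_mul (hle k) (by linarith) (by linarith) ((hC k).trans (hle k))

/-- The discrete bulk energy of the exact solution is second-order accurate. -/
theorem IsExactSolution.exists_abs_bulkEnergy_sub_le (h : IsExactSolution P T Qe)
    (hℓ : 0 < P.ℓ) (hT : 0 < T) {R Λ₀ : ℝ}
    (hR : ∀ z ∈ cylinder d P.ℓ T, ‖spaceTime Qe z‖ ≤ R) (hΛ₀ : 0 ≤ Λ₀)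
    (hF : ForceBounds d P R Λ₀) :
    ∃ K, 0 ≤ K ∧ ∀ M : ℕ, 0 < M → ∀ t ∈ Set.Icc 0 T,
      |discBulkEnergy P M (nodalValues P M Qe t) - bulkEnergy P (Qe t)| ≤ K * (P.ℓ / M) ^ 2 := by
  have hK := uniqueDiffOn_cylinder (d := d) hℓ hT
  have hc := isCompact_cylinder d P.ℓ T
  have hG : ContDiffOn ℝ (4 : ℕ) (fun z => bulkDensity P (spaceTime Qe z)) (cylinder d P.ℓ T) :=
    ContDiff.comp_contDiffOn (contDiff_bulkDensity P) h.contDiffOn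
  obtain ⟨C, hC, H⟩ := exists_norm_second_diff_le_sq hK hc (hG.of_le (by norm_num))
  obtain ⟨D, hD, HD⟩ := h.exists_norm_le_near_boundary hℓ hT
  refine ⟨2 * (C + Λ₀ * D ^ 2) * P.ℓ ^ d, by positivity, fun M hM t ht => ?_⟩
  have hM' : (0 : ℝ) < M := by exact_mod_cast hM
  have hh : 0 < P.ℓ / M := by positivity
  have hR0 : 0 ≤ R := (norm_nonneg _).trans (hR (t, 0) ⟨ht, mem_cube.2 fun k => ⟨le_rfl, hℓ.le⟩⟩)
  have e : discBulkEnergy P M (nodalValues P M Qe t) = (P.ℓ / M) ^ d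
      * ∑ p ∈ interiorNodes d M, bulkDensity P (Qe t (node P.ℓ M p)) := by
    unfold discBulkEnergy
    congr 1
    exact Finset.sum_congr rfl fun p hp => by simp only [nodalValues, hp, if_true]
  rw [e, abs_sub_comm, bulkEnergy]
  refine (abs_integral_cube_sub_sum_le hℓ hM (u := fun x => bulkDensity P (Qe t x))
    (B := (C + Λ₀ * D ^ 2) * (P.ℓ / M) ^ 2) ?_ (by positivity) ?_ ?_).trans (le_of_eq (by ring))
  · exact hG.continuousOn.comp (f := fun x => (t, x)) (by fun_prop) fun x hx => ⟨ht, hx⟩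
  · intro p hp x hx
    have hv : ‖((0, x - node P.ℓ M p) : ℝ × (Fin d → ℝ))‖ ≤ P.ℓ / M := by
      rw [Prod.norm_mk, norm_zero, max_eq_right (norm_nonneg _), pi_norm_le_iff_of_nonneg hh.le]
      intro k
      have h1 := hx.1 k
      have h2 := hx.2 k
      simp only [Pi.sub_apply, Pi.add_apply] at h1 h2 ⊢
      rw [Real.norm_eq_abs, abs_le]
      constructor <;> linarith
    have h1 := H (t, node P.ℓ M p) (0, x - node P.ℓ M p) fun r hr => by
      refine ⟨by simpa using ht, ?_⟩
      refine box_subset_cube hℓ hM hp ?_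
      have key : ∀ k, |r * (x k - node P.ℓ M p k)| ≤ P.ℓ / M / 2 := fun k => by
        have h1 := hx.1 k
        have h2 := hx.2 k
        simp only [Pi.sub_apply, Pi.add_apply] at h1 h2
        rw [abs_mul]
        have h3 : |r| ≤ 1 := abs_le.2 hr
        have h4 : |x k - node P.ℓ M p k| ≤ P.ℓ / M / 2 := by
          rw [abs_le]; constructor <;> linarith
        calc _ ≤ 1 * (P.ℓ / M / 2) := by gcongr
          _ = _ := one_mul _
      constructor <;> intro k
      · have := (abs_le.1 (key k)).1
        simp only [Prod.smul_mk, Prod.mk_add_mk, Pi.add_apply, Pi.sub_apply, Pi.smul_apply,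
          smul_eq_mul]
        linarith
      · have := (abs_le.1 (key k)).2
        simp only [Prod.smul_mk, Prod.mk_add_mk, Pi.add_apply, Pi.sub_apply, Pi.smul_apply,
          smul_eq_mul]
        linarith
    simp only [Prod.mk_add_mk, Prod.mk_sub_mk, add_zero, sub_zero, add_sub_cancel, spaceTime,
      smul_eq_mul, Real.norm_eq_abs, sub_sub_eq_add_sub] at h1
    refine h1.trans ?_
    have : 0 ≤ Λ₀ * D ^ 2 := by positivity
    gcongr
    · linarith
  · intro x hx hk
    have h1 := HD t ht x hx _ hk
    -- Both F and f vanish at 0, so F(Q) is quadratic in Q and hence O(h²) in the boundary layer.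
    have h2 := hF.density_one 0 (Qe t x) isQTensor_zero (h.isQTensor t ht x hx)
      (by simpa using hR0) (hR (t, x) ⟨ht, hx⟩)
    rw [bulkDensity_zero, bulkForce_zero, sub_zero, sub_zero] at h2
    simp only [frobInner, Matrix.zero_apply, zero_mul, Finset.sum_const_zero, add_zero] at h2
    calc _ ≤ Λ₀ * ‖Qe t x‖ ^ 2 := h2
      _ ≤ Λ₀ * (D * (P.ℓ / M)) ^ 2 := by gcongr
      _ ≤ (C + Λ₀ * D ^ 2) * (P.ℓ / M) ^ 2 := by
        have : 0 ≤ C * (P.ℓ / M) ^ 2 := by positivity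
        linarith

end EnergyConsistency

/-! ### Convergence -/

section Convergence

variable {d M : ℕ} {P : Params} {T : ℝ} {Qe : ℝ → (Fin d → ℝ) → Matrix (Fin d) (Fin d) ℝ}

lemma IsInitialValue.eq_nodalValues {Φ : GridTensor d} {s : ℝ}
    (h : IsInitialValue P M (Qe 0) Φ s) : Φ = nodalValues P M Qe 0 := by
  ext1 p
  unfold nodalValues
  split_ifs with hp
  · exact h.2.1 p hp
  · exact h.1.2 p hp

/-- The elastic energy of the nodal values is bounded uniformly in the mesh size. -/
lemma IsExactSolution.exists_discElasticEnergy_le (h : IsExactSolution P T Qe) (hℓ : 0 < P.ℓ)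
    (hT : 0 < T) (hL : 0 ≤ P.L) : ∃ K, ∀ M : ℕ, 0 < M →
      discElasticEnergy P M (nodalValues P M Qe 0) ≤ K := by
  have hK := uniqueDiffOn_cylinder (d := d) hℓ hT
  have hc := isCompact_cylinder d P.ℓ T
  choose C hC H using fun k : Fin d =>
    exists_norm_sub_le hK hc (by norm_num) h.contDiffOn (0, Pi.single k 1)
  refine ⟨P.L / 2 * (P.ℓ ^ d * ∑ k, C k ^ 2), fun M hM => ?_⟩
  have hM' : (0 : ℝ) < M := by exact_mod_cast hM
  have hh : 0 < P.ℓ / M := by positivity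
  have ht : (0 : ℝ) ∈ Set.Icc 0 T := ⟨le_rfl, hT.le⟩
  have hdiff : ∀ k, ∀ p ∈ cellNodes d M,
      ‖forwardDiff (P.ℓ / M) k (nodalValues P M Qe 0) p‖ ≤ C k := by
    intro k p hp
    have hp' := mem_cellNodes.1 hp
    have hcube : ∀ r ∈ Set.Icc 0 (P.ℓ / M), node P.ℓ M p + r • Pi.single k 1 ∈ cube d P.ℓ := by
      intro r hr
      refine mem_cube.2 fun j => ?_
      have hj1 := node_apply_mem hℓ hM j (hp' j).1 (hp' j).2.le
      by_cases hj : j = k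
      · subst hj
        have h2 := node_apply_mem (p := p + Pi.single j 1) hℓ hM j
          (by have := hp' j; simp; omega) (by have := hp' j; simp; omega)
        rw [node_add_single] at h2
        simp only [Pi.add_apply, Pi.smul_apply, Pi.single_eq_same, smul_eq_mul, mul_one] at h2 ⊢
        constructor <;> linarith [hr.1, hr.2]
      · simpa [Pi.single_eq_of_ne hj] using hj1
    have h1 : nodalValues P M Qe 0 p = spaceTime Qe (0, node P.ℓ M p) :=
      nodalValues_eq h hℓ hM ht fun j => ⟨(hp' j).1, (hp' j).2.le⟩
    have h2 : nodalValues P M Qe 0 (p + Pi.single k 1)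
        = spaceTime Qe ((0, node P.ℓ M p) + (P.ℓ / M) • (0, Pi.single k 1)) := by
      rw [nodalValues_eq h hℓ hM ht fun j => ?_, node_add_single]
      · simp [spaceTime]
      · have := hp' j
        by_cases hj : j = k
        · subst hj; simp; omega
        · simp [Pi.single_eq_of_ne hj]; omega
    have h3 := H k (0, node P.ℓ M p) (P.ℓ / M) hh.le fun r hr =>
      ⟨by simpa using ht, by simpa using hcube r hr⟩
    rw [forwardDiff, h1, h2, norm_smul, Real.norm_of_nonneg (by positivity)]
    calc _ ≤ (P.ℓ / M)⁻¹ * (C k * (P.ℓ / M)) := by gcongr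
      _ = C k := by field_simp
  rw [discElasticEnergy, gradNorm, Real.sq_sqrt (by positivity)]
  refine mul_le_mul_of_nonneg_left ?_ (by positivity)
  calc (P.ℓ / M) ^ d * ∑ k, ∑ p ∈ cellNodes d M, ∑ i, ∑ j,
        forwardDiff (P.ℓ / M) k (nodalValues P M Qe 0) p i j ^ 2
      ≤ (P.ℓ / M) ^ d * ∑ k, ∑ p ∈ cellNodes d M, C k ^ 2 := by
        gcongr with k _ p hp
        rw [← norm_sq_eq_sum]
        have := hdiff k p hp
        gcongr
    _ = P.ℓ ^ d * ∑ k, C k ^ 2 := by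
        simp only [Finset.sum_const, nsmul_eq_mul, card_cellNodes, ← Finset.mul_sum]
        rw [← mul_assoc, ← mul_pow, div_mul_cancel₀ _ hM'.ne']

/-- The nodal values of the exact solution fit into the error analysis, with constants that do not
depend on the mesh size. -/
theorem IsExactSolution.exists_errorSetting (h : IsExactSolution P T Qe) (hd : d = 2 ∨ d = 3)
    (hT : 0 < T) (hL : d = 3 → P.L₂ + P.L₃ = 0) (hP : StableData d P (maxBound P (Qe 0))) :
    ∃ R Λ K, 0 ≤ K ∧ ∀ M : ℕ, 0 < M → ∀ Φ s, IsInitialValue P M (Qe 0) Φ s →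
      ErrorSetting d P M (maxBound P (Qe 0)) (discElasticEnergy P M Φ + discBulkEnergy P M Φ)
        R Λ T (nodalValues P M Qe) ∧
      ∀ t ∈ Set.Icc 0 T, |discBulkEnergy P M (nodalValues P M Qe t) - bulkEnergy P (Qe t)|
        ≤ K * (P.ℓ / M) ^ 2 := by
  have hℓ := hP.ℓ_pos
  obtain ⟨R₀, hR₀, hb⟩ := exists_bound_of_contDiffOn (isCompact_cylinder d P.ℓ T) h.contDiffOn
  set η := maxBound P (Qe 0)
  set R := max η R₀
  have hR : ∀ z ∈ cylinder d P.ℓ T, ‖spaceTime Qe z‖ ≤ R := fun z hz =>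
    (hb z hz).trans (le_max_right _ _)
  have hR0 : 0 ≤ R := hR₀.trans (le_max_right _ _)
  obtain ⟨Λ₁, h1, hF⟩ := exists_forceBounds d P hR0
  obtain ⟨Λ₂, h2, hcons⟩ := h.exists_isConsistent hd hℓ hT hP.L_pos.le hL hR h1 hF
  obtain ⟨K, hK, hquad⟩ := h.exists_abs_bulkEnergy_sub_le hℓ hT hR h1 hF
  obtain ⟨K₁, hel⟩ := h.exists_discElasticEnergy_le hℓ hT hP.L_pos.le
  -- A bound for G^* independent of the mesh: the bulk energy is controlled by the quadrature
  -- estimate at time 0 together with h ≤ ℓ.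
  set G := Real.exp (K₁ + (bulkEnergy P (Qe 0) + K * P.ℓ ^ 2) + P.Cstar)
  have hG : 0 < G := Real.exp_pos _
  have hκ := hP.κ_nonneg
  have hv := Real.sqrt_nonneg (P.ℓ ^ d)
  set v := √(P.ℓ ^ d)
  refine ⟨R, 1 + R + P.κ + v + T + G + Λ₁ + Λ₂, K, hK, fun M hM Φ s hΦ =>
    ⟨⟨hP, hM, by linarith, le_max_left _ _, by linarith, by linarith, by linarith, by linarith,
      ?_, hF.mono (by linarith), (hcons M hM).mono (by linarith)⟩, hquad M hM⟩⟩
  have hM' : (1 : ℝ) ≤ M := by exact_mod_cast hM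
  have e1 : discElasticEnergy P M Φ ≤ K₁ := hΦ.eq_nodalValues (Qe := Qe) ▸ hel M hM
  have e2 : discBulkEnergy P M Φ ≤ bulkEnergy P (Qe 0) + K * P.ℓ ^ 2 := by
    rw [hΦ.eq_nodalValues]
    have a1 := (abs_le.1 (hquad M hM 0 ⟨le_rfl, hT.le⟩)).2
    have a2 : K * (P.ℓ / M) ^ 2 ≤ K * P.ℓ ^ 2 := by
      gcongr
      exact div_le_self hℓ.le hM'
    linarith
  have e3 : Real.exp (discElasticEnergy P M Φ + discBulkEnergy P M Φ + P.Cstar) ≤ G :=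
    Real.exp_le_exp.2 (by linarith)
  linarith

/-- The initial values are admissible. -/
lemma IsExactSolution.isAdmissible_initial (h : IsExactSolution P T Qe) (hT : 0 < T)
    (hP : StableData d P (maxBound P (Qe 0))) (hM : 0 < M) {Φ : GridTensor d} {s : ℝ}
    (hΦ : IsInitialValue P M (Qe 0) Φ s) :
    IsAdmissible P M (maxBound P (Qe 0)) (discElasticEnergy P M Φ + discBulkEnergy P M Φ) Φ s where
  grid := hΦ.1
  norm_le p := by
    by_cases hp : p ∈ interiorNodes d M
    · obtain ⟨C, -, hb⟩ := exists_bound_of_contDiffOn (isCompact_cylinder d P.ℓ T) h.contDiffOn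
      have hbdd : BddAbove (Set.range fun x : cube d P.ℓ => frobNorm (Qe 0 x)) := by
        refine ⟨C, ?_⟩
        rintro _ ⟨x, rfl⟩
        exact (frobNorm_eq_norm _).trans_le <| hb (0, x) ⟨⟨le_rfl, hT.le⟩, x.2⟩
      rw [hΦ.2.1 p hp, ← frobNorm_eq_norm]
      refine le_trans ?_ (supNorm_le_maxBound P (Qe 0))
      exact le_ciSup hbdd ⟨node P.ℓ M p, node_mem_cube hP.ℓ_pos hM fun k =>
        ⟨(mem_interiorNodes.1 hp k).1.le, (mem_interiorNodes.1 hp k).2.le⟩⟩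
    · rw [hΦ.1.2 p hp, norm_zero]
      exact hP.η_nonneg
  cutoff_le := by
    have h1 := neg_Cstar_le_discBulkEnergy hP hM hΦ.1.1
    have h2 : 0 ≤ discElasticEnergy P M Φ := by
      have := hP.L_pos; unfold discElasticEnergy; positivity
    rw [hΦ.2.2]
    linarith
  energy_le := by rw [hΦ.2.2]

/-- Linearization at the exact values; the quadratic remainder is made linear by the maximum bound.
-/
lemma ErrorSetting.abs_discBulkEnergy_sub_le {η E₀ R Λ t s : ℝ} {F : ℝ → GridTensor d}
    (H : ErrorSetting d P M η E₀ R Λ T F) (ht : t ∈ Set.Icc 0 T) {Q : GridTensor d}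
    (hQ : IsAdmissible P M η E₀ Q s) :
    |discBulkEnergy P M Q - discBulkEnergy P M (F t)| ≤ 3 * Λ ^ 3 * errNorm P M Q (F t) := by
  have hΛ1 := H.one_le
  have hΛ := zero_le_one.trans hΛ1
  have hℓ := H.stable.ℓ_pos
  have hh : 0 ≤ P.ℓ / M := by positivity
  have h1 := QTensorFlow.abs_discBulkEnergy_sub_le (M := M) (Q := F t) (Q' := Q)
    (Φ := gridForce P (F t)) (K := Λ) (u := fun p => ‖Q p - F t p‖ ^ 2) hℓ fun p _ =>
      H.force.density_one _ _ ((H.cons.grid t ht).1 p) (hQ.grid.1 p) (H.cons.norm_le t ht p)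
        (hQ.norm_le_R H p)
  have h2 := norm_gridVec_sq (M := M) hh (Q - F t)
  simp only [Pi.sub_apply] at h2
  rw [← h2] at h1
  have h3 := abs_gridInner_le (M := M) hh (gridForce P (F t)) (Q - F t)
  have h4 := H.norm_force_le (H.cons.norm_le t ht)
  have h5 := H.norm_gridVec_le (Φ := Q - F t) (c := 2 * Λ) (by positivity) fun p _ =>
    (norm_sub_le _ _).trans (by linarith [hQ.norm_le_R H p, H.cons.norm_le t ht p, H.R_le])
  unfold errNorm
  set e := ‖gridVec (P.ℓ / M) M (Q - F t)‖
  have he : 0 ≤ e := norm_nonneg _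
  have h6 : |gridInner (P.ℓ / M) M (gridForce P (F t)) (Q - F t)| ≤ Λ ^ 3 * e :=
    h3.trans (by
      gcongr
      refine h4.trans ?_
      rw [← sq]
      exact pow_le_pow_right₀ hΛ1 (by norm_num))
  have h7 : Λ * e ^ 2 ≤ 2 * Λ ^ 3 * e := by
    calc Λ * e ^ 2 = Λ * e * e := by ring
      _ ≤ Λ * (2 * Λ * Λ) * e := by gcongr
      _ = _ := by ring
  rw [abs_le] at h1 h6 ⊢
  constructor <;> linarith [h1.1, h1.2, h6.1, h6.2]

/-- The total error in terms of the error against the nodal values. -/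
lemma IsExactSolution.totalError_le (h : IsExactSolution P T Qe) {η E₀ R Λ K t s : ℝ}
    (H : ErrorSetting d P M η E₀ R Λ T (nodalValues P M Qe))
    (hquad : ∀ t ∈ Set.Icc 0 T, |discBulkEnergy P M (nodalValues P M Qe t) - bulkEnergy P (Qe t)|
      ≤ K * (P.ℓ / M) ^ 2) (ht : t ∈ Set.Icc 0 T) {Q : GridTensor d}
    (hQ : IsAdmissible P M η E₀ Q s) :
    totalError P M Q s (Qe t) ≤ (1 + 3 * Λ ^ 3) * errNorm P M Q (nodalValues P M Qe t)
      + errGrad P M Q (nodalValues P M Qe t) + auxDefect P M Q s + K * (P.ℓ / M) ^ 2 := by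
  have hℓ := H.stable.ℓ_pos
  have hh : 0 ≤ P.ℓ / M := by positivity
  have heq : ∀ p : Fin d → ℤ, (∀ k, 0 ≤ p k ∧ p k ≤ M) →
      gridError P M Q (Qe t) p = (Q - nodalValues P M Qe t) p := fun p hp => by
    rw [Pi.sub_apply, nodalValues_eq h hℓ H.M_pos ht hp]; rfl
  have h1 : gridNorm (P.ℓ / M) M (gridError P M Q (Qe t))
      = errNorm P M Q (nodalValues P M Qe t) := by
    rw [← norm_gridVec hh, errNorm]
    congr 1
    exact gridVec_congr fun p hp => heq p fun k =>
      ⟨(mem_interiorNodes.1 hp k).1.le, (mem_interiorNodes.1 hp k).2.le⟩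
  have h2 : gradNorm (P.ℓ / M) M (gridError P M Q (Qe t))
      = errGrad P M Q (nodalValues P M Qe t) := by
    rw [errGrad, norm_gradVec hh, gradNorm, gradNorm]
    refine congrArg (fun r => √((P.ℓ / M) ^ d * r))
      (Finset.sum_congr rfl fun k _ => Finset.sum_congr rfl fun p hp => ?_)
    have hp' := mem_cellNodes.1 hp
    rw [forwardDiff, forwardDiff, heq p fun j => ⟨(hp' j).1, (hp' j).2.le⟩,
      heq (p + Pi.single k 1) fun j => ?_]
    have := hp' j
    by_cases hj : j = k
    · subst hj; simp; omega
    · simp [Pi.single_eq_of_ne hj]; omega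
  have h3 := H.abs_discBulkEnergy_sub_le ht hQ
  have h4 := hquad t ht
  have h5 := abs_add_three (s - discBulkEnergy P M Q)
    (discBulkEnergy P M Q - discBulkEnergy P M (nodalValues P M Qe t))
    (discBulkEnergy P M (nodalValues P M Qe t) - bulkEnergy P (Qe t))
  -- The error in s splits into the defect, the effect of the error in Q on the discrete energy, and
  -- the quadrature error.
  rw [show s - discBulkEnergy P M Q
    + (discBulkEnergy P M Q - discBulkEnergy P M (nodalValues P M Qe t))
    + (discBulkEnergy P M (nodalValues P M Qe t) - bulkEnergy P (Qe t)) = s - bulkEnergy P (Qe t)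
    by ring] at h5
  rw [totalError, h1, h2, auxDefect]
  linarith

/-- A one-step error recursion implies the error estimate. -/
lemma IsExactSolution.exists_totalError_le (h : IsExactSolution P T Qe) (hT : 0 < T)
    (hP : StableData d P (maxBound P (Qe 0))) (R Λ : ℝ) {K : ℝ} (hK : 0 ≤ K) (A : ℝ) :
    ∃ C, 0 < C ∧ ∀ (M : ℕ) (τ ρ : ℝ) (Q : ℕ → GridTensor d) (s : ℕ → ℝ), 0 < M → 0 < τ →
      (P.ℓ / M) ^ 2 ≤ ρ → IsInitialValue P M (Qe 0) (Q 0) (s 0) →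
      ErrorSetting d P M (maxBound P (Qe 0))
        (discElasticEnergy P M (Q 0) + discBulkEnergy P M (Q 0)) R Λ T (nodalValues P M Qe) →
      (∀ t ∈ Set.Icc 0 T, |discBulkEnergy P M (nodalValues P M Qe t) - bulkEnergy P (Qe t)|
        ≤ K * (P.ℓ / M) ^ 2) →
      (∀ n, IsAdmissible P M (maxBound P (Qe 0))
        (discElasticEnergy P M (Q 0) + discBulkEnergy P M (Q 0)) (Q n) (s n)) →
      (∀ n : ℕ, n * τ + τ ≤ T → ∃ δ, ErrorStep A P.L τ ρ
        (errNorm P M (Q n) (nodalValues P M Qe (n * τ)))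
        (errGrad P M (Q n) (nodalValues P M Qe (n * τ))) (auxDefect P M (Q n) (s n))
        (errNorm P M (Q (n + 1)) (nodalValues P M Qe (n * τ + τ)))
        (errGrad P M (Q (n + 1)) (nodalValues P M Qe (n * τ + τ)))
        (auxDefect P M (Q (n + 1)) (s (n + 1))) δ) →
      ∀ n : ℕ, n ≤ ⌊T / τ⌋₊ → totalError P M (Q n) (s n) (Qe (n * τ)) ≤ C * ρ := by
  obtain ⟨C, hC, HC⟩ := exists_gronwall_const A hP.L_pos hT
  -- The constant is chosen before any error setting is given, so Λ ≥ 1 is not yet available; hence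
  -- the absolute value.
  refine ⟨(1 + 3 * |Λ| ^ 3) * C + C + C + K, by positivity, ?_⟩
  intro M τ ρ Q s hM hτ hρ hinit H hquad hadm hstep n hn
  have hρ0 : 0 ≤ ρ := (sq_nonneg _).trans hρ
  have hnT : n * τ ≤ T := by
    rw [← le_div_iff₀ hτ]
    exact (Nat.cast_le.2 hn).trans (Nat.floor_le (by positivity))
  have h0 : Q 0 - nodalValues P M Qe ((0 : ℕ) * τ) = 0 := by
    rw [hinit.eq_nodalValues (Qe := Qe), Nat.cast_zero, zero_mul, sub_self]
  obtain ⟨h1, h2, h3⟩ := HC τ ρ (fun n => errNorm P M (Q n) (nodalValues P M Qe (n * τ)))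
    (fun n => errGrad P M (Q n) (nodalValues P M Qe (n * τ)))
    (fun n => auxDefect P M (Q n) (s n)) hτ hρ0 (fun _ => norm_nonneg _) (fun _ => abs_nonneg _)
    (by simp only [errNorm, h0, map_zero, norm_zero])
    (by simp only [errGrad, h0, map_zero, norm_zero])
    (by simp only [auxDefect, hinit.2.2, sub_self, abs_zero])
    (fun n hn => by
      rw [add_mul, one_mul] at hn
      simpa only [Nat.cast_add, Nat.cast_one, add_mul, one_mul] using hstep n hn) n hnT
  have h4 := h.totalError_le H hquad (t := n * τ) ⟨by positivity, hnT⟩ (hadm n)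
  have hΛ : |Λ| = Λ := abs_of_nonneg (zero_le_one.trans H.one_le)
  have hΛ0 : 0 ≤ Λ := zero_le_one.trans H.one_le
  have h5 : (1 + 3 * Λ ^ 3) * errNorm P M (Q n) (nodalValues P M Qe (n * τ))
      ≤ (1 + 3 * Λ ^ 3) * (C * ρ) := by gcongr
  have h6 : K * (P.ℓ / M) ^ 2 ≤ K * ρ := by gcongr
  rw [hΛ]
  linarith

end Convergence

end QTensorFlow

end

/-! ### Convergence of both schemes -/

theorem mainTheorem1 (d : ℕ) (hd : d = 2 ∨ d = 3) (P : QTensorFlow.Params) (T : ℝ) (hT : 0 < T)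
    (hℓ : 0 < P.ℓ) (hL₁ : 0 < P.L₁) (hL₂₃ : 0 ≤ P.L₂ + P.L₃) (hL : d = 3 → P.L₂ + P.L₃ = 0)
    (hb : 0 ≤ P.b) (hc : 0 < P.c)
    (hCstar : 0 < P.Cstar)
    (hbulk : ∀ A : Matrix (Fin d) (Fin d) ℝ, QTensorFlow.IsQTensor A →
      -P.Cstar ≤ P.ℓ ^ d * QTensorFlow.bulkDensity P A)
    (Qe : ℝ → (Fin d → ℝ) → Matrix (Fin d) (Fin d) ℝ)
    (hQe : QTensorFlow.IsExactSolution P T Qe)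
    (hκ : QTensorFlow.StabilizationCondition P (Qe 0)) :
    ∃ C : ℝ, 0 < C ∧ ∀ (M : ℕ) (τ : ℝ) (Q : ℕ → QTensorFlow.GridTensor d) (s : ℕ → ℝ),
      0 < M → 0 < τ →
      QTensorFlow.IsInitialValue P M (Qe 0) (Q 0) (s 0) →
      τ ≤ (P.κ * QTensorFlow.ratioBound P M (Q 0) / 2
            + 2 ^ (d - 1) * P.L / (P.ℓ / M) ^ 2)⁻¹ →
      ((∀ n, QTensorFlow.FirstOrderStep P M τ (Q n) (s n) (Q (n + 1)) (s (n + 1))) →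
        ∀ n : ℕ, n ≤ ⌊T / τ⌋₊ →
          QTensorFlow.totalError P M (Q n) (s n) (Qe (n * τ)) ≤ C * (τ + (P.ℓ / M) ^ 2)) ∧
      ((∀ n, QTensorFlow.SecondOrderStep P M τ (Q n) (s n) (Q (n + 1)) (s (n + 1))) →
        ∀ n : ℕ, n ≤ ⌊T / τ⌋₊ →
          QTensorFlow.totalError P M (Q n) (s n) (Qe (n * τ)) ≤
            C * (τ ^ 2 + (P.ℓ / M) ^ 2)) := by
  have hLpos : 0 < P.L := by unfold QTensorFlow.Params.L; linarith
  have hP : QTensorFlow.StableData d P (QTensorFlow.maxBound P (Qe 0)) :=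
    ⟨hd, hℓ, hLpos, QTensorFlow.kappa_nonneg hκ, hCstar, QTensorFlow.maxBound_nonneg P (Qe 0),
      hbulk, fun A hA hAη => QTensorFlow.norm_bulkForce_add_smul_le hd hb hc hκ hA hAη⟩
  obtain ⟨R, Λ, K, hK, hset⟩ := hQe.exists_errorSetting hd hT hL hP
  obtain ⟨C₁, hC₁, H₁⟩ := hQe.exists_totalError_le hT hP R Λ hK (10 * Λ ^ 5)
  obtain ⟨C₂, hC₂, H₂⟩ := hQe.exists_totalError_le hT hP R Λ hK (140 * Λ ^ 14)
  refine ⟨C₁ + C₂, by positivity, fun M τ Q s hM hτ hinit hstep => ?_⟩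
  obtain ⟨H, hquad⟩ := hset M hM _ _ hinit
  have hadm0 := hQe.isAdmissible_initial hT hP hM hinit
  refine ⟨fun hS n hn => ?_, fun hS n hn => ?_⟩
  · have hadm : ∀ n, QTensorFlow.IsAdmissible P M (QTensorFlow.maxBound P (Qe 0))
        (QTensorFlow.discElasticEnergy P M (Q 0) + QTensorFlow.discBulkEnergy P M (Q 0))
        (Q n) (s n) := fun n => by
      induction n with
      | zero => exact hadm0
      | succ n ih => exact (hS n).isAdmissible hP hτ ih
    refine (H₁ M τ (τ + (P.ℓ / M) ^ 2) Q s hM hτ (by linarith) hinit H hquad hadm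
      (fun n hn => (hS n).exists_errorStep H (by positivity) hτ hn (hadm n)) n hn).trans ?_
    gcongr
    linarith
  · have hadm : ∀ n, QTensorFlow.IsAdmissible P M (QTensorFlow.maxBound P (Qe 0))
        (QTensorFlow.discElasticEnergy P M (Q 0) + QTensorFlow.discBulkEnergy P M (Q 0))
        (Q n) (s n) := fun n => by
      induction n with
      | zero => exact hadm0
      | succ n ih =>
        obtain ⟨Qs, ss, h1, h2⟩ := (hS n).exists_corrector
        exact h2.isAdmissible hP hM hτ hstep ih (h1.isAdmissible hP (by positivity) ih)
    -- `ratioBound` unfolds to exp(E₀ + C_*) with E₀ the initial discrete energy, so `hstep` is the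
    -- step size condition of the corrector.
    refine (H₂ M τ (τ ^ 2 + (P.ℓ / M) ^ 2) Q s hM hτ (by linarith [sq_nonneg τ]) hinit H hquad hadm
      (fun n hn => ((hS n).exists_errorStep H (by positivity) hτ hn hstep (hadm n)).2) n
      hn).trans ?_
    gcongr
    linarith
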